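/- Let $\mathcal A$ be a finite alphabet with $|\mathcal A|\ge 2$, let $\mathcal A^*$ be the set of finite strings over $\mathcal A$, and let $(p_\alpha)_{\alpha\in\mathcal A}$ be a probability distribution on $\mathcal A$ with $p_\alpha>0$ for all $\alpha$. The \emph{trie} generated by a finite set $S$ of infinite strings over $\mathcal A$ is the set $T\subset\mathcal A^*$ of all $\boldsymbol\alpha\in\mathcal A^*$ such that, with $n_{\boldsymbol\alpha}$ the number of strings in $S$ having prefix $\boldsymbol\alpha$, either $n_{\boldsymbol\alpha}\ge2$, or $n_{\boldsymbol\alpha}=1$ and $\boldsymbol\alpha$ is either the empty string or has a parent $\boldsymbol\beta$ ($\boldsymbol\alpha$ with its last letter removed) with $n_{\boldsymbol\beta}\ge2$. For a trie $T$ and $v\in\mathcal A^*$, the fringe tree is the trie $T^v=\{\boldsymbol\beta\in\mathcal A^*: v\boldsymbol\beta\in T\}$. Let $\varphi$ be a real-valued function on the set of all tries (a toll function) with $\varphi(\emptyset)=0$, and let $\Phi(T)=\sum_{v\in T}\varphi(T^v)$ be the corresponding additive functional. For $\lambda>0$ let $T_\lambda$ be the random trie generated by $\Xi^{(1)},\dots,\Xi^{(N_\lambda)}$,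 where $\Xi^{(1)},\Xi^{(2)},\dots$ are i.i.d. infinite strings whose letters are i.i.d. with distribution $(p_\alpha)$, and $N_\lambda\sim\mathrm{Po}(\lambda)$ is independent of the strings. For real random variables $X_\lambda,Y_\lambda$, write $X_\lambda\overset{d}{\approx}Y_\lambda$ (as $\lambda\to\infty$) if $\mathbb E f(X_\lambda)=\mathbb E f(Y_\lambda)+o(1)$ for every bounded continuous $f:\mathbb R\to\mathbb R$. This holds \emph{with all (absolute) moments of order $s<r$} if moreover $\mathbb E|X_\lambda|^s=\mathbb E|Y_\lambda|^s+o(1)$ for every real $0<s<r$ and $\mathbb E X_\lambda^k=\mathbb E Y_\lambda^k+o(1)$ for every integer $1\le k<r$, all these moments being finite for large $\lambda$; convergence of all (absolute) moments of order $s<r$ is defined in the same way, with $Y_\lambda$ replaced by the limit. We write $N(0,\sigma^2)$ also for a random variable with that distribution, and read $N(0,v)$ as the point mass at $0$ if $v\le0$. Let $a(\lambda)$ and $b(\lambda)$ be real-valued functions, and suppose that for some real $r>2$, as $\lambda\to\infty$, \begin{align*} \mathbb E\,\Phi(T_\lambda)&=a(\lambda)+o(\sqrt\lambda),\\ \operatorname{Var}\Phi(T_\lambda)&=b(\lambda)+o(\lambda),\\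 \operatorname{Var}\Phi(T_\lambda)&=O(\lambda),\\ \operatorname{Var}\varphi(T_\lambda)&=o(\lambda),\\ \mathbb E\,|\varphi(T_\lambda)-\mathbb E\,\varphi(T_\lambda)|^r&=O(\lambda^{r/2}), \end{align*} where the last expectation is finite for all large $\lambda$. (i) Then, as $\lambda\to\infty$, $$\frac{\Phi(T_\lambda)-a(\lambda)}{\sqrt\lambda}\overset{d}{\approx}N\bigl(0,b(\lambda)/\lambda\bigr) \quad\text{and}\quad \frac{\Phi(T_\lambda)-\mathbb E\,\Phi(T_\lambda)}{\sqrt\lambda}\overset{d}{\approx}N\bigl(0,\operatorname{Var}[\Phi(T_\lambda)]/\lambda\bigr),$$ in both cases with all (absolute) moments of order $s<r$. (ii) Suppose further that $b(\lambda)=\Omega(\lambda)$, i.e. that there is $c>0$ with $b(\lambda)\ge c\lambda$ for all large $\lambda$. Then, as $\lambda\to\infty$, $$\frac{\Phi(T_\lambda)-a(\lambda)}{\sqrt{b(\lambda)}}\overset{d}{\longrightarrow}N(0,1) \quad\text{and}\quad \frac{\Phi(T_\lambda)-\mathbb E\,\Phi(T_\lambda)}{\sqrt{\operatorname{Var}\Phi(T_\lambda)}}\overset{d}{\longrightarrow}N(0,1),$$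 in both cases with convergence of all (absolute) moments of order $s<r$. -/

import Mathlib

open MeasureTheory ProbabilityTheory Filter Topology Asymptotics
open scoped NNReal ENNReal BoundedContinuousFunction

noncomputable section

namespace Tries

/-- The finite string `α` is a prefix of the infinite string `ξ`. -/
def IsPrefixOf {A : Type*} (α : List A) (ξ : ℕ → A) : Prop :=
  ∀ i : Fin α.length, α.get i = ξ i

open Classical in
/-- The number of strings in the set `S` that have `α` as a prefix. -/
def prefixCount {A : Type*} (S : Finset (ℕ → A)) (α : List A) : ℕ :=
  (S.filter (IsPrefixOf α)).card

/-- `α` is a node of the trie generated by the finite set `S` of infinite strings: either at least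
two strings pass through `α` (internal node), or exactly one does and `α` is the root or its parent
`α.dropLast` is an internal node (external node). -/
def IsTrieNode {A : Type*} (S : Finset (ℕ → A)) (α : List A) : Prop :=
  2 ≤ prefixCount S α ∨
    (prefixCount S α = 1 ∧ (α = [] ∨ 2 ≤ prefixCount S α.dropLast))

/-- A finite set of nodes is a trie if it is generated by some finite set of infinite strings. -/
def IsTrie {A : Type*} (T : Finset (List A)) : Prop :=
  ∃ S : Finset (ℕ → A), ∀ α, α ∈ T ↔ IsTrieNode S α

/-- The set of all tries over the alphabet `A`, each identified with its set of nodes. -/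
abbrev Trie (A : Type*) : Type _ := {T : Finset (List A) // IsTrie T}

lemma exists_separating_length {A : Type*} (S : Finset (ℕ → A)) :
    ∃ L : ℕ, ∀ ξ ∈ S, ∀ η ∈ S, (∀ i < L, ξ i = η i) → ξ = η := by
  have h : ∀ q : (ℕ → A) × (ℕ → A), ∃ L : ℕ, (∀ i < L, q.1 i = q.2 i) → q.1 = q.2 := by
    intro q
    by_cases hq : q.1 = q.2
    · exact ⟨0, fun _ => hq⟩
    · obtain ⟨i, hi⟩ := Function.ne_iff.mp hq
      exact ⟨i + 1, fun h => absurd (h i (Nat.lt_succ_self i)) hi⟩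
  choose f hf using h
  refine ⟨(S ×ˢ S).sup f, fun ξ hξ η hη h => hf (ξ, η) fun i hi => h i (lt_of_lt_of_le hi ?_)⟩
  exact Finset.le_sup (f := f) (Finset.mk_mem_product hξ hη)

lemma length_le_of_two_le_prefixCount {A : Type*} {S : Finset (ℕ → A)} {L : ℕ}
    (hL : ∀ ξ ∈ S, ∀ η ∈ S, (∀ i < L, ξ i = η i) → ξ = η) {α : List A}
    (h : 2 ≤ prefixCount S α) : α.length ≤ L := by
  classical
  by_contra! hlt
  obtain ⟨ξ, hξ, η, hη, hne⟩ := Finset.one_lt_card.mp (show 1 < _ from h)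
  rw [Finset.mem_filter] at hξ hη
  refine hne (hL ξ hξ.1 η hη.1 fun i hi => ?_)
  exact (hξ.2 ⟨i, hi.trans hlt⟩).symm.trans (hη.2 ⟨i, hi.trans hlt⟩)

lemma finite_trieNodes {A : Type*} [Finite A] (S : Finset (ℕ → A)) :
    {α | IsTrieNode S α}.Finite := by
  obtain ⟨L, hL⟩ := exists_separating_length S
  refine (List.finite_length_le A (L + 1)).subset ?_
  rintro α (h | ⟨-, rfl | h⟩)
  · exact (length_le_of_two_le_prefixCount hL h).trans (Nat.le_succ L)
  · simp
  · have := length_le_of_two_le_prefixCount hL h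
    rw [List.length_dropLast] at this
    simp only [Set.mem_ofPred_eq]
    omega

/-- The trie generated by the finite set `S` of infinite strings. -/
def trieOf {A : Type*} [Finite A] (S : Finset (ℕ → A)) : Trie A :=
  ⟨(finite_trieNodes S).toFinset, S, fun α => by simp⟩

/-- The empty trie. -/
def emptyTrie (A : Type*) : Trie A :=
  ⟨∅, ∅, fun α => by simp [IsTrieNode, prefixCount]⟩

lemma isPrefixOf_append {A : Type*} {α β : List A} {ξ : ℕ → A} :
    IsPrefixOf (α ++ β) ξ ↔ IsPrefixOf α ξ ∧ IsPrefixOf β (fun i => ξ (α.length + i)) := by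
  constructor
  · intro h
    refine ⟨fun i => ?_, fun i => ?_⟩
    · have := h ⟨i, by simp; omega⟩
      simpa [List.getElem_append_left] using this
    · have := h ⟨α.length + i, by simp⟩
      simpa [List.getElem_append_right] using this
  · rintro ⟨h₁, h₂⟩ ⟨i, hi⟩
    rw [List.length_append] at hi
    by_cases hlt : i < α.length
    · simpa [List.getElem_append_left, hlt] using h₁ ⟨i, hlt⟩
    · have := h₂ ⟨i - α.length, by omega⟩
      simp only [List.get_eq_getElem] at this ⊢
      rw [List.getElem_append_right (by omega), this]
      congr 1
      omega

lemma prefixCount_append_le {A : Type*} (S : Finset (ℕ → A)) (α β : List A) :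
    prefixCount S (α ++ β) ≤ prefixCount S α := by
  classical
  exact Finset.card_le_card
    (Finset.monotone_filter_right S fun ξ _ h => (isPrefixOf_append.mp h).1)

lemma exists_shifted {A : Type*} (S : Finset (ℕ → A)) (α : List A) :
    ∃ S' : Finset (ℕ → A), ∀ β, prefixCount S' β = prefixCount S (α ++ β) := by
  classical
  refine ⟨(S.filter (IsPrefixOf α)).image fun ξ i => ξ (α.length + i), fun β => ?_⟩
  unfold prefixCount
  rw [Finset.filter_image, Finset.card_image_of_injOn, Finset.filter_filter]
  · congr 1
    ext ξ
    simp only [Finset.mem_filter, isPrefixOf_append]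
  · intro ξ hξ η hη h
    simp only [Finset.coe_filter, Finset.mem_filter, Set.mem_ofPred_eq] at hξ hη
    funext i
    by_cases hi : i < α.length
    · exact (hξ.1.2 ⟨i, hi⟩).symm.trans (hη.1.2 ⟨i, hi⟩)
    · have := congrFun h (i - α.length)
      simpa [Nat.add_sub_cancel' (not_lt.mp hi)] using this

lemma isTrieNode_of_append {A : Type*} {S : Finset (ℕ → A)} {α β : List A}
    (h : IsTrieNode S (α ++ β)) : IsTrieNode S α := by
  by_cases hβ : β = []
  · simpa [hβ] using h
  · left
    rcases h with h | ⟨-, h | h⟩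
    · exact h.trans (prefixCount_append_le S α β)
    · simp [hβ] at h
    · rw [List.dropLast_append_of_ne_nil hβ] at h
      exact h.trans (prefixCount_append_le S α _)

lemma isTrie_fringe {A : Type*} {T : Finset (List A)} (hT : IsTrie T) (α : List A) :
    IsTrie (T.preimage (fun β => α ++ β) (List.append_right_injective α).injOn) := by
  obtain ⟨S, hS⟩ := hT
  by_cases hα : IsTrieNode S α
  · obtain ⟨S', hS'⟩ := exists_shifted S α
    refine ⟨S', fun β => ?_⟩
    rw [Finset.mem_preimage, hS]
    by_cases hβ : β = []
    · subst hβ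
      simp only [IsTrieNode, hS', List.append_nil]
      unfold IsTrieNode at hα
      tauto
    · simp only [IsTrieNode, hS', List.dropLast_append_of_ne_nil hβ, List.append_eq_nil_iff, hβ,
        and_false]
  · refine ⟨∅, fun β => ?_⟩
    rw [Finset.mem_preimage, hS]
    refine iff_of_false (fun h => hα (isTrieNode_of_append h)) ?_
    simp [IsTrieNode, prefixCount]

/-- The fringe tree `T^α = {β : αβ ∈ T}` of a trie, again a trie (empty if `α ∉ T`). -/
def fringe {A : Type*} (T : Trie A) (α : List A) : Trie A :=
  ⟨T.1.preimage (fun β => α ++ β) (List.append_right_injective α).injOn, isTrie_fringe T.2 α⟩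

/-- The additive functional with toll function `φ`: the sum of `φ(T^v)` over all nodes `v` of `T`. -/
def additiveFunctional {A : Type*} (φ : Trie A → ℝ) (T : Trie A) : ℝ :=
  ∑ v ∈ T.1, φ (fringe T v)

open Classical in
/-- The trie generated by the first `n` strings of the sequence `Ξ`. -/
def fixedTrie {A : Type*} [Finite A] (n : ℕ) (Ξ : ℕ → ℕ → A) : Trie A :=
  trieOf ((Finset.range n).image Ξ)

/-- The law of an i.i.d. sequence of infinite strings, with i.i.d. letters of distribution `p`. -/
def stringsLaw {A : Type*} [MeasurableSpace A] (p : PMF A) : Measure (ℕ → ℕ → A) :=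
  Measure.infinitePi fun _ : ℕ => Measure.infinitePi fun _ : ℕ => p.toMeasure

instance {A : Type*} [MeasurableSpace A] (p : PMF A) : IsProbabilityMeasure (stringsLaw p) := by
  unfold stringsLaw
  infer_instance

/-- The Poisson model: a pair `(N, Ξ)`, where `N` is Poisson distributed with mean `t` and
independent of the random strings `Ξ`. -/
def poissonModel {A : Type*} [MeasurableSpace A] (p : PMF A) (t : ℝ≥0) :
    Measure (ℕ × (ℕ → ℕ → A)) :=
  (poissonMeasure t).prod (stringsLaw p)

instance {A : Type*} [MeasurableSpace A] (p : PMF A) (t : ℝ≥0) :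
    IsProbabilityMeasure (poissonModel p t) := by
  unfold poissonModel
  infer_instance

/-- The random trie of the Poisson model, generated by the first `N` strings. -/
def poissonTrie {A : Type*} [Finite A] (ω : ℕ × (ℕ → ℕ → A)) : Trie A :=
  fixedTrie ω.1 ω.2

/-- The mean of `ψ` of the random trie in the Poisson model. -/
def poissonMean {A : Type*} [Finite A] [MeasurableSpace A] (p : PMF A) (ψ : Trie A → ℝ)
    (t : ℝ≥0) : ℝ :=
  ∫ ω, ψ (poissonTrie ω) ∂(poissonModel p t)

/-- The variance of `ψ` of the random trie in the Poisson model. -/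
def poissonVar {A : Type*} [Finite A] [MeasurableSpace A] (p : PMF A) (ψ : Trie A → ℝ)
    (t : ℝ≥0) : ℝ :=
  variance (fun ω => ψ (poissonTrie ω)) (poissonModel p t)

/-- `X i ≈ Y i` in distribution along the filter `l`: for every bounded continuous `f`,
`E f(X i) = E f(Y i) + o(1)`. -/
def ApproxInDistribution {ι Ω Ω' : Type*} [MeasurableSpace Ω] [MeasurableSpace Ω'] (l : Filter ι)
    (P : ι → Measure Ω) (X : ι → Ω → ℝ) (Q : ι → Measure Ω') (Y : ι → Ω' → ℝ) : Prop :=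
  ∀ f : ℝ →ᵇ ℝ,
    Tendsto (fun i => ∫ ω, f (X i ω) ∂(P i) - ∫ ω, f (Y i ω) ∂(Q i)) l (𝓝 0)

/-- `E |X i|^s = E |Y i|^s + o(1)` along `l`, with both sides finite. -/
def ApproxAbsMoment {ι Ω Ω' : Type*} [MeasurableSpace Ω] [MeasurableSpace Ω'] (l : Filter ι)
    (P : ι → Measure Ω) (X : ι → Ω → ℝ) (Q : ι → Measure Ω') (Y : ι → Ω' → ℝ) (s : ℝ) : Prop :=
  (∀ᶠ i in l, Integrable (fun ω => |X i ω| ^ s) (P i) ∧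
      Integrable (fun ω => |Y i ω| ^ s) (Q i)) ∧
    Tendsto (fun i => ∫ ω, |X i ω| ^ s ∂(P i) - ∫ ω, |Y i ω| ^ s ∂(Q i)) l (𝓝 0)

/-- `E (X i)^k = E (Y i)^k + o(1)` along `l`, with both sides finite. -/
def ApproxMoment {ι Ω Ω' : Type*} [MeasurableSpace Ω] [MeasurableSpace Ω'] (l : Filter ι)
    (P : ι → Measure Ω) (X : ι → Ω → ℝ) (Q : ι → Measure Ω') (Y : ι → Ω' → ℝ) (k : ℕ) : Prop :=
  (∀ᶠ i in l, Integrable (fun ω => X i ω ^ k) (P i) ∧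
      Integrable (fun ω => Y i ω ^ k) (Q i)) ∧
    Tendsto (fun i => ∫ ω, X i ω ^ k ∂(P i) - ∫ ω, Y i ω ^ k ∂(Q i)) l (𝓝 0)

/-- Approximation along `l` of all absolute moments of real order `0 < s < r`, and of all ordinary moments of
integer order `1 ≤ k < r`. -/
def ApproxMomentsBelow {ι Ω Ω' : Type*} [MeasurableSpace Ω] [MeasurableSpace Ω'] (l : Filter ι)
    (P : ι → Measure Ω) (X : ι → Ω → ℝ) (Q : ι → Measure Ω') (Y : ι → Ω' → ℝ) (r : ℝ) : Prop :=
  (∀ s : ℝ, 0 < s → s < r → ApproxAbsMoment l P X Q Y s) ∧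
    ∀ k : ℕ, 1 ≤ k → (k : ℝ) < r → ApproxMoment l P X Q Y k

end Tries

end

/-! Splitting a trie at its root gives `Φ(T) = φ(T) + ∑ x, Φ(T^x)`. When the number of strings is
`Po(t)`, the subtries `T^x` are independent, and `T^x` is distributed as the Poisson trie with
parameter `p x * t`. The toll can be changed so that it vanishes on tries generated by at most one
string, which makes this recursion hold without exceptions.

Write `Φ*` for `Φ(T)` centred and divided by `√t`. The recursion for `Φ*` has the weights
`√(p x)`, and it contracts `r`-th moments, up to lower order terms, because
`∑ x, (p x) ^ (r / 2) < 1`; hence `Φ*` is bounded in `L^r`. The same recursion, applied to the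
characteristic function, contracts its distance from the Gaussian characteristic function of the
same variance, relative to `|u| ^ s` with `2 < s ≤ 3`, because `∑ x, (p x) ^ (s / 2) < 1`: the toll
is negligible, and a third-order Taylor expansion controls what is left. So that distance tends to
`0`, which is convergence in distribution by Lévy's continuity theorem, and boundedness in `L^r`
upgrades it to convergence of all moments of order below `r`. -/

noncomputable section

namespace Tries

section Moments

lemma rpow_le_rpow_add_mul_sub {r x y : ℝ} (hr : 1 ≤ r) (hx : 0 ≤ x) (hy : 0 < y) :
    y ^ r ≤ x ^ r + r * y ^ (r - 1) * (y - x) := by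
  have bernoulli := one_add_mul_self_le_rpow_one_add (s := x / y - 1)
    (by have := div_nonneg hx hy.le; linarith) hr
  rw [add_sub_cancel, Real.div_rpow hx hy.le, le_div_iff₀ (by positivity)] at bernoulli
  have hpow : y ^ r = y ^ (r - 1) * y := by
    rw [← Real.rpow_add_one hy.ne', sub_add_cancel]
  have hexpand : (1 + r * (x / y - 1)) * y ^ r = y ^ r - r * y ^ (r - 1) * (y - x) := by
    rw [hpow]
    field_simp
    ring
  linarith

/-- Compare the sum `S` with the largest term `x k`: convexity gives
`S ^ r - x k ^ r ≤ r * S ^ (r - 1) * (S - x k)`, and `S` is at most `card ι * x k`. -/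
lemma sum_rpow_le {ι : Type*} [Fintype ι] [DecidableEq ι] {r : ℝ} (hr : 1 ≤ r)
    {x : ι → ℝ} (hx : ∀ i, 0 ≤ x i) :
    (∑ i, x i) ^ r ≤ ∑ i, x i ^ r + r * (Fintype.card ι : ℝ) ^ (r - 1) *
      ∑ i, ∑ j ∈ Finset.univ.erase i, x i ^ (r - 1) * x j := by
  have hcross : ∀ i, 0 ≤ ∑ j ∈ Finset.univ.erase i, x i ^ (r - 1) * x j := fun i =>
    Finset.sum_nonneg fun j _ => mul_nonneg (Real.rpow_nonneg (hx i) _) (hx j)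
  rcases (Finset.sum_nonneg fun i (_ : i ∈ Finset.univ) => hx i).eq_or_lt with hzero | hpos
  · rw [← hzero, Real.zero_rpow (by linarith)]
    have hpowers := Finset.sum_nonneg fun i (_ : i ∈ Finset.univ) => Real.rpow_nonneg (hx i) r
    have hcrosses := Finset.sum_nonneg fun i (_ : i ∈ Finset.univ) => hcross i
    positivity
  set S := ∑ i, x i with hS
  have hι : Nonempty ι := by
    by_contra hempty
    rw [not_nonempty_iff] at hempty
    simp [hS] at hpos
  obtain ⟨k, hk⟩ := Finite.exists_max x
  have hrest : S - x k = ∑ j ∈ Finset.univ.erase k, x j := by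
    rw [hS, ← Finset.add_sum_erase _ _ (Finset.mem_univ k), add_sub_cancel_left]
  have hrest_nonneg : 0 ≤ S - x k := hrest ▸ Finset.sum_nonneg fun i _ => hx i
  have hS_le : S ≤ Fintype.card ι * x k := by
    rw [hS, ← nsmul_eq_mul, ← Finset.card_univ]
    exact Finset.sum_le_card_nsmul _ _ _ fun i _ => hk i
  calc S ^ r ≤ x k ^ r + r * S ^ (r - 1) * (S - x k) := rpow_le_rpow_add_mul_sub hr (hx k) hpos
    _ ≤ x k ^ r + r * (Fintype.card ι * x k) ^ (r - 1) * (S - x k) := by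
        have : 0 ≤ r - 1 := by linarith
        gcongr
    _ = x k ^ r + r * (Fintype.card ι : ℝ) ^ (r - 1) *
          ∑ j ∈ Finset.univ.erase k, x k ^ (r - 1) * x j := by
        rw [Real.mul_rpow (by positivity) (hx k), hrest, ← Finset.mul_sum]
        ring
    _ ≤ _ := by
        gcongr
        · exact Finset.single_le_sum (f := fun i => x i ^ r)
            (fun i _ => Real.rpow_nonneg (hx i) r) (Finset.mem_univ k)
        · exact Finset.single_le_sum (f := fun i => ∑ j ∈ Finset.univ.erase i, x i ^ (r - 1) * x j)
            (fun i _ => hcross i) (Finset.mem_univ k)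

lemma sum_sum_erase_rpow_mul_le {ι : Type*} [Fintype ι] [DecidableEq ι] {s b v : ℝ} {x y : ι → ℝ}
    (hs : 0 ≤ s) (hx : ∀ i, 0 ≤ x i) (hxb : ∀ i, x i ≤ b) (hy : ∀ i, 0 ≤ y i)
    (hyv : ∀ i, y i ≤ v) :
    ∑ i, ∑ j ∈ Finset.univ.erase i, x i ^ s * y j ≤ (Fintype.card ι : ℝ) ^ 2 * (b ^ s * v) := by
  have hterm : ∀ i j, x i ^ s * y j ≤ b ^ s * v := fun i j => by
    have hb := hy j
    have := hx i
    have := (hx i).trans (hxb i)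
    gcongr
    · exact hxb i
    · exact hyv j
  calc _ ≤ ∑ i, ∑ j, x i ^ s * y j := Finset.sum_le_sum fun i _ =>
        Finset.sum_le_sum_of_subset_of_nonneg (Finset.subset_univ _) fun j _ _ =>
          mul_nonneg (Real.rpow_nonneg (hx i) s) (hy j)
    _ ≤ ∑ _i : ι, ∑ _j : ι, b ^ s * v :=
        Finset.sum_le_sum fun i _ => Finset.sum_le_sum fun j _ => hterm i j
    _ = _ := by
        simp only [Finset.sum_const, Finset.card_univ, nsmul_eq_mul]
        ring

lemma eventually_add_rpow_inv_le {r ρ : ℝ} (hr : 0 < r) (hρ : 0 ≤ ρ) (hρ1 : ρ < 1) {B : ℝ}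
    (hB : 0 ≤ B) (C : ℝ) :
    ∀ᶠ K in atTop, C + (ρ * K ^ r + B * K ^ (r - 1)) ^ r⁻¹ ≤ K := by
  have hlim : Tendsto (fun K : ℝ => C / K + (ρ + B / K) ^ r⁻¹) atTop (𝓝 (0 + (ρ + 0) ^ r⁻¹)) :=
    (tendsto_id.const_div_atTop C).add
      (((tendsto_id.const_div_atTop B).const_add ρ).rpow_const (Or.inr (by positivity)))
  have hlt : 0 + (ρ + 0) ^ r⁻¹ < 1 := by
    simpa using Real.rpow_lt_one hρ hρ1 (inv_pos.mpr hr)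
  filter_upwards [hlim.eventually_lt_const hlt, eventually_gt_atTop 0] with K hlt hK
  have hfactor : ρ * K ^ r + B * K ^ (r - 1) = K ^ r * (ρ + B / K) := by
    rw [Real.rpow_sub_one hK.ne']
    field_simp
  rw [hfactor, Real.mul_rpow (by positivity) (by positivity), Real.rpow_rpow_inv hK.le hr.ne']
  calc C + K * (ρ + B / K) ^ r⁻¹ = K * (C / K + (ρ + B / K) ^ r⁻¹) := by field_simp
    _ ≤ K := mul_le_of_le_one_right hK.le hlt.le

variable {Ω : Type*} [MeasurableSpace Ω] {μ : Measure Ω} {X : Ω → ℝ} {r : ℝ}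

lemma integral_abs_rpow_eq_lpNorm_rpow (hX : AEStronglyMeasurable X μ) (hr : 0 < r) :
    ∫ ω, |X ω| ^ r ∂μ = lpNorm X (ENNReal.ofReal r) μ ^ r := by
  rw [lpNorm_eq_integral_norm_rpow_toReal (by simpa using hr) ENNReal.ofReal_ne_top hX,
    ENNReal.toReal_ofReal hr.le, Real.rpow_inv_rpow _ hr.ne']
  · rfl
  · exact integral_nonneg fun ω => by positivity

lemma lpNorm_two_sub_integral [IsFiniteMeasure μ] (hX : MemLp X 2 μ) :
    lpNorm (fun ω => X ω - ∫ ω', X ω' ∂μ) 2 μ = √(Var[X; μ]) := by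
  have hcentred : MemLp (fun ω => X ω - ∫ ω', X ω' ∂μ) 2 μ := hX.sub (memLp_const _)
  rw [lpNorm_eq_integral_norm_rpow_toReal two_ne_zero ENNReal.ofNat_ne_top hcentred.1,
    variance_eq_integral hX.1.aemeasurable, Real.sqrt_eq_rpow]
  simp

lemma lpNorm_eq_of_identDistrib {Ω' : Type*} [MeasurableSpace Ω'] {ν : Measure Ω'} {Y : Ω' → ℝ}
    {p : ℝ≥0∞} (h : IdentDistrib X Y μ ν) : lpNorm X p μ = lpNorm Y p ν := by
  rw [← toReal_eLpNorm h.aemeasurable_fst.aestronglyMeasurable, h.eLpNorm_eq,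
    toReal_eLpNorm h.aemeasurable_snd.aestronglyMeasurable]

variable [IsProbabilityMeasure μ]

lemma lpNorm_le_lpNorm {p q : ℝ≥0∞} (hpq : p ≤ q) (hX : MemLp X q μ) :
    lpNorm X p μ ≤ lpNorm X q μ := by
  rw [← toReal_eLpNorm hX.1, ← toReal_eLpNorm hX.1]
  exact ENNReal.toReal_mono hX.eLpNorm_ne_top (eLpNorm_le_eLpNorm_of_exponent_le hpq hX.1)

lemma integrable_abs_rpow {s : ℝ} (hX : MemLp X (ENNReal.ofReal r) μ) (hs : 0 ≤ s)
    (hsr : s ≤ r) : Integrable (fun ω => |X ω| ^ s) μ := by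
  have h := (hX.mono_exponent (ENNReal.ofReal_le_ofReal hsr)).integrable_norm_rpow'
  simpa [ENNReal.toReal_ofReal hs] using h

lemma integral_abs_rpow_le_lpNorm_rpow {s : ℝ} (hX : MemLp X (ENNReal.ofReal r) μ)
    (hs : 0 < s) (hsr : s ≤ r) : ∫ ω, |X ω| ^ s ∂μ ≤ lpNorm X (ENNReal.ofReal r) μ ^ s := by
  rw [integral_abs_rpow_eq_lpNorm_rpow hX.1 hs]
  exact Real.rpow_le_rpow lpNorm_nonneg (lpNorm_le_lpNorm (ENNReal.ofReal_le_ofReal hsr) hX) hs.le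

lemma lpNorm_sub_integral_le (hr : 1 ≤ r) (hX : MemLp X (ENNReal.ofReal r) μ) :
    lpNorm (fun ω => X ω - ∫ ω', X ω' ∂μ) (ENNReal.ofReal r) μ ≤
      2 * lpNorm X (ENNReal.ofReal r) μ := by
  have hr' : 1 ≤ ENNReal.ofReal r := ENNReal.one_le_ofReal.mpr hr
  have hmean : |∫ ω, X ω ∂μ| ≤ lpNorm X (ENNReal.ofReal r) μ := by
    calc |∫ ω, X ω ∂μ| ≤ ∫ ω, ‖X ω‖ ∂μ := abs_integral_le_integral_abs
      _ = lpNorm X 1 μ := (lpNorm_one_eq_integral_norm hX.1).symm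
      _ ≤ lpNorm X (ENNReal.ofReal r) μ := lpNorm_le_lpNorm hr' hX
  calc _ ≤ lpNorm X (ENNReal.ofReal r) μ + lpNorm (fun _ : Ω => ∫ ω, X ω ∂μ) _ μ :=
        lpNorm_sub_le hX hr'
    _ ≤ _ := by
        rw [lpNorm_const (by positivity) (IsProbabilityMeasure.ne_zero μ), two_mul]
        simpa using hmean

lemma abs_covariance_le {Y : Ω → ℝ}
    (hX : MemLp X 2 μ) (hY : MemLp Y 2 μ) :
    |cov[X, Y; μ]| ≤ √(Var[X; μ] * Var[Y; μ]) := by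
  have hquad (c : ℝ) : 0 ≤ Var[Y; μ] * (c * c) + 2 * cov[X, Y; μ] * c + Var[X; μ] := by
    have hvar := variance_nonneg (X + c • Y) μ
    rw [variance_add hX (hY.const_smul c), covariance_smul_right, variance_smul] at hvar
    linarith
  have hdiscrim := discrim_le_zero hquad
  rw [discrim] at hdiscrim
  exact Real.abs_le_sqrt (by linarith)

lemma abs_variance_add_sub_le {Y : Ω → ℝ} (hX : MemLp X 2 μ) (hY : MemLp Y 2 μ) :
    |Var[fun ω => X ω + Y ω; μ] - Var[X; μ]| ≤ 2 * √(Var[X; μ] * Var[Y; μ]) + Var[Y; μ] := by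
  have hcov := abs_covariance_le hX hY
  have hY0 := variance_nonneg Y μ
  rw [variance_fun_add hX hY]
  rw [abs_le] at hcov ⊢
  constructor <;> linarith

section IndependentSums

variable {ι : Type*} [Fintype ι] {W : ι → Ω → ℝ}

omit [IsProbabilityMeasure μ] [Fintype ι] in
lemma indepFun_abs_rpow (hind : iIndepFun W μ) {i j : ι} (hij : i ≠ j) (s : ℝ) :
    IndepFun (fun ω => |W i ω| ^ s) (fun ω => |W j ω|) μ :=
  (hind.indepFun hij).comp (φ := fun x : ℝ => |x| ^ s) (ψ := fun x : ℝ => |x|)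
    (by fun_prop) (by fun_prop)

lemma integral_abs_sum_rpow_le [DecidableEq ι] (hr : 1 ≤ r) (hind : iIndepFun W μ)
    (hW : ∀ i, MemLp (W i) (ENNReal.ofReal r) μ) :
    ∫ ω, |∑ i, W i ω| ^ r ∂μ ≤ ∑ i, ∫ ω, |W i ω| ^ r ∂μ + r * (Fintype.card ι : ℝ) ^ (r - 1) *
      ∑ i, ∑ j ∈ Finset.univ.erase i, (∫ ω, |W i ω| ^ (r - 1) ∂μ) * ∫ ω, |W j ω| ∂μ := by
  have hpow : ∀ i, Integrable (fun ω => |W i ω| ^ r) μ := fun i =>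
    integrable_abs_rpow (hW i) (by linarith) le_rfl
  have hpow' : ∀ i, Integrable (fun ω => |W i ω| ^ (r - 1)) μ := fun i =>
    integrable_abs_rpow (hW i) (by linarith) (by linarith)
  have habs : ∀ i, Integrable (fun ω => |W i ω|) μ := fun i =>
    ((hW i).integrable (ENNReal.one_le_ofReal.mpr hr)).abs
  have hindep : ∀ i, ∀ j ∈ Finset.univ.erase i,
      IndepFun (fun ω => |W i ω| ^ (r - 1)) (fun ω => |W j ω|) μ := fun i j hj =>
    indepFun_abs_rpow hind (Finset.ne_of_mem_erase hj).symm _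
  have hcross : ∀ i, ∀ j ∈ Finset.univ.erase i,
      Integrable (fun ω => |W i ω| ^ (r - 1) * |W j ω|) μ := fun i j hj =>
    (hindep i j hj).integrable_mul (hpow' i) (habs j)
  have hpows : Integrable (fun ω => ∑ i, |W i ω| ^ r) μ := integrable_finsetSum _ fun i _ => hpow i
  have hcrosses : Integrable (fun ω => ∑ i, ∑ j ∈ Finset.univ.erase i,
      |W i ω| ^ (r - 1) * |W j ω|) μ :=
    integrable_finsetSum _ fun i _ => integrable_finsetSum _ fun j hj => hcross i j hj
  calc ∫ ω, |∑ i, W i ω| ^ r ∂μ ≤ ∫ ω, (∑ i, |W i ω| ^ r + r * (Fintype.card ι : ℝ) ^ (r - 1) *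
        ∑ i, ∑ j ∈ Finset.univ.erase i, |W i ω| ^ (r - 1) * |W j ω|) ∂μ := by
        refine integral_mono_of_nonneg (.of_forall fun ω => by positivity)
          (hpows.add (hcrosses.const_mul _)) (.of_forall fun ω => ?_)
        exact (Real.rpow_le_rpow (abs_nonneg _) (Finset.abs_sum_le_sum_abs _ _)
          (by linarith)).trans (sum_rpow_le hr fun i => abs_nonneg _)
    _ = _ := by
        rw [integral_add hpows (hcrosses.const_mul _), integral_finsetSum _ fun i _ => hpow i,
          integral_const_mul, integral_finsetSum _ fun i _ =>
            integrable_finsetSum _ fun j hj => hcross i j hj]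
        congr! 3 with i
        rw [integral_finsetSum _ (hcross i)]
        exact Finset.sum_congr rfl fun j hj => (hindep i j hj).integral_fun_mul_eq_mul_integral
          (hpow' i).aestronglyMeasurable (habs j).aestronglyMeasurable

lemma lpNorm_sum_rpow_le [DecidableEq ι] (hr : 1 < r) (hind : iIndepFun W μ)
    (hW : ∀ i, MemLp (W i) (ENNReal.ofReal r) μ) :
    lpNorm (fun ω => ∑ i, W i ω) (ENNReal.ofReal r) μ ^ r ≤
      ∑ i, lpNorm (W i) (ENNReal.ofReal r) μ ^ r + r * (Fintype.card ι : ℝ) ^ (r - 1) *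
        ∑ i, ∑ j ∈ Finset.univ.erase i,
          lpNorm (W i) (ENNReal.ofReal r) μ ^ (r - 1) * lpNorm (W j) 1 μ := by
  have hr0 : 0 < r := by linarith
  rw [← integral_abs_rpow_eq_lpNorm_rpow (memLp_finsetSum _ fun i _ => hW i).1 hr0]
  simp_rw [← integral_abs_rpow_eq_lpNorm_rpow (hW _).1 hr0, lpNorm_one_eq_integral_norm (hW _).1,
    Real.norm_eq_abs]
  refine (integral_abs_sum_rpow_le hr.le hind hW).trans ?_
  gcongr with i _ j _
  · exact integral_abs_rpow_le_lpNorm_rpow (hW i) (by linarith) (by linarith)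

lemma lpNorm_sum_le_of_indep (hr : 1 < r) (hind : iIndepFun W μ)
    (hW : ∀ i, MemLp (W i) (ENNReal.ofReal r) μ) {a K V ρ : ℝ} {w : ι → ℝ}
    (ha : 0 ≤ a) (hK : 0 ≤ K) (hV : 0 ≤ V) (hw0 : ∀ i, 0 ≤ w i) (hw1 : ∀ i, w i ≤ 1)
    (hwρ : ∑ i, w i ^ r ≤ ρ) (hWK : ∀ i, lpNorm (W i) (ENNReal.ofReal r) μ ≤ K * (w i * a))
    (hWV : ∀ i, lpNorm (W i) 1 μ ≤ V * a) :
    lpNorm (fun ω => ∑ i, W i ω) (ENNReal.ofReal r) μ ≤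
      (ρ * K ^ r + r * (Fintype.card ι : ℝ) ^ (r + 1) * V * K ^ (r - 1)) ^ r⁻¹ * a := by
  classical
  have hr0 : 0 < r := by linarith
  have hρ : 0 ≤ ρ := (Finset.sum_nonneg fun i _ => Real.rpow_nonneg (hw0 i) r).trans hwρ
  have hdiag : ∑ i, lpNorm (W i) (ENNReal.ofReal r) μ ^ r ≤ ρ * (K ^ r * a ^ r) := by
    calc _ ≤ ∑ i, (K * (w i * a)) ^ r := Finset.sum_le_sum fun i _ =>
          Real.rpow_le_rpow lpNorm_nonneg (hWK i) hr0.le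
      _ = (∑ i, w i ^ r) * (K ^ r * a ^ r) := by
          rw [Finset.sum_mul]
          refine Finset.sum_congr rfl fun i _ => ?_
          rw [Real.mul_rpow hK (mul_nonneg (hw0 i) ha), Real.mul_rpow (hw0 i) ha]
          ring
      _ ≤ _ := by gcongr
  have hcross := sum_sum_erase_rpow_mul_le (s := r - 1) (b := K * a) (v := V * a) (by linarith)
    (fun i => lpNorm_nonneg (f := W i) (p := ENNReal.ofReal r) (μ := μ))
    (fun i => (hWK i).trans (by gcongr; exact mul_le_of_le_one_left ha (hw1 i)))
    (fun i => lpNorm_nonneg) hWV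
  have hpow : lpNorm (fun ω => ∑ i, W i ω) (ENNReal.ofReal r) μ ^ r ≤
      (ρ * K ^ r + r * (Fintype.card ι : ℝ) ^ (r + 1) * V * K ^ (r - 1)) * a ^ r := by
    calc _ ≤ _ := lpNorm_sum_rpow_le hr hind hW
      _ ≤ ρ * (K ^ r * a ^ r) + r * (Fintype.card ι : ℝ) ^ (r - 1) *
            ((Fintype.card ι : ℝ) ^ 2 * ((K * a) ^ (r - 1) * (V * a))) := by gcongr
      _ = ρ * (K ^ r * a ^ r) + r * ((Fintype.card ι : ℝ) ^ (r - 1) * (Fintype.card ι : ℝ) ^ 2) *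
            V * K ^ (r - 1) * (a ^ (r - 1) * a) := by
          rw [Real.mul_rpow hK ha]
          ring
      _ = _ := by
          rw [← Real.rpow_add_one' ha (by linarith), sub_add_cancel, ← Real.rpow_add_natCast'
            (by positivity) (by push_cast; linarith), show r - 1 + ((2 : ℕ) : ℝ) = r + 1 by
              push_cast; ring]
          ring
  calc _ = (lpNorm (fun ω => ∑ i, W i ω) (ENNReal.ofReal r) μ ^ r) ^ r⁻¹ :=
        (Real.rpow_rpow_inv lpNorm_nonneg hr0.ne').symm
    _ ≤ _ := Real.rpow_le_rpow (Real.rpow_nonneg lpNorm_nonneg r) hpow (by positivity)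
    _ = _ := by rw [Real.mul_rpow (by positivity) (by positivity), Real.rpow_rpow_inv ha hr0.ne']

/-- When `∑ i, w i ^ r ≤ ρ < 1`, the constant of the conclusion is below `K` for large `K`, by
`eventually_add_rpow_inv_le`, so the recursion `Z = Y + ∑ i, W i` reproduces bounds. -/
lemma lpNorm_add_sum_le_of_indep (hr : 1 < r) (hind : iIndepFun W μ)
    (hW : ∀ i, MemLp (W i) (ENNReal.ofReal r) μ) {Y : Ω → ℝ} {a C K V ρ : ℝ} {w : ι → ℝ}
    (ha : 0 ≤ a) (hK : 0 ≤ K) (hV : 0 ≤ V) (hw0 : ∀ i, 0 ≤ w i) (hw1 : ∀ i, w i ≤ 1)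
    (hwρ : ∑ i, w i ^ r ≤ ρ) (hY : MemLp Y (ENNReal.ofReal r) μ)
    (hYC : lpNorm Y (ENNReal.ofReal r) μ ≤ C * a)
    (hWK : ∀ i, lpNorm (W i) (ENNReal.ofReal r) μ ≤ K * (w i * a))
    (hWV : ∀ i, lpNorm (W i) 1 μ ≤ V * a) :
    lpNorm (fun ω => Y ω + ∑ i, W i ω) (ENNReal.ofReal r) μ ≤
      (C + (ρ * K ^ r + r * (Fintype.card ι : ℝ) ^ (r + 1) * V * K ^ (r - 1)) ^ r⁻¹) * a := by
  rw [add_mul]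
  exact (lpNorm_add_le hY (ENNReal.one_le_ofReal.mpr hr.le)).trans
    (add_le_add hYC (lpNorm_sum_le_of_indep hr hind hW ha hK hV hw0 hw1 hwρ hWK hWV))

end IndependentSums

end Moments

section CharFun

/-- For `|y| ≤ 1` this is the bound by `|y| ^ 3`, for `|y| > 1` each term is at most `|y| ^ s`. -/
lemma norm_cexp_sub_taylor_le {s : ℝ} (hs : 2 ≤ s) (hs3 : s ≤ 3) (y : ℝ) :
    ‖Complex.exp (y * Complex.I) - (1 + y * Complex.I - y ^ 2 / 2)‖ ≤ 4 * |y| ^ s := by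
  have hnorm : ‖(y * Complex.I : ℂ)‖ = |y| := by simp
  rcases le_or_gt |y| 1 with hy | hy
  · have htaylor : ∑ m ∈ Finset.range 3, (y * Complex.I : ℂ) ^ m / m.factorial =
        1 + y * Complex.I - y ^ 2 / 2 := by
      simp [Finset.sum_range_succ, mul_pow, Complex.I_sq]
      ring
    have hbound := Complex.exp_bound (x := y * Complex.I) (hnorm.trans_le hy) (n := 3) (by norm_num)
    rw [htaylor, hnorm] at hbound
    have hcube : |y| ^ 3 ≤ |y| ^ s := by
      rw [← Real.rpow_natCast]
      exact Real.rpow_le_rpow_of_exponent_ge' (abs_nonneg y) hy (by linarith)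
        (by exact_mod_cast hs3)
    refine hbound.trans ?_
    have hcube_nonneg : 0 ≤ |y| ^ 3 := by positivity
    norm_num [Nat.factorial]
    linarith
  · have : 1 ≤ |y| ^ s := Real.one_le_rpow hy.le (by linarith)
    have hself : |y| ≤ |y| ^ s := Real.self_le_rpow_of_one_le hy.le (by linarith)
    have hsq : |y| ^ 2 ≤ |y| ^ s := by
      rw [← Real.rpow_natCast]
      exact Real.rpow_le_rpow_of_exponent_le hy.le (by exact_mod_cast hs)
    calc _ ≤ ‖Complex.exp (y * Complex.I)‖ + (‖(1 : ℂ)‖ + ‖(y * Complex.I : ℂ)‖ +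
          ‖((y : ℂ) ^ 2 / 2)‖) :=
          (norm_sub_le _ _).trans (add_le_add le_rfl ((norm_sub_le _ _).trans
            (add_le_add (norm_add_le _ _) le_rfl)))
      _ = 1 + (1 + |y| + |y| ^ 2 / 2) := by
          rw [Complex.norm_exp_ofReal_mul_I, hnorm, norm_one]
          simp
      _ ≤ 4 * |y| ^ s := by linarith

lemma abs_exp_neg_sub_one_sub_le {a s : ℝ} (ha : 0 ≤ a) (hs : 1 ≤ s) (hs2 : s ≤ 2) :
    |Real.exp (-a) - (1 - a)| ≤ a ^ s := by
  have hnonneg : 0 ≤ Real.exp (-a) - (1 - a) := by linarith [Real.add_one_le_exp (-a)]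
  rw [abs_of_nonneg hnonneg]
  rcases le_or_gt a 1 with h | h
  · have htaylor := Real.abs_exp_sub_one_sub_id_le (x := -a) (by rwa [abs_neg, abs_of_nonneg ha])
    have hpow : a ^ (2 : ℝ) ≤ a ^ s :=
      Real.rpow_le_rpow_of_exponent_ge' ha h (by linarith) hs2
    rw [neg_sq, ← Real.rpow_two] at htaylor
    linarith [le_abs_self (Real.exp (-a) - 1 - -a)]
  · have hexp : Real.exp (-a) ≤ 1 := Real.exp_le_one_iff.mpr (by linarith)
    linarith [Real.self_le_rpow_of_one_le h.le hs]

lemma abs_exp_neg_sub_exp_neg_le {a b : ℝ} (ha : 0 ≤ a) (hb : 0 ≤ b) :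
    |Real.exp (-a) - Real.exp (-b)| ≤ |a - b| := by
  wlog hab : a ≤ b generalizing a b
  · rw [abs_sub_comm, abs_sub_comm a]
    exact this hb ha (le_of_not_ge hab)
  have hfactor : Real.exp (-b) = Real.exp (-a) * Real.exp (-(b - a)) := by
    rw [← Real.exp_add]
    ring_nf
  have hexp : Real.exp (-a) ≤ 1 := Real.exp_le_one_iff.mpr (by linarith)
  rw [abs_of_nonneg (sub_nonneg.mpr (Real.exp_le_exp.mpr (by linarith))), abs_sub_comm,
    abs_of_nonneg (by linarith), hfactor]
  nlinarith [Real.add_one_le_exp (-(b - a)), Real.exp_pos (-a)]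

lemma norm_prod_sub_prod_le {ι : Type*} (s : Finset ι) {f g : ι → ℂ} (hf : ∀ i, ‖f i‖ ≤ 1)
    (hg : ∀ i, ‖g i‖ ≤ 1) : ‖∏ i ∈ s, f i - ∏ i ∈ s, g i‖ ≤ ∑ i ∈ s, ‖f i - g i‖ := by
  classical
  induction s using Finset.induction_on with
  | empty => simp
  | insert i s hi ih =>
    rw [Finset.prod_insert hi, Finset.prod_insert hi, Finset.sum_insert hi]
    have hprod : ‖∏ j ∈ s, f j‖ ≤ 1 := by
      rw [norm_prod]
      exact Finset.prod_le_one (fun _ _ => norm_nonneg _) fun j _ => hf j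
    calc ‖f i * ∏ j ∈ s, f j - g i * ∏ j ∈ s, g j‖ =
          ‖(f i - g i) * ∏ j ∈ s, f j + g i * (∏ j ∈ s, f j - ∏ j ∈ s, g j)‖ := by ring_nf
      _ ≤ ‖f i - g i‖ * ‖∏ j ∈ s, f j‖ + ‖g i‖ * ‖∏ j ∈ s, f j - ∏ j ∈ s, g j‖ := by
          rw [← norm_mul, ← norm_mul]
          exact norm_add_le _ _
      _ ≤ ‖f i - g i‖ * 1 + 1 * ∑ j ∈ s, ‖f j - g j‖ := by
          gcongr
          exact hg i
      _ = _ := by ring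

lemma norm_cexp_sub_cexp_le (x y : ℝ) :
    ‖Complex.exp (x * Complex.I) - Complex.exp (y * Complex.I)‖ ≤ |x - y| := by
  have hfactor : Complex.exp (x * Complex.I) - Complex.exp (y * Complex.I) =
      Complex.exp (y * Complex.I) * (Complex.exp (Complex.I * (x - y : ℝ)) - 1) := by
    rw [mul_sub, mul_one, ← Complex.exp_add]
    push_cast
    ring_nf
  rw [hfactor, norm_mul, Complex.norm_exp_ofReal_mul_I, one_mul]
  exact Real.norm_exp_I_mul_ofReal_sub_one_le

variable {Ω : Type*} [MeasurableSpace Ω] {μ : Measure Ω} {X Y : Ω → ℝ}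

lemma charFun_map_real (hX : AEMeasurable X μ) (u : ℝ) :
    charFun (μ.map X) u = ∫ ω, Complex.exp ((u * X ω : ℝ) * Complex.I) ∂μ := by
  rw [charFun_apply_real, integral_map hX (by fun_prop)]
  push_cast
  rfl

variable [IsProbabilityMeasure μ]

lemma integrable_cexp_mul_I (hX : AEMeasurable X μ) :
    Integrable (fun ω => Complex.exp (X ω * Complex.I)) μ := by
  refine Integrable.of_bound (C := 1) ?_ (.of_forall fun ω => ?_)
  · exact (Complex.measurable_exp.comp_aemeasurable
      ((Complex.measurable_ofReal.comp_aemeasurable hX).mul_const _)).aestronglyMeasurable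
  · rw [Complex.norm_exp_ofReal_mul_I]

lemma norm_charFun_map_sub_le (hX : AEMeasurable X μ) (hY : AEMeasurable Y μ)
    (hXY : Integrable (fun ω => X ω - Y ω) μ) (u : ℝ) :
    ‖charFun (μ.map X) u - charFun (μ.map Y) u‖ ≤ |u| * ∫ ω, |X ω - Y ω| ∂μ := by
  rw [charFun_map_real hX, charFun_map_real hY,
    ← integral_sub (integrable_cexp_mul_I (hX.const_mul u))
      (integrable_cexp_mul_I (hY.const_mul u)),
    ← integral_const_mul]
  refine norm_integral_le_of_norm_le (hXY.abs.const_mul _) (.of_forall fun ω => ?_)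
  refine (norm_cexp_sub_cexp_le _ _).trans_eq ?_
  rw [← mul_sub, abs_mul]

lemma integral_taylor_eq (hX : MemLp X 2 μ) (hmean : ∫ ω, X ω ∂μ = 0) (u : ℝ) :
    Integrable (fun ω => 1 + ((u * X ω : ℝ) : ℂ) * Complex.I - ((u * X ω : ℝ) : ℂ) ^ 2 / 2) μ ∧
      ∫ ω, (1 + ((u * X ω : ℝ) : ℂ) * Complex.I - ((u * X ω : ℝ) : ℂ) ^ 2 / 2) ∂μ =
        ((1 - u ^ 2 * (∫ ω, X ω ^ 2 ∂μ) / 2 : ℝ) : ℂ) := by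
  have hsq : ∀ ω, ((u * X ω : ℝ) : ℂ) ^ 2 / 2 = ((u ^ 2 / 2 * X ω ^ 2 : ℝ) : ℂ) := fun ω => by
    push_cast
    ring
  simp_rw [hsq]
  have hlinear : Integrable (fun ω => ((u * X ω : ℝ) : ℂ) * Complex.I) μ :=
    ((hX.integrable one_le_two).const_mul u).ofReal.mul_const _
  have haffine : Integrable (fun ω => 1 + ((u * X ω : ℝ) : ℂ) * Complex.I) μ :=
    (integrable_const _).add hlinear
  have hquadratic : Integrable (fun ω => ((u ^ 2 / 2 * X ω ^ 2 : ℝ) : ℂ)) μ :=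
    (hX.integrable_sq.const_mul (u ^ 2 / 2)).ofReal
  refine ⟨haffine.sub hquadratic, ?_⟩
  rw [integral_sub haffine hquadratic, integral_add (integrable_const _) hlinear,
    integral_mul_const, integral_complex_ofReal, integral_complex_ofReal, integral_const_mul,
    integral_const_mul, hmean]
  simp
  ring

lemma norm_charFun_map_sub_taylor_le {s : ℝ} (hs : 2 ≤ s) (hs3 : s ≤ 3)
    (hX : MemLp X (ENNReal.ofReal s) μ) (hmean : ∫ ω, X ω ∂μ = 0) (u : ℝ) :
    ‖charFun (μ.map X) u - (1 - u ^ 2 * (∫ ω, X ω ^ 2 ∂μ) / 2 : ℝ)‖ ≤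
      4 * (|u| * lpNorm X (ENNReal.ofReal s) μ) ^ s := by
  have hX2 : MemLp X 2 μ := hX.mono_exponent (by simpa using ENNReal.ofReal_le_ofReal hs)
  have hXm := hX.1.aemeasurable
  obtain ⟨htaylor_int, htaylor⟩ := integral_taylor_eq hX2 hmean u
  rw [charFun_map_real hXm, ← htaylor,
    ← integral_sub (integrable_cexp_mul_I (hXm.const_mul u)) htaylor_int,
    Real.mul_rpow (abs_nonneg u) lpNorm_nonneg,
    ← integral_abs_rpow_eq_lpNorm_rpow hX.1 (by linarith), ← mul_assoc, ← integral_const_mul]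
  refine norm_integral_le_of_norm_le
    ((integrable_abs_rpow hX (by linarith) le_rfl).const_mul _) (.of_forall fun ω => ?_)
  refine (norm_cexp_sub_taylor_le hs hs3 (u * X ω)).trans_eq ?_
  rw [abs_mul, Real.mul_rpow (abs_nonneg _) (abs_nonneg _)]
  ring

lemma norm_charFun_map_sub_gaussian_le {s : ℝ} (hs : 2 ≤ s) (hs3 : s ≤ 3)
    (hX : MemLp X (ENNReal.ofReal s) μ) (hmean : ∫ ω, X ω ∂μ = 0) (u : ℝ) :
    ‖charFun (μ.map X) u - Real.exp (-(u ^ 2 * (∫ ω, X ω ^ 2 ∂μ) / 2))‖ ≤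
      5 * (|u| * lpNorm X (ENNReal.ofReal s) μ) ^ s := by
  set m := ∫ ω, X ω ^ 2 ∂μ
  set L := lpNorm X (ENNReal.ofReal s) μ
  have : 0 ≤ m := integral_nonneg fun ω => sq_nonneg _
  have hL : 0 ≤ L := lpNorm_nonneg
  have hmL : m ≤ L ^ 2 := by simpa using integral_abs_rpow_le_lpNorm_rpow hX two_pos hs
  have hexp : ‖((1 - u ^ 2 * m / 2 : ℝ) : ℂ) - Real.exp (-(u ^ 2 * m / 2))‖ ≤ (|u| * L) ^ s := by
    rw [← Complex.ofReal_sub, Complex.norm_real, Real.norm_eq_abs, abs_sub_comm]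
    calc _ ≤ (u ^ 2 * m / 2) ^ (s / 2) :=
          abs_exp_neg_sub_one_sub_le (by positivity) (by linarith) (by linarith)
      _ ≤ ((|u| * L) ^ 2) ^ (s / 2) := by
          refine Real.rpow_le_rpow (by positivity) ?_ (by linarith)
          rw [mul_pow, sq_abs]
          exact (half_le_self (by positivity)).trans (by gcongr)
      _ = _ := by
          rw [← Real.rpow_natCast, ← Real.rpow_mul (by positivity)]
          congr 1
          push_cast
          ring
  calc _ ≤ _ := norm_sub_le_norm_sub_add_norm_sub _ ((1 - u ^ 2 * m / 2 : ℝ) : ℂ) _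
    _ ≤ 4 * (|u| * L) ^ s + (|u| * L) ^ s :=
        add_le_add (norm_charFun_map_sub_taylor_le hs hs3 hX hmean u) hexp
    _ = _ := by ring

end CharFun

section Normalized

variable {Ω : Type*} [MeasurableSpace Ω] {P : ℝ≥0 → Measure Ω} {X : Ω → ℝ} {t : ℝ≥0}

/-- The random variable `X`, centred by its mean under `P t` and divided by `√t`. For `t = 0` it
is `0`, by the convention on division. -/
def normalized (P : ℝ≥0 → Measure Ω) (X : Ω → ℝ) (t : ℝ≥0) (ω : Ω) : ℝ :=
  (X ω - ∫ ω', X ω' ∂(P t)) / √t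

lemma measurable_normalized (hX : Measurable X) : Measurable (normalized P X t) :=
  (hX.sub_const _).div_const _

lemma normalized_eq_inv_mul : normalized P X t = (√t)⁻¹ • (X · - ∫ ω, X ω ∂(P t)) :=
  funext fun _ => div_eq_inv_mul _ _

lemma memLp_normalized [IsFiniteMeasure (P t)] {p : ℝ≥0∞} (hX : MemLp X p (P t)) :
    MemLp (normalized P X t) p (P t) := by
  rw [normalized_eq_inv_mul]
  exact (hX.sub (memLp_const _)).const_smul _

lemma lpNorm_normalized (p : ℝ≥0∞) :
    lpNorm (normalized P X t) p (P t) = lpNorm (X · - ∫ ω, X ω ∂(P t)) p (P t) / √t := by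
  rw [normalized_eq_inv_mul, lpNorm_const_smul, div_eq_inv_mul,
    Real.nnnorm_of_nonneg (by positivity)]
  rfl

lemma integral_normalized [IsProbabilityMeasure (P t)] (hX : Integrable X (P t)) :
    ∫ ω, normalized P X t ω ∂(P t) = 0 := by
  simp only [normalized, integral_div, integral_sub hX (integrable_const _), integral_const,
    probReal_univ, one_smul, sub_self, zero_div]

lemma variance_normalized [IsProbabilityMeasure (P t)] (hX : AEStronglyMeasurable X (P t)) :
    Var[normalized P X t; P t] = Var[X; P t] / t := by
  rw [normalized_eq_inv_mul, variance_smul, variance_sub_const hX, inv_pow,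
    Real.sq_sqrt t.coe_nonneg, inv_mul_eq_div]

lemma integral_normalized_sq [IsProbabilityMeasure (P t)] (hX : MemLp X 2 (P t)) :
    ∫ ω, normalized P X t ω ^ 2 ∂(P t) = Var[X; P t] / t := by
  rw [← variance_normalized hX.aestronglyMeasurable, variance_of_integral_eq_zero
    (memLp_normalized hX).aemeasurable (integral_normalized (hX.integrable one_le_two))]

lemma lpNorm_two_normalized [IsProbabilityMeasure (P t)] (hX : MemLp X 2 (P t)) :
    lpNorm (normalized P X t) 2 (P t) = √(Var[X; P t] / t) := by
  rw [lpNorm_normalized, lpNorm_two_sub_integral hX, Real.sqrt_div (variance_nonneg _ _)]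

end Normalized

lemma sum_rpow_lt_one_of_sum_eq_one {ι : Type*} [Fintype ι] {q : ι → ℝ≥0} (hpos : ∀ i, 0 < q i)
    (hlt : ∀ i, q i < 1) (hsum : ∑ i, q i = 1) {s : ℝ} (hs : 1 < s) :
    ∑ i, (q i : ℝ) ^ s < 1 := by
  have : Nonempty ι := by
    by_contra! hι
    simp at hsum
  calc ∑ i, (q i : ℝ) ^ s < ∑ i, (q i : ℝ) :=
        Finset.sum_lt_sum_of_nonempty Finset.univ_nonempty fun i _ =>
          Real.rpow_lt_self_of_lt_one (hpos i) (hlt i) hs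
    _ = 1 := by exact_mod_cast hsum

/-- A family of random variables `Z`, under probability measures `P t`, that satisfies the
distributional recursion `Z = Y + ∑ x, W x`, where the `W x` are independent and `W x` under `P t`
is distributed as `Z` under `P (q x * t)`. The variance of `Z` is at most linear in `t`, and the
toll `Y` has variance `o(t)` and central `r`-th moment `O(t ^ (r / 2))`. -/
structure RecursiveFamily {A Ω : Type*} [Fintype A] [MeasurableSpace Ω] (q : A → ℝ≥0)
    (P : ℝ≥0 → Measure Ω) (Z Y : Ω → ℝ) (W : A → Ω → ℝ) (r : ℝ) : Prop where
  two_lt : 2 < r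
  sum_eq_one : ∑ x, q x = 1
  pos : ∀ x, 0 < q x
  lt_one : ∀ x, q x < 1
  isProbabilityMeasure : ∀ t, IsProbabilityMeasure (P t)
  measurable : Measurable Z
  measurable_child : ∀ x, Measurable (W x)
  decomp : ∀ ω, Z ω = Y ω + ∑ x, W x ω
  indep : ∀ t, iIndepFun W (P t)
  identDistrib_child : ∀ t x, IdentDistrib (W x) Z (P t) (P (q x * t))
  memLp : ∀ t, MemLp Z (ENNReal.ofReal r) (P t)
  bounded : ∀ t₀, ∃ C, ∀ t ≤ t₀, lpNorm Z (ENNReal.ofReal r) (P t) ≤ C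
  variance_le : ∃ V, ∀ᶠ t : ℝ≥0 in atTop, Var[Z; P t] / t ≤ V
  toll_variance : Tendsto (fun t : ℝ≥0 => Var[Y; P t] / t) atTop (𝓝 0)
  toll_moment : ∃ C, ∀ᶠ t : ℝ≥0 in atTop,
    lpNorm (normalized P Y t) (ENNReal.ofReal r) (P t) ≤ C

lemma forall_ge_of_forall_mul {A : Type*} [Finite A] [Nonempty A] {q : A → ℝ≥0}
    (hlt : ∀ x, q x < 1) {t₁ t₀ : ℝ≥0} (ht₀ : 0 < t₀) (ht₁ : ∀ x, t₁ ≤ q x * t₀)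
    {S : ℝ≥0 → Prop} (hbase : ∀ t, t₁ ≤ t → t ≤ t₀ → S t)
    (hrec : ∀ t, t₀ ≤ t → (∀ x, S (q x * t)) → S t) (t : ℝ≥0) (ht : t₁ ≤ t) : S t := by
  obtain ⟨k, hk⟩ := Finite.exists_max q
  have descent (n : ℕ) : ∀ t, t₁ ≤ t → q k ^ n * t ≤ t₀ → S t := by
    induction n with
    | zero => exact fun t htt₁ htt₀ => hbase t htt₁ (by simpa using htt₀)
    | succ n ih =>
      intro t htt₁ hn
      rcases le_total t t₀ with htt₀ | htt₀
      · exact hbase t htt₁ htt₀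
      refine hrec t htt₀ fun x => ih _ ((ht₁ x).trans (by gcongr)) (le_trans ?_ hn)
      calc q k ^ n * (q x * t) ≤ q k ^ n * (q k * t) := by gcongr; exact hk x
        _ = q k ^ (n + 1) * t := by ring
  have hlim : Tendsto (fun n : ℕ => q k ^ n * t) atTop (𝓝 (0 * t)) :=
    (tendsto_pow_atTop_nhds_zero_of_lt_one zero_le (hlt k)).mul_const t
  rw [zero_mul] at hlim
  obtain ⟨n, hn⟩ := (hlim.eventually_le_const ht₀).exists
  exact descent n t ht hn

namespace RecursiveFamily

variable {A Ω : Type*} [Fintype A] [MeasurableSpace Ω] {q : A → ℝ≥0} {P : ℝ≥0 → Measure Ω}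
  {Z Y : Ω → ℝ} {W : A → Ω → ℝ} {r : ℝ}

lemma nonempty (h : RecursiveFamily q P Z Y W r) : Nonempty A := by
  by_contra! hA
  simpa using h.sum_eq_one

lemma sum_rpow_lt_one (h : RecursiveFamily q P Z Y W r) {s : ℝ} (hs : 1 < s) :
    ∑ x, (q x : ℝ) ^ s < 1 :=
  sum_rpow_lt_one_of_sum_eq_one h.pos h.lt_one h.sum_eq_one hs

lemma tendsto_mul_atTop (h : RecursiveFamily q P Z Y W r) (x : A) :
    Tendsto (fun t : ℝ≥0 => q x * t) atTop atTop :=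
  tendsto_id.const_mul_atTop (h.pos x)

lemma two_le_ofReal (h : RecursiveFamily q P Z Y W r) : 2 ≤ ENNReal.ofReal r := by
  rw [← ENNReal.ofReal_ofNat]
  exact ENNReal.ofReal_le_ofReal h.two_lt.le

lemma memLp_two (h : RecursiveFamily q P Z Y W r) (t : ℝ≥0) : MemLp Z 2 (P t) :=
  have := h.isProbabilityMeasure t
  (h.memLp t).mono_exponent h.two_le_ofReal

lemma memLp_child (h : RecursiveFamily q P Z Y W r) (t : ℝ≥0) (x : A) :
    MemLp (W x) (ENNReal.ofReal r) (P t) :=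
  (h.identDistrib_child t x).memLp_iff.mpr (h.memLp _)

lemma memLp_toll (h : RecursiveFamily q P Z Y W r) (t : ℝ≥0) :
    MemLp Y (ENNReal.ofReal r) (P t) := by
  have htoll : Y = fun ω => Z ω - ∑ x, W x ω := funext fun ω => by rw [h.decomp]; ring
  rw [htoll]
  exact (h.memLp t).sub (memLp_finsetSum _ fun x _ => h.memLp_child t x)

lemma memLp_two_toll (h : RecursiveFamily q P Z Y W r) (t : ℝ≥0) : MemLp Y 2 (P t) :=
  have := h.isProbabilityMeasure t
  (h.memLp_toll t).mono_exponent h.two_le_ofReal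

lemma normalized_eq_add_sum (h : RecursiveFamily q P Z Y W r) (t : ℝ≥0) (ω : Ω) :
    normalized P Z t ω = normalized P Y t ω + ∑ x, normalized P (W x) t ω := by
  have := h.isProbabilityMeasure t
  have hW (x : A) : Integrable (W x) (P t) :=
    (h.memLp_child t x).integrable (one_le_two.trans h.two_le_ofReal)
  have hmean : ∫ ω, Z ω ∂(P t) = ∫ ω, Y ω ∂(P t) + ∑ x, ∫ ω, W x ω ∂(P t) := by
    simp_rw [h.decomp]
    rw [integral_add ((h.memLp_two_toll t).integrable one_le_two)
      (integrable_finsetSum _ fun x _ => hW x), integral_finsetSum _ fun x _ => hW x]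
  simp only [normalized]
  rw [hmean, h.decomp, ← Finset.sum_div, Finset.sum_sub_distrib]
  ring

lemma iIndepFun_normalized_child (h : RecursiveFamily q P Z Y W r) (t : ℝ≥0) :
    iIndepFun (fun x => normalized P (W x) t) (P t) :=
  (h.indep t).comp (fun x z => (z - ∫ ω, W x ω ∂(P t)) / √t) fun x => by fun_prop

lemma identDistrib_normalized_child (h : RecursiveFamily q P Z Y W r) (t : ℝ≥0) (x : A) :
    IdentDistrib (normalized P (W x) t) (√(q x) • normalized P Z (q x * t))
      (P t) (P (q x * t)) := by
  have hscale : √(q x) • normalized P Z (q x * t) =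
      fun ω => (Z ω - ∫ ω', Z ω' ∂(P (q x * t))) / √t := by
    funext ω
    have hx : √(q x : ℝ) ≠ 0 := (Real.sqrt_pos.mpr (h.pos x)).ne'
    simp only [Pi.smul_apply, smul_eq_mul, normalized, NNReal.coe_mul,
      Real.sqrt_mul (q x).coe_nonneg]
    field_simp
  have hident := (h.identDistrib_child t x).comp
    (u := fun z => (z - ∫ ω, W x ω ∂(P t)) / √t) (by fun_prop)
  rwa [(h.identDistrib_child t x).integral_eq, Function.comp_def, Function.comp_def, ← hscale,
    ← (h.identDistrib_child t x).integral_eq] at hident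

lemma lpNorm_normalized_child (h : RecursiveFamily q P Z Y W r) (t : ℝ≥0) (x : A) (p : ℝ≥0∞) :
    lpNorm (normalized P (W x) t) p (P t) =
      √(q x) * lpNorm (normalized P Z (q x * t)) p (P (q x * t)) := by
  rw [lpNorm_eq_of_identDistrib (h.identDistrib_normalized_child t x), lpNorm_const_smul,
    Real.nnnorm_of_nonneg (by positivity)]
  rfl

lemma variance_normalized_child (h : RecursiveFamily q P Z Y W r) (t : ℝ≥0) (x : A) :
    Var[normalized P (W x) t; P t] = q x * (Var[Z; P (q x * t)] / (q x * t : ℝ≥0)) := by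
  have := h.isProbabilityMeasure
  rw [(h.identDistrib_normalized_child t x).variance_eq, variance_smul,
    variance_normalized h.measurable.aestronglyMeasurable, Real.sq_sqrt (q x).coe_nonneg]

/-! ### Moments of recursive families -/

lemma lpNorm_normalized_le_of_child_le (h : RecursiveFamily q P Z Y W r) {t : ℝ≥0} {C K V : ℝ}
    (hK : 0 ≤ K) (hV : ∀ x, Var[Z; P (q x * t)] / (q x * t : ℝ≥0) ≤ V)
    (hC : lpNorm (normalized P Y t) (ENNReal.ofReal r) (P t) ≤ C)
    (hZK : ∀ x, lpNorm (normalized P Z (q x * t)) (ENNReal.ofReal r) (P (q x * t)) ≤ K) :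
    lpNorm (normalized P Z t) (ENNReal.ofReal r) (P t) ≤
      C + ((∑ x, (q x : ℝ) ^ (r / 2)) * K ^ r +
        r * (Fintype.card A : ℝ) ^ (r + 1) * √V * K ^ (r - 1)) ^ r⁻¹ := by
  have := h.isProbabilityMeasure
  have hsqrt (x : A) : √(q x : ℝ) ≤ 1 := Real.sqrt_le_one.mpr (h.lt_one x).le
  have hfirst (x : A) : lpNorm (normalized P (W x) t) 1 (P t) ≤ √V := by
    rw [h.lpNorm_normalized_child]
    calc _ ≤ lpNorm (normalized P Z (q x * t)) 1 (P (q x * t)) :=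
          mul_le_of_le_one_left lpNorm_nonneg (hsqrt x)
      _ ≤ lpNorm (normalized P Z (q x * t)) 2 (P (q x * t)) :=
          lpNorm_le_lpNorm one_le_two (memLp_normalized (h.memLp_two _))
      _ ≤ √V := by
          rw [lpNorm_two_normalized (h.memLp_two _)]
          exact Real.sqrt_le_sqrt (hV x)
  have hpow (x : A) : √(q x : ℝ) ^ r = (q x : ℝ) ^ (r / 2) :=
    (Real.rpow_div_two_eq_sqrt r (q x).coe_nonneg).symm
  rw [funext (h.normalized_eq_add_sum t)]
  simpa only [mul_one] using
    lpNorm_add_sum_le_of_indep (a := 1) (w := fun x => √(q x : ℝ)) (by linarith [h.two_lt])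
      (h.iIndepFun_normalized_child t) (fun x => memLp_normalized (h.memLp_child t x)) zero_le_one
      hK (Real.sqrt_nonneg V) (fun x => Real.sqrt_nonneg _) hsqrt
      (Finset.sum_le_sum fun x _ => (hpow x).le) (memLp_normalized (h.memLp_toll t))
      (by simpa using hC) (fun x => by
        rw [h.lpNorm_normalized_child, mul_one, mul_comm K]
        gcongr
        exact hZK x) (fun x => by simpa using hfirst x)

lemma exists_lpNorm_normalized_le_of_le (h : RecursiveFamily q P Z Y W r) (t₀ : ℝ≥0) :
    ∃ C, ∀ t, 1 ≤ t → t ≤ t₀ → lpNorm (normalized P Z t) (ENNReal.ofReal r) (P t) ≤ C := by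
  obtain ⟨C, hC⟩ := h.bounded t₀
  refine ⟨2 * C, fun t ht1 htt₀ => ?_⟩
  have := h.isProbabilityMeasure t
  rw [lpNorm_normalized]
  calc _ ≤ lpNorm (Z · - ∫ ω, Z ω ∂(P t)) (ENNReal.ofReal r) (P t) :=
        div_le_self lpNorm_nonneg (Real.one_le_sqrt.mpr (by exact_mod_cast ht1))
    _ ≤ 2 * lpNorm Z (ENNReal.ofReal r) (P t) :=
        lpNorm_sub_integral_le (by linarith [h.two_lt]) (h.memLp t)
    _ ≤ 2 * C := by gcongr; exact hC t htt₀

theorem exists_lpNorm_normalized_le (h : RecursiveFamily q P Z Y W r) :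
    ∃ K, 0 ≤ K ∧ ∀ᶠ t : ℝ≥0 in atTop,
      lpNorm (normalized P Z t) (ENNReal.ofReal r) (P t) ≤ K := by
  have := h.nonempty
  have hr := h.two_lt
  obtain ⟨V, hV⟩ := h.variance_le
  obtain ⟨C, hC⟩ := h.toll_moment
  obtain ⟨t₁, ht₁⟩ := eventually_atTop.mp ((hV.and hC).and (eventually_ge_atTop 1))
  obtain ⟨k, hk⟩ := Finite.exists_min q
  have ht₀ (x : A) : t₁ ≤ q x * (t₁ / q k) := by
    calc t₁ = q k * (t₁ / q k) := (mul_div_cancel₀ _ (h.pos k).ne').symm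
      _ ≤ q x * (t₁ / q k) := by gcongr; exact hk x
  obtain ⟨C₀, hC₀⟩ := h.exists_lpNorm_normalized_le_of_le (t₁ / q k)
  have hρ1 : ∑ x, (q x : ℝ) ^ (r / 2) < 1 := h.sum_rpow_lt_one (by linarith)
  obtain ⟨K, hKclosed, hKbase, hK0⟩ := ((eventually_add_rpow_inv_le (r := r)
    (B := r * (Fintype.card A : ℝ) ^ (r + 1) * √V) (by linarith)
    (Finset.sum_nonneg fun x _ => by positivity) hρ1 (by positivity) C).and
      ((eventually_ge_atTop C₀).and (eventually_ge_atTop 0))).exists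
  refine ⟨K, hK0, eventually_atTop.mpr ⟨t₁, ?_⟩⟩
  have hone_le : 1 ≤ t₁ := (ht₁ t₁ le_rfl).2
  refine forall_ge_of_forall_mul h.lt_one (div_pos (by positivity) (h.pos k)) ht₀
    (fun t htt₁ htt₀ => (hC₀ t (hone_le.trans htt₁) htt₀).trans hKbase) fun t ht hchild => ?_
  have hge (x : A) : t₁ ≤ q x * t := (ht₀ x).trans (by gcongr)
  have htt₁ : t₁ ≤ t := (hge k).trans (mul_le_of_le_one_left zero_le (h.lt_one k).le)
  exact (h.lpNorm_normalized_le_of_child_le hK0 (fun x => (ht₁ _ (hge x)).1.1) (ht₁ t htt₁).1.2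
    hchild).trans hKclosed

/-! ### Characteristic functions of recursive families -/

lemma abs_variance_sub_sum_le (h : RecursiveFamily q P Z Y W r) (t : ℝ≥0) :
    |Var[Z; P t] / t - ∑ x, q x * (Var[Z; P (q x * t)] / (q x * t : ℝ≥0))| ≤
      2 * √((∑ x, q x * (Var[Z; P (q x * t)] / (q x * t : ℝ≥0))) * (Var[Y; P t] / t)) +
        Var[Y; P t] / t := by
  have := h.isProbabilityMeasure t
  have hchild (x : A) : MemLp (normalized P (W x) t) 2 (P t) :=
    memLp_normalized ((h.memLp_child t x).mono_exponent h.two_le_ofReal)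
  have hsum : Var[fun ω => ∑ x, normalized P (W x) t ω; P t] =
      ∑ x, q x * (Var[Z; P (q x * t)] / (q x * t : ℝ≥0)) := by
    simp_rw [← h.variance_normalized_child]
    rw [← IndepFun.variance_sum (fun x _ => hchild x) fun x _ y _ hxy =>
      (h.iIndepFun_normalized_child t).indepFun hxy]
    exact congrArg (Var[·; P t]) (funext fun ω => (Finset.sum_apply ω _ _).symm)
  have hbound := abs_variance_add_sub_le (memLp_finsetSum Finset.univ fun x _ => hchild x)
    (memLp_normalized (h.memLp_two_toll t))
  simp_rw [add_comm _ (normalized P Y t _), ← h.normalized_eq_add_sum t] at hbound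
  rwa [hsum, variance_normalized h.measurable.aestronglyMeasurable,
    variance_normalized (h.memLp_toll t).aestronglyMeasurable] at hbound

lemma tendsto_variance_sub (h : RecursiveFamily q P Z Y W r) :
    Tendsto (fun t : ℝ≥0 => |Var[Z; P t] / t - ∑ x, q x * (Var[Z; P (q x * t)] / (q x * t : ℝ≥0))|)
      atTop (𝓝 0) := by
  obtain ⟨V, hV⟩ := h.variance_le
  have hchild : ∀ᶠ t : ℝ≥0 in atTop, ∀ x, Var[Z; P (q x * t)] / (q x * t : ℝ≥0) ≤ V :=
    eventually_all.mpr fun x => (h.tendsto_mul_atTop x).eventually hV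
  have hlim : Tendsto (fun t : ℝ≥0 => 2 * √(V * (Var[Y; P t] / t)) + Var[Y; P t] / t) atTop
      (𝓝 0) := by
    simpa using ((h.toll_variance.const_mul V).sqrt.const_mul 2).add h.toll_variance
  refine squeeze_zero' (.of_forall fun t => abs_nonneg _) ?_ hlim
  filter_upwards [hchild] with t ht
  refine (h.abs_variance_sub_sum_le t).trans ?_
  have hmean : ∑ x, q x * (Var[Z; P (q x * t)] / (q x * t : ℝ≥0)) ≤ V := by
    calc _ ≤ ∑ x, (q x : ℝ) * V := Finset.sum_le_sum fun x _ => by gcongr; exact ht x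
      _ = V := by rw [← Finset.sum_mul, ← NNReal.coe_sum, h.sum_eq_one, NNReal.coe_one, one_mul]
  gcongr
  exact div_nonneg (variance_nonneg Y (P t)) t.coe_nonneg

end RecursiveFamily

/-- The distance at `u` between the characteristic function of `Z`, normalized under `P t`, and that
of the centred normal distribution with the same variance. -/
def gaussianError {Ω : Type*} [MeasurableSpace Ω] (P : ℝ≥0 → Measure Ω) (Z : Ω → ℝ) (t : ℝ≥0)
    (u : ℝ) : ℝ :=
  ‖charFun ((P t).map (normalized P Z t)) u - Real.exp (-(u ^ 2 * (Var[Z; P t] / t) / 2))‖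

namespace RecursiveFamily

variable {A Ω : Type*} [Fintype A] [MeasurableSpace Ω] {q : A → ℝ≥0} {P : ℝ≥0 → Measure Ω}
  {Z Y : Ω → ℝ} {W : A → Ω → ℝ} {r : ℝ}

lemma exists_gaussianError_le (h : RecursiveFamily q P Z Y W r) {s : ℝ} (hs : 2 ≤ s)
    (hs3 : s ≤ 3) (hsr : s ≤ r) :
    ∃ C, ∀ᶠ t : ℝ≥0 in atTop, ∀ u : ℝ, gaussianError P Z t u ≤ C * |u| ^ s := by
  obtain ⟨K, hK0, hK⟩ := h.exists_lpNorm_normalized_le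
  refine ⟨5 * K ^ s, ?_⟩
  filter_upwards [hK] with t ht u
  have := h.isProbabilityMeasure t
  have hZ : MemLp (normalized P Z t) (ENNReal.ofReal r) (P t) := memLp_normalized (h.memLp t)
  have hexp : ENNReal.ofReal s ≤ ENNReal.ofReal r := ENNReal.ofReal_le_ofReal hsr
  have htaylor := norm_charFun_map_sub_gaussian_le hs hs3 (hZ.mono_exponent hexp)
    (integral_normalized ((h.memLp_two t).integrable one_le_two)) u
  rw [integral_normalized_sq (h.memLp_two t)] at htaylor
  calc gaussianError P Z t u
      ≤ 5 * (|u| * lpNorm (normalized P Z t) (ENNReal.ofReal s) (P t)) ^ s := htaylor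
    _ ≤ 5 * (|u| * K) ^ s := by
        gcongr
        · exact mul_nonneg (abs_nonneg u) lpNorm_nonneg
        · exact (lpNorm_le_lpNorm hexp hZ).trans ht
    _ = 5 * K ^ s * |u| ^ s := by rw [Real.mul_rpow (abs_nonneg u) hK0]; ring

lemma norm_charFun_sub_prod_le (h : RecursiveFamily q P Z Y W r) (t : ℝ≥0) (u : ℝ) :
    ‖charFun ((P t).map (normalized P Z t)) u -
      ∏ x, charFun ((P (q x * t)).map (normalized P Z (q x * t))) (√(q x) * u)‖ ≤
      |u| * √(Var[Y; P t] / t) := by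
  have := h.isProbabilityMeasure t
  have hW (x : A) : Measurable (normalized P (W x) t) :=
    measurable_normalized (h.measurable_child x)
  have hprod : charFun ((P t).map fun ω => ∑ x, normalized P (W x) t ω) u =
      ∏ x, charFun ((P (q x * t)).map (normalized P Z (q x * t))) (√(q x) * u) := by
    rw [(h.iIndepFun_normalized_child t).charFun_map_fun_sum_eq_prod fun x => (hW x).aemeasurable,
      Finset.prod_apply]
    refine Finset.prod_congr rfl fun x _ => ?_
    rw [(h.identDistrib_normalized_child t x).map_eq]
    exact charFun_map_mul_comp (measurable_normalized h.measurable).aemeasurable _ _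
  have htoll (ω : Ω) : normalized P Z t ω - ∑ x, normalized P (W x) t ω = normalized P Y t ω := by
    rw [h.normalized_eq_add_sum]
    ring
  have hY : MemLp (normalized P Y t) 2 (P t) := memLp_normalized (h.memLp_two_toll t)
  rw [← hprod]
  refine (norm_charFun_map_sub_le (measurable_normalized h.measurable).aemeasurable
    (Finset.measurable_fun_sum _ fun x _ => hW x).aemeasurable ?_ u).trans ?_
  · simpa only [htoll] using hY.integrable one_le_two
  · simp only [htoll]
    rw [← lpNorm_two_normalized (h.memLp_two_toll t)]
    gcongr
    simpa only [lpNorm_one_eq_integral_norm hY.aestronglyMeasurable, Real.norm_eq_abs] using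
      lpNorm_le_lpNorm one_le_two hY

lemma norm_prod_charFun_sub_le (h : RecursiveFamily q P Z Y W r) (t : ℝ≥0) (u : ℝ) :
    ‖∏ x, charFun ((P (q x * t)).map (normalized P Z (q x * t))) (√(q x) * u) - Real.exp
      (-(u ^ 2 * (∑ x, q x * (Var[Z; P (q x * t)] / (q x * t : ℝ≥0))) / 2))‖ ≤
      ∑ x, gaussianError P Z (q x * t) (√(q x) * u) := by
  have := h.isProbabilityMeasure
  have hprod : (Real.exp (-(u ^ 2 *
      (∑ x, q x * (Var[Z; P (q x * t)] / (q x * t : ℝ≥0))) / 2)) : ℂ) = ∏ x, (Real.exp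
      (-((√(q x) * u) ^ 2 * (Var[Z; P (q x * t)] / (q x * t : ℝ≥0)) / 2)) : ℂ) := by
    rw [← Complex.ofReal_prod, ← Real.exp_sum, Finset.sum_neg_distrib, ← Finset.sum_div,
      Finset.mul_sum]
    simp_rw [mul_pow, Real.sq_sqrt (NNReal.coe_nonneg _)]
    congr! 5
    ring
  rw [hprod]
  refine norm_prod_sub_prod_le _ (fun x => ?_) fun x => ?_
  · have := Measure.isProbabilityMeasure_map (μ := P (q x * t))
      (measurable_normalized (P := P) (t := q x * t) h.measurable).aemeasurable
    exact norm_charFun_le_one _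
  · rw [Complex.norm_real, Real.norm_eq_abs, Real.abs_exp, Real.exp_le_one_iff]
    have := variance_nonneg Z (P (q x * t))
    exact neg_nonpos.mpr (by positivity)

lemma gaussianError_le_add_sum (h : RecursiveFamily q P Z Y W r) (t : ℝ≥0) (u : ℝ) :
    gaussianError P Z t u ≤ |u| * √(Var[Y; P t] / t) +
      ∑ x, gaussianError P Z (q x * t) (√(q x) * u) + u ^ 2 / 2 *
        |Var[Z; P t] / t - ∑ x, q x * (Var[Z; P (q x * t)] / (q x * t : ℝ≥0))| := by
  set v := ∑ x, q x * (Var[Z; P (q x * t)] / (q x * t : ℝ≥0))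
  have hv : 0 ≤ v := Finset.sum_nonneg fun x _ => by
    have := variance_nonneg Z (P (q x * t))
    positivity
  have hexp : ‖(Real.exp (-(u ^ 2 * v / 2)) : ℂ) - Real.exp (-(u ^ 2 * (Var[Z; P t] / t) / 2))‖ ≤
      u ^ 2 / 2 * |Var[Z; P t] / t - v| := by
    rw [← Complex.ofReal_sub, Complex.norm_real, Real.norm_eq_abs]
    have := variance_nonneg Z (P t)
    refine (abs_exp_neg_sub_exp_neg_le (by positivity) (by positivity)).trans (le_of_eq ?_)
    rw [abs_sub_comm, ← abs_of_nonneg (by positivity : 0 ≤ u ^ 2 / 2), ← abs_mul]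
    congr 1
    ring
  calc gaussianError P Z t u
      ≤ _ := norm_sub_le_norm_sub_add_norm_sub _ (Real.exp (-(u ^ 2 * v / 2)) : ℂ) _
    _ ≤ _ := add_le_add ((norm_sub_le_norm_sub_add_norm_sub _ _ _).trans
      (add_le_add (h.norm_charFun_sub_prod_le t u) (h.norm_prod_charFun_sub_le t u))) hexp

/-- Each use of the recursion multiplies the bound `C * |u| ^ s` by `∑ x, q x ^ (s / 2)`. -/
lemma eventually_gaussianError_le (h : RecursiveFamily q P Z Y W r) {s C : ℝ}
    (hC : ∀ᶠ t : ℝ≥0 in atTop, ∀ u : ℝ, gaussianError P Z t u ≤ C * |u| ^ s) (n : ℕ) (u : ℝ)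
    {ε : ℝ} (hε : 0 < ε) : ∀ᶠ t : ℝ≥0 in atTop,
      gaussianError P Z t u ≤ C * (∑ x, (q x : ℝ) ^ (s / 2)) ^ n * |u| ^ s + ε := by
  induction n generalizing u ε with
  | zero => filter_upwards [hC] with t ht using by linarith [ht u]
  | succ n ih =>
    set ρ := ∑ x, (q x : ℝ) ^ (s / 2) with hρ
    set remainder : ℝ≥0 → ℝ := fun t => |u| * √(Var[Y; P t] / t) + u ^ 2 / 2 *
      |Var[Z; P t] / t - ∑ x, q x * (Var[Z; P (q x * t)] / (q x * t : ℝ≥0))|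
    have hremainder : Tendsto remainder atTop (𝓝 0) := by
      simpa [remainder] using (h.toll_variance.sqrt.const_mul |u|).add
        (h.tendsto_variance_sub.const_mul (u ^ 2 / 2))
    have := h.nonempty
    have hcard : (0 : ℝ) < Fintype.card A := by exact_mod_cast Fintype.card_pos
    have hchild : ∀ᶠ t : ℝ≥0 in atTop, ∀ x, gaussianError P Z (q x * t) (√(q x) * u) ≤
        C * ρ ^ n * |√(q x) * u| ^ s + ε / 2 / Fintype.card A :=
      eventually_all.mpr fun x => (h.tendsto_mul_atTop x).eventually
        (ih (√(q x) * u) (by positivity))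
    have hsum : ∑ x, (C * ρ ^ n * |√(q x) * u| ^ s + ε / 2 / Fintype.card A) =
        C * ρ ^ (n + 1) * |u| ^ s + ε / 2 := by
      rw [Finset.sum_add_distrib, Finset.sum_const, Finset.card_univ, nsmul_eq_mul,
        mul_div_cancel₀ _ hcard.ne', ← Finset.mul_sum]
      simp_rw [abs_mul, abs_of_nonneg (Real.sqrt_nonneg _),
        Real.mul_rpow (Real.sqrt_nonneg _) (abs_nonneg _),
        ← Real.rpow_div_two_eq_sqrt s (NNReal.coe_nonneg _)]
      rw [← Finset.sum_mul, ← hρ]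
      ring
    filter_upwards [hremainder.eventually_le_const (half_pos hε), hchild] with t hrem hchild
    have hle := (Finset.sum_le_sum fun x _ => hchild x).trans_eq hsum
    have hrec := h.gaussianError_le_add_sum t u
    simp only [remainder] at hrem
    linarith

theorem tendsto_gaussianError (h : RecursiveFamily q P Z Y W r) (u : ℝ) :
    Tendsto (fun t => gaussianError P Z t u) atTop (𝓝 0) := by
  obtain ⟨s, hs2, hs3, hsr⟩ : ∃ s, 2 < s ∧ s ≤ 3 ∧ s ≤ r :=
    ⟨min 3 r, lt_min (by norm_num) h.two_lt, min_le_left _ _, min_le_right _ _⟩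
  obtain ⟨C, hC⟩ := h.exists_gaussianError_le hs2.le hs3 hsr
  have hlim : Tendsto (fun n : ℕ => C * (∑ x, (q x : ℝ) ^ (s / 2)) ^ n * |u| ^ s) atTop (𝓝 0) := by
    simpa using ((tendsto_pow_atTop_nhds_zero_of_lt_one (Finset.sum_nonneg fun x _ => by positivity)
      (h.sum_rpow_lt_one (by linarith))).const_mul C).mul_const (|u| ^ s)
  rw [Metric.tendsto_nhds]
  intro ε hε
  obtain ⟨n, hn⟩ := (hlim.eventually_lt_const (half_pos hε)).exists
  filter_upwards [h.eventually_gaussianError_le hC n u (half_pos hε)] with t ht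
  rw [Real.dist_0_eq_abs, abs_of_nonneg (by exact norm_nonneg _)]
  linarith

end RecursiveFamily

/-! ### Gaussian approximation from characteristic functions -/

section Approximation

variable {ι Ω Ω' : Type*} [MeasurableSpace Ω] [MeasurableSpace Ω'] {l : Filter ι}
  {P : ι → Measure Ω} {X : ι → Ω → ℝ} {Q : ι → Measure Ω'} {Y : ι → Ω' → ℝ}

lemma charFun_gaussianReal_zero (v : ℝ≥0) (u : ℝ) :
    charFun (gaussianReal 0 v) u = Real.exp (-(u ^ 2 * v / 2)) := by
  rw [charFun_gaussianReal]
  push_cast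
  congr 1
  ring

/-- The centred normal distribution of variance `v`, as a point of the space of probability
measures with its weak topology. -/
def centredGaussian (v : ℝ≥0) : ProbabilityMeasure ℝ :=
  ⟨gaussianReal 0 v, inferInstance⟩

lemma continuous_centredGaussian : Continuous centredGaussian := by
  refine continuous_iff_seqContinuous.mpr fun v v₀ hv =>
    ProbabilityMeasure.tendsto_of_tendsto_charFun fun u => ?_
  simp only [Function.comp, centredGaussian, ProbabilityMeasure.coe_mk, charFun_gaussianReal_zero]
  have hcont : Continuous fun z : ℝ≥0 => ((Real.exp (-(u ^ 2 * z / 2)) : ℝ) : ℂ) := by fun_prop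
  exact (hcont.tendsto v₀).comp hv

lemma map_mul_centredGaussian (c : ℝ) (v : ℝ≥0) :
    (centredGaussian v).map (f := fun x => c * x + 0) (by fun_prop) =
      centredGaussian ((c ^ 2).toNNReal * v) := by
  refine Subtype.ext ?_
  simp only [centredGaussian, ProbabilityMeasure.map, ProbabilityMeasure.coe_mk, add_zero,
    gaussianReal_map_const_mul, mul_zero, Real.toNNReal_of_nonneg (sq_nonneg c)]

/-- The law of the affine image is the image of a product with a Dirac measure, which depends
continuously on all the data. -/
lemma tendsto_map_affine {μ : ι → ProbabilityMeasure ℝ} {μ₀ : ProbabilityMeasure ℝ}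
    (hμ : Tendsto μ l (𝓝 μ₀)) {c δ : ι → ℝ} {c₀ δ₀ : ℝ} (hc : Tendsto c l (𝓝 c₀))
    (hδ : Tendsto δ l (𝓝 δ₀)) :
    Tendsto (fun i => (μ i).map (f := fun x => c i * x + δ i) (by fun_prop)) l
      (𝓝 (μ₀.map (f := fun x => c₀ * x + δ₀) (by fun_prop))) := by
  have haffine : Continuous fun z : ℝ × ℝ × ℝ => z.2.1 * z.1 + z.2.2 := by fun_prop
  have map_prod_dirac (ν : ProbabilityMeasure ℝ) (a b : ℝ) :
      (ν.prod (diracProba (a, b))).map haffine.aemeasurable =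
        ν.map (f := fun x => a * x + b) (by fun_prop) := by
    refine Subtype.ext ?_
    simp only [ProbabilityMeasure.map, ProbabilityMeasure.prod, diracProba,
      ProbabilityMeasure.coe_mk, Measure.prod_dirac]
    exact Measure.map_map haffine.measurable (by fun_prop)
  simp only [← map_prod_dirac]
  have hpair := (continuous_diracProba.tendsto (c₀, δ₀)).comp (hc.prodMk_nhds hδ)
  exact ((ProbabilityMeasure.continuous_map haffine).tendsto _).comp
    ((ProbabilityMeasure.continuous_prod.tendsto (μ₀, _)).comp (hμ.prodMk_nhds hpair))

lemma tendsto_centredGaussian_of_tendsto_charFun_sub {μ : ℕ → ProbabilityMeasure ℝ}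
    {v : ℕ → ℝ≥0} {v₀ : ℝ≥0} (hv : Tendsto v atTop (𝓝 v₀))
    (hchar : ∀ u : ℝ, Tendsto (fun n => charFun (μ n : Measure ℝ) u -
      Real.exp (-(u ^ 2 * v n / 2))) atTop (𝓝 0)) :
    Tendsto μ atTop (𝓝 (centredGaussian v₀)) := by
  refine ProbabilityMeasure.tendsto_of_tendsto_charFun fun u => ?_
  have hlim := ProbabilityMeasure.tendsto_iff_tendsto_charFun.mp
    ((continuous_centredGaussian.tendsto v₀).comp hv) u
  simp only [Function.comp, centredGaussian, ProbabilityMeasure.coe_mk,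
    charFun_gaussianReal_zero v₀] at hlim ⊢
  simpa only [charFun_gaussianReal_zero, sub_add_cancel, zero_add] using (hchar u).add hlim

lemma approxInDistribution_affine_gaussianReal_of_tendsto {P : ℕ → Measure Ω}
    [∀ n, IsProbabilityMeasure (P n)] {X : ℕ → Ω → ℝ} (hX : ∀ n, Measurable (X n))
    {v w : ℕ → ℝ≥0} {v₀ : ℝ≥0} (hv : Tendsto v atTop (𝓝 v₀))
    (hchar : ∀ u : ℝ, Tendsto (fun n => charFun ((P n).map (X n)) u -
      Real.exp (-(u ^ 2 * v n / 2))) atTop (𝓝 0))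
    {c δ : ℕ → ℝ} {c₀ : ℝ} (hc : Tendsto c atTop (𝓝 c₀)) (hδ : Tendsto δ atTop (𝓝 0))
    (hw : Tendsto (fun n => (w n : ℝ) - c n ^ 2 * v n) atTop (𝓝 0)) :
    ApproxInDistribution atTop P (fun n ω => c n * X n ω + δ n) (fun n => gaussianReal 0 (w n))
      fun _ y => y := by
  intro f
  have hw₀ : Tendsto w atTop (𝓝 ((c₀ ^ 2).toNNReal * v₀)) := by
    have := hw.add ((hc.pow 2).mul (NNReal.tendsto_coe.mpr hv))
    rw [← NNReal.tendsto_coe]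
    simpa [Real.coe_toNNReal _ (sq_nonneg c₀)] using this
  have hlaw := tendsto_centredGaussian_of_tendsto_charFun_sub (μ := fun n =>
    ⟨(P n).map (X n), Measure.isProbabilityMeasure_map (hX n).aemeasurable⟩) hv hchar
  have haffine := tendsto_map_affine hlaw hc hδ
  rw [map_mul_centredGaussian] at haffine
  have hgauss := (continuous_centredGaussian.tendsto _).comp hw₀
  have hdiff := (ProbabilityMeasure.tendsto_iff_forall_integral_tendsto.mp haffine f).sub
    (ProbabilityMeasure.tendsto_iff_forall_integral_tendsto.mp hgauss f)
  rw [sub_self] at hdiff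
  refine hdiff.congr fun n => ?_
  have haff : Continuous fun x => c n * x + δ n := by fun_prop
  simp only [ProbabilityMeasure.map, ProbabilityMeasure.coe_mk, centredGaussian, Function.comp]
  rw [integral_map haff.aemeasurable f.continuous.aestronglyMeasurable,
    integral_map (hX n).aemeasurable (by fun_prop : Continuous _).aestronglyMeasurable]

lemma approxInDistribution_affine_gaussianReal [l.IsCountablyGenerated]
    [∀ i, IsProbabilityMeasure (P i)] (hX : ∀ i, Measurable (X i)) {v w : ι → ℝ≥0} {V : ℝ≥0}
    (hv : ∀ᶠ i in l, v i ≤ V)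
    (hchar : ∀ u : ℝ, Tendsto (fun i => charFun ((P i).map (X i)) u -
      Real.exp (-(u ^ 2 * v i / 2))) l (𝓝 0))
    {c δ : ι → ℝ} {B : ℝ} (hc : ∀ᶠ i in l, |c i| ≤ B) (hδ : Tendsto δ l (𝓝 0))
    (hw : Tendsto (fun i => (w i : ℝ) - c i ^ 2 * v i) l (𝓝 0)) :
    ApproxInDistribution l P (fun i ω => c i * X i ω + δ i) (fun i => gaussianReal 0 (w i))
      fun _ y => y := by
  intro f
  refine tendsto_of_subseq_tendsto fun ns hns => ?_
  have hbounded : ∃ᶠ n in atTop, (c (ns n), v (ns n)) ∈ Set.Icc (-B) B ×ˢ Set.Icc 0 V :=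
    ((hns.eventually (hc.and hv)).mono fun n hn => ⟨abs_le.mp hn.1, zero_le, hn.2⟩).frequently
  obtain ⟨⟨c₀, v₀⟩, -, ms, hms, hlim⟩ := (isCompact_Icc.prod isCompact_Icc).tendsto_subseq' hbounded
  have hsub : Tendsto (fun n => ns (ms n)) atTop l := hns.comp hms.tendsto_atTop
  exact ⟨ms, approxInDistribution_affine_gaussianReal_of_tendsto
    (P := fun n => P (ns (ms n))) (X := fun n => X (ns (ms n))) (fun _ => hX _)
    ((continuous_snd.tendsto _).comp hlim) (fun u => (hchar u).comp hsub)
    ((continuous_fst.tendsto _).comp hlim) (hδ.comp hsub) (hw.comp hsub) f⟩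

end Approximation

/-! ### Convergence of moments -/

section MomentConvergence

variable {ι Ω Ω' : Type*} [MeasurableSpace Ω] [MeasurableSpace Ω'] {l : Filter ι}
  {P : ι → Measure Ω} {X : ι → Ω → ℝ} {Q : ι → Measure Ω'} {Y : ι → Ω' → ℝ} {g : ℝ → ℝ}
  {r s : ℝ}

lemma abs_max_neg_min_le {M : ℝ} (hM : 0 ≤ M) (x : ℝ) : |max (-M) (min M x)| ≤ M :=
  abs_le.mpr ⟨le_max_left _ _, max_le (by linarith) (min_le_left _ _)⟩

lemma abs_sub_clamp_le {M : ℝ} (hs : 0 < s) (hsr : s < r) (hM : 0 < M)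
    (hg : ∀ x, |g x| ≤ |x| ^ s) (x : ℝ) :
    |g x - g (max (-M) (min M x))| ≤ 2 * M ^ (s - r) * |x| ^ r := by
  rcases le_or_gt |x| M with hx | hx
  · rw [min_eq_right (abs_le.mp hx).2, max_eq_right (abs_le.mp hx).1, sub_self, abs_zero]
    positivity
  have hrpow : |x| ^ s ≤ M ^ (s - r) * |x| ^ r := by
    calc |x| ^ s = |x| ^ (s - r) * |x| ^ r := by
          rw [← Real.rpow_add (hM.trans hx), sub_add_cancel]
      _ ≤ M ^ (s - r) * |x| ^ r :=
          mul_le_mul_of_nonneg_right (Real.rpow_le_rpow_of_nonpos hM hx.le (by linarith))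
            (by positivity)
  calc |g x - g (max (-M) (min M x))| ≤ |g x| + |g (max (-M) (min M x))| := abs_sub _ _
    _ ≤ |x| ^ s + |x| ^ s := by
        exact add_le_add (hg x) ((hg _).trans (Real.rpow_le_rpow (abs_nonneg _)
          ((abs_max_neg_min_le hM.le x).trans hx.le) hs.le))
    _ ≤ 2 * M ^ (s - r) * |x| ^ r := by linarith

lemma integrable_of_abs_le_rpow {μ : Measure Ω} [IsProbabilityMeasure μ] {Z : Ω → ℝ}
    (hs : 0 < s) (hsr : s < r) (hg : Continuous g) (hgs : ∀ x, |g x| ≤ |x| ^ s)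
    (hZ : MemLp Z (ENNReal.ofReal r) μ) : Integrable (fun ω => g (Z ω)) μ :=
  (integrable_abs_rpow hZ hs.le hsr.le).mono'
    (hg.comp_aestronglyMeasurable hZ.aestronglyMeasurable) (.of_forall fun _ => hgs _)

lemma abs_integral_sub_clamp_le {μ : Measure Ω} [IsProbabilityMeasure μ] {Z : Ω → ℝ} {M K : ℝ}
    (hs : 0 < s) (hsr : s < r) (hM : 0 < M) (hg : Continuous g) (hgs : ∀ x, |g x| ≤ |x| ^ s)
    (hZ : MemLp Z (ENNReal.ofReal r) μ) (hK : lpNorm Z (ENNReal.ofReal r) μ ≤ K) :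
    |∫ ω, g (Z ω) ∂μ - ∫ ω, g (max (-M) (min M (Z ω))) ∂μ| ≤ 2 * M ^ (s - r) * K ^ r := by
  have hr : 0 < r := hs.trans hsr
  have hclamp : Integrable (fun ω => g (max (-M) (min M (Z ω)))) μ := by
    refine .of_bound (C := M ^ s) ?_ (.of_forall fun ω => (hgs _).trans ?_)
    · exact (by fun_prop : Continuous fun x => g (max (-M) (min M x))).comp_aestronglyMeasurable
        hZ.aestronglyMeasurable
    · gcongr
      exact abs_max_neg_min_le hM.le _
  rw [← integral_sub (integrable_of_abs_le_rpow hs hsr hg hgs hZ) hclamp, ← Real.norm_eq_abs]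
  calc _ ≤ ∫ ω, 2 * M ^ (s - r) * |Z ω| ^ r ∂μ :=
        norm_integral_le_of_norm_le ((integrable_abs_rpow hZ hr.le le_rfl).const_mul _)
          (.of_forall fun ω => abs_sub_clamp_le hs hsr hM hgs _)
    _ ≤ 2 * M ^ (s - r) * K ^ r := by
        rw [integral_const_mul, integral_abs_rpow_eq_lpNorm_rpow hZ.aestronglyMeasurable hr]
        gcongr
        exact lpNorm_nonneg

/-- Clamping to `[-M, M]` makes `g` bounded, at a cost of order `M ^ (s - r)` uniformly in `i`. -/
lemma ApproxInDistribution.tendsto_integral_sub (h : ApproxInDistribution l P X Q Y)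
    [∀ i, IsProbabilityMeasure (P i)] [∀ i, IsProbabilityMeasure (Q i)] {K : ℝ}
    (hX : ∀ᶠ i in l, MemLp (X i) (ENNReal.ofReal r) (P i) ∧
      lpNorm (X i) (ENNReal.ofReal r) (P i) ≤ K)
    (hY : ∀ᶠ i in l, MemLp (Y i) (ENNReal.ofReal r) (Q i) ∧
      lpNorm (Y i) (ENNReal.ofReal r) (Q i) ≤ K)
    (hs : 0 < s) (hsr : s < r) (hg : Continuous g) (hgs : ∀ x, |g x| ≤ |x| ^ s) :
    Tendsto (fun i => ∫ ω, g (X i ω) ∂(P i) - ∫ ω, g (Y i ω) ∂(Q i)) l (𝓝 0) := by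
  rw [Metric.tendsto_nhds]
  intro ε hε
  obtain ⟨M, hMε, hM⟩ : ∃ M : ℝ, 2 * M ^ (s - r) * K ^ r < ε / 3 ∧ 0 < M := by
    have hlim := ((tendsto_rpow_neg_atTop (sub_pos.mpr hsr)).const_mul 2).mul_const (K ^ r)
    rw [neg_sub, mul_zero, zero_mul] at hlim
    exact ((hlim.eventually_lt_const (by positivity)).and (eventually_gt_atTop 0)).exists
  have hbound (x : ℝ) : ‖g (max (-M) (min M x))‖ ≤ M ^ s :=
    (hgs _).trans (Real.rpow_le_rpow (abs_nonneg _) (abs_max_neg_min_le hM.le x) hs.le)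
  have hclamp := h (.ofNormedAddCommGroup (fun x => g (max (-M) (min M x))) (by fun_prop) _ hbound)
  simp only [BoundedContinuousFunction.coe_ofNormedAddCommGroup] at hclamp
  filter_upwards [hX, hY, Metric.tendsto_nhds.mp hclamp (ε / 3) (by positivity)] with i hXi hYi hi
  have hXerr := abs_le.mp (abs_integral_sub_clamp_le hs hsr hM hg hgs hXi.1 hXi.2)
  have hYerr := abs_le.mp (abs_integral_sub_clamp_le hs hsr hM hg hgs hYi.1 hYi.2)
  rw [Real.dist_eq, sub_zero, abs_lt] at hi ⊢
  constructor <;> linarith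

theorem ApproxInDistribution.approxMomentsBelow (h : ApproxInDistribution l P X Q Y)
    [∀ i, IsProbabilityMeasure (P i)] [∀ i, IsProbabilityMeasure (Q i)] {K : ℝ}
    (hX : ∀ᶠ i in l, MemLp (X i) (ENNReal.ofReal r) (P i) ∧
      lpNorm (X i) (ENNReal.ofReal r) (P i) ≤ K)
    (hY : ∀ᶠ i in l, MemLp (Y i) (ENNReal.ofReal r) (Q i) ∧
      lpNorm (Y i) (ENNReal.ofReal r) (Q i) ≤ K) :
    ApproxMomentsBelow l P X Q Y r := by
  have approx_integral {s : ℝ} (hs : 0 < s) (hsr : s < r) {g : ℝ → ℝ} (hg : Continuous g)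
      (hgs : ∀ x, |g x| ≤ |x| ^ s) :
      (∀ᶠ i in l, Integrable (fun ω => g (X i ω)) (P i) ∧ Integrable (fun ω => g (Y i ω)) (Q i)) ∧
      Tendsto (fun i => ∫ ω, g (X i ω) ∂(P i) - ∫ ω, g (Y i ω) ∂(Q i)) l (𝓝 0) := by
    refine ⟨?_, h.tendsto_integral_sub hX hY hs hsr hg hgs⟩
    filter_upwards [hX, hY] with i hXi hYi
    exact ⟨integrable_of_abs_le_rpow hs hsr hg hgs hXi.1,
      integrable_of_abs_le_rpow hs hsr hg hgs hYi.1⟩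
  refine ⟨fun s hs hsr => approx_integral hs hsr (g := fun x => |x| ^ s)
      (continuous_abs.rpow_const fun x => Or.inr hs.le) fun x => ?_,
    fun k hk hkr => approx_integral (by exact_mod_cast hk) hkr (g := fun x => x ^ k)
      (continuous_pow k) fun x => ?_⟩
  · rw [abs_of_nonneg (by positivity)]
  · rw [abs_pow, Real.rpow_natCast]

lemma ApproxInDistribution.congr {X' : ι → Ω → ℝ} (h : ApproxInDistribution l P X Q Y)
    (hX : X =ᶠ[l] X') : ApproxInDistribution l P X' Q Y := fun f =>
  (h f).congr' (hX.mono fun i hi => by rw [hi])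

lemma ApproxMomentsBelow.congr {X' : ι → Ω → ℝ} (h : ApproxMomentsBelow l P X Q Y r)
    (hX : X =ᶠ[l] X') : ApproxMomentsBelow l P X' Q Y r := by
  refine ⟨fun s hs hsr => ⟨?_, (h.1 s hs hsr).2.congr' (hX.mono fun i hi => by rw [hi])⟩,
    fun k hk hkr => ⟨?_, (h.2 k hk hkr).2.congr' (hX.mono fun i hi => by rw [hi])⟩⟩
  · filter_upwards [(h.1 s hs hsr).1, hX] with i hint hi
    rwa [← hi]
  · filter_upwards [(h.2 k hk hkr).1, hX] with i hint hi
    rwa [← hi]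

lemma ApproxInDistribution.tendstoInDistribution [∀ i, IsProbabilityMeasure (P i)]
    {μ : Measure ℝ} [IsProbabilityMeasure μ] (hX : ∀ i, Measurable (X i))
    (h : ApproxInDistribution l P X (fun _ => μ) fun _ y => y) :
    TendstoInDistribution X l (fun y : ℝ => y) P μ where
  forall_aemeasurable i := (hX i).aemeasurable
  aemeasurable_limit := aemeasurable_id
  tendsto := by
    refine ProbabilityMeasure.tendsto_iff_forall_integral_tendsto.mpr fun f => ?_
    have hf := (h f).add_const (∫ y, f y ∂μ)
    simp only [sub_add_cancel, zero_add] at hf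
    simp only [ProbabilityMeasure.coe_mk]
    rw [integral_map aemeasurable_id' f.continuous.aestronglyMeasurable]
    refine hf.congr fun i => ?_
    rw [integral_map (hX i).aemeasurable f.continuous.aestronglyMeasurable]

lemma lpNorm_gaussianReal_zero (w : ℝ≥0) (p : ℝ≥0∞) :
    lpNorm (fun y => y) p (gaussianReal 0 w) = √w * lpNorm (fun y => y) p (gaussianReal 0 1) := by
  have hident : IdentDistrib (fun y => y) (√w • fun y => y) (gaussianReal 0 w)
      (gaussianReal 0 1) := by
    refine ⟨aemeasurable_id, by fun_prop, ?_⟩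
    rw [Measure.map_id']
    refine Eq.trans ?_ (gaussianReal_map_const_mul √(w : ℝ)).symm
    rw [mul_zero, mul_one]
    congr 1
    exact NNReal.eq (Real.sq_sqrt w.coe_nonneg).symm
  rw [lpNorm_eq_of_identDistrib hident, lpNorm_const_smul, Real.nnnorm_of_nonneg (by positivity)]
  rfl

end MomentConvergence

namespace RecursiveFamily

variable {A Ω : Type*} [Fintype A] [MeasurableSpace Ω] {q : A → ℝ≥0} {P : ℝ≥0 → Measure Ω}
  {Z Y : Ω → ℝ} {W : A → Ω → ℝ} {r : ℝ}

lemma exists_lpNorm_affine_le (h : RecursiveFamily q P Z Y W r) {c δ : ℝ≥0 → ℝ} {B : ℝ}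
    (hc : ∀ᶠ t in atTop, |c t| ≤ B) (hδ : Tendsto δ atTop (𝓝 0)) :
    ∃ K, ∀ᶠ t in atTop,
      lpNorm (fun ω => c t * normalized P Z t ω + δ t) (ENNReal.ofReal r) (P t) ≤ K := by
  obtain ⟨K, -, hK⟩ := h.exists_lpNorm_normalized_le
  refine ⟨B * K + 1, ?_⟩
  have hδ1 : ∀ᶠ t in atTop, |δ t| ≤ 1 := by
    simpa using hδ.abs.eventually_le_const (by simp : |(0 : ℝ)| < 1)
  filter_upwards [hc, hK, hδ1] with t hct hKt hδt
  have := h.isProbabilityMeasure t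
  have hZ := memLp_normalized (h.memLp t)
  calc _ ≤ lpNorm (c t • normalized P Z t) (ENNReal.ofReal r) (P t) +
        lpNorm (fun _ : Ω => δ t) (ENNReal.ofReal r) (P t) :=
        lpNorm_add_le (hZ.const_smul _) (one_le_two.trans h.two_le_ofReal)
    _ ≤ B * K + 1 := by
        rw [lpNorm_const_smul, lpNorm_const
          (zero_lt_two.trans_le h.two_le_ofReal).ne' (IsProbabilityMeasure.ne_zero _)]
        simp only [coe_nnnorm, Real.norm_eq_abs, probReal_univ, Real.one_rpow, mul_one]
        exact add_le_add
          (mul_le_mul hct hKt lpNorm_nonneg ((abs_nonneg _).trans hct)) hδt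

theorem approx_affine (h : RecursiveFamily q P Z Y W r) {c δ : ℝ≥0 → ℝ} {w : ℝ≥0 → ℝ≥0}
    {B : ℝ} (hc : ∀ᶠ t in atTop, |c t| ≤ B) (hδ : Tendsto δ atTop (𝓝 0))
    (hw : Tendsto (fun t : ℝ≥0 => (w t : ℝ) - c t ^ 2 * (Var[Z; P t] / t)) atTop (𝓝 0))
    {X : ℝ≥0 → Ω → ℝ}
    (hX : (fun t ω => c t * normalized P Z t ω + δ t) =ᶠ[atTop] X) :
    ApproxInDistribution atTop P X (fun t => gaussianReal 0 (w t)) (fun _ y => y) ∧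
      ApproxMomentsBelow atTop P X (fun t => gaussianReal 0 (w t)) (fun _ y => y) r := by
  have hprob := h.isProbabilityMeasure
  have hvar (t : ℝ≥0) : ((Var[Z; P t] / t).toNNReal : ℝ) = Var[Z; P t] / t :=
    Real.coe_toNNReal _ (div_nonneg (variance_nonneg _ _) t.coe_nonneg)
  obtain ⟨V, hV⟩ := h.variance_le
  have happrox := approxInDistribution_affine_gaussianReal
    (fun t => measurable_normalized h.measurable) (V := V.toNNReal)
    (hV.mono fun t ht => Real.toNNReal_le_toNNReal ht) (fun u => by
      simpa only [hvar] using tendsto_zero_iff_norm_tendsto_zero.mpr (h.tendsto_gaussianError u))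
    hc hδ (by simpa only [hvar] using hw)
  have hwV : ∀ᶠ t in atTop, √(w t) ≤ √(B ^ 2 * V + 1) := by
    filter_upwards [hw.eventually_le_const one_pos, hV, hc] with t hwt hVt hct
    have : c t ^ 2 * (Var[Z; P t] / t) ≤ B ^ 2 * V :=
      mul_le_mul (sq_le_sq' (abs_le.mp hct).1 (abs_le.mp hct).2) hVt
        (div_nonneg (variance_nonneg _ _) t.coe_nonneg) (sq_nonneg B)
    exact Real.sqrt_le_sqrt (by linarith)
  obtain ⟨K, hK⟩ := h.exists_lpNorm_affine_le hc hδ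
  set G := lpNorm (fun y => y) (ENNReal.ofReal r) (gaussianReal 0 1)
  refine ⟨happrox.congr hX, (happrox.approxMomentsBelow (K := max K (√(B ^ 2 * V + 1) * G))
    ?_ ?_).congr hX⟩
  · filter_upwards [hK] with t hKt
    exact ⟨((memLp_normalized (h.memLp t)).const_mul _).add (memLp_const _), le_max_of_le_left hKt⟩
  · filter_upwards [hwV] with t ht
    refine ⟨memLp_id_gaussianReal' _ ENNReal.ofReal_ne_top, le_max_of_le_right ?_⟩
    rw [lpNorm_gaussianReal_zero]
    exact mul_le_mul_of_nonneg_right ht lpNorm_nonneg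

theorem approx_div_sqrt (h : RecursiveFamily q P Z Y W r) {a b : ℝ≥0 → ℝ}
    (ha : Tendsto (fun t : ℝ≥0 => (∫ ω, Z ω ∂(P t) - a t) / √t) atTop (𝓝 0))
    (hb : Tendsto (fun t : ℝ≥0 => (Var[Z; P t] - b t) / t) atTop (𝓝 0)) :
    ApproxInDistribution atTop P (fun t ω => (Z ω - a t) / √t)
        (fun t => gaussianReal 0 (b t / t).toNNReal) (fun _ y => y) ∧
      ApproxMomentsBelow atTop P (fun t ω => (Z ω - a t) / √t)
        (fun t => gaussianReal 0 (b t / t).toNNReal) (fun _ y => y) r := by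
  refine h.approx_affine (c := fun _ => 1) (B := 1) (by simp) ha ?_ (.of_forall fun t => ?_)
  · refine squeeze_zero_norm (fun t => ?_) (by simpa using hb.abs)
    have hv : 0 ≤ Var[Z; P t] / t := div_nonneg (variance_nonneg _ _) t.coe_nonneg
    rw [one_pow, one_mul, Real.norm_eq_abs, Real.coe_toNNReal', sub_div, abs_sub_comm _ (b t / t)]
    simpa only [max_eq_left hv] using abs_max_sub_max_le_abs (b t / t) (Var[Z; P t] / t) 0
  · funext ω
    simp only [normalized]
    rw [one_mul, ← add_div, sub_add_sub_cancel]

theorem approx_div_sqrt_variance (h : RecursiveFamily q P Z Y W r) {a b : ℝ≥0 → ℝ}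
    (ha : Tendsto (fun t : ℝ≥0 => (∫ ω, Z ω ∂(P t) - a t) / √t) atTop (𝓝 0))
    (hb : Tendsto (fun t : ℝ≥0 => (Var[Z; P t] - b t) / t) atTop (𝓝 0)) {c : ℝ} (hc : 0 < c)
    (hcb : ∀ᶠ t : ℝ≥0 in atTop, c * t ≤ b t) :
    ApproxInDistribution atTop P (fun t ω => (Z ω - a t) / √(b t))
        (fun _ => gaussianReal 0 1) (fun _ y => y) ∧
      ApproxMomentsBelow atTop P (fun t ω => (Z ω - a t) / √(b t))
        (fun _ => gaussianReal 0 1) (fun _ y => y) r := by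
  have hpos : ∀ᶠ t : ℝ≥0 in atTop, (0 : ℝ) < t ∧ 0 < b t ∧ |t / b t| ≤ c⁻¹ := by
    filter_upwards [hcb, eventually_gt_atTop 0] with t ht ht0
    have hb0 : 0 < b t := lt_of_lt_of_le (by positivity) ht
    refine ⟨ht0, hb0, ?_⟩
    rwa [abs_of_nonneg (by positivity), div_le_iff₀ hb0, ← div_eq_inv_mul, le_div_iff₀' hc]
  have hratio : ∀ᶠ t : ℝ≥0 in atTop, |√(t / b t)| ≤ √c⁻¹ := hpos.mono fun t ht => by
    rw [abs_of_nonneg (Real.sqrt_nonneg _)]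
    exact Real.sqrt_le_sqrt ((le_abs_self _).trans ht.2.2)
  have hbdd {u : ℝ≥0 → ℝ} {B : ℝ} (hu : ∀ᶠ t in atTop, |u t| ≤ B) :
      IsBoundedUnder (· ≤ ·) atTop ((‖·‖) ∘ u) := isBoundedUnder_of_eventually_le hu
  refine h.approx_affine (w := fun _ => 1) hratio
    (isBoundedUnder_le_mul_tendsto_zero (hbdd hratio) ha) ?_ (hpos.mono fun t ⟨ht, hbt, _⟩ => ?_)
  · have hlim := (isBoundedUnder_le_mul_tendsto_zero
      (hbdd (hpos.mono fun t ht => ht.2.2)) hb).neg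
    rw [neg_zero] at hlim
    refine hlim.congr' (hpos.mono fun t ⟨ht, hbt, _⟩ => ?_)
    simp only [Real.sq_sqrt (div_pos ht hbt).le, NNReal.coe_one]
    field_simp
    ring
  · funext ω
    have hsqrt_t := (Real.sqrt_pos.mpr ht).ne'
    have hsqrt_b := (Real.sqrt_pos.mpr hbt).ne'
    simp only [normalized, Real.sqrt_div ht.le]
    field_simp
    ring

end RecursiveFamily

/-! ### Decomposition of a trie at its root -/

section Root

variable {A : Type*}

open Classical in
/-- The strings of `S` that start with the letter `x`, with that letter removed. They generate the
fringe tree at `x` as soon as `S` has at least two elements. -/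
def childSet (S : Finset (ℕ → A)) (x : A) : Finset (ℕ → A) :=
  (S.filter fun ξ => ξ 0 = x).image fun ξ i => ξ (i + 1)

lemma isPrefixOf_nil (ξ : ℕ → A) : IsPrefixOf [] ξ := fun i => i.elim0

lemma isPrefixOf_cons {x : A} {β : List A} {ξ : ℕ → A} :
    IsPrefixOf (x :: β) ξ ↔ ξ 0 = x ∧ IsPrefixOf β fun i => ξ (i + 1) := by
  constructor
  · intro h
    exact ⟨(h ⟨0, by simp⟩).symm, fun i => h ⟨i + 1, by simp⟩⟩
  · rintro ⟨hhead, htail⟩ ⟨_ | i, hi⟩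
    · exact hhead.symm
    · exact htail ⟨i, by simpa using hi⟩

lemma prefixCount_nil (S : Finset (ℕ → A)) : prefixCount S [] = S.card := by
  simp [prefixCount, isPrefixOf_nil]

lemma injOn_tail (x : A) :
    Set.InjOn (fun (ξ : ℕ → A) i => ξ (i + 1)) {ξ | ξ 0 = x} := by
  rintro ξ hξ η hη h
  funext i
  cases i with
  | zero => exact Eq.trans hξ (Eq.symm hη)
  | succ i => exact congrFun h i

lemma prefixCount_childSet (S : Finset (ℕ → A)) (x : A) (β : List A) :
    prefixCount (childSet S x) β = prefixCount S (x :: β) := by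
  classical
  unfold prefixCount childSet
  rw [Finset.filter_image, Finset.card_image_of_injOn, Finset.filter_filter]
  · simp only [isPrefixOf_cons]
  · refine (injOn_tail x).mono fun ξ hξ => ?_
    rw [Finset.mem_coe, Finset.mem_filter, Finset.mem_filter] at hξ
    exact hξ.1.2

lemma sum_card_childSet [Fintype A] (S : Finset (ℕ → A)) :
    ∑ x, (childSet S x).card = S.card := by
  classical
  rw [Finset.card_eq_sum_card_fiberwise (f := fun ξ : ℕ → A => ξ 0) (t := Finset.univ)
    fun _ _ => by simp]
  refine Finset.sum_congr rfl fun x _ => Finset.card_image_of_injOn ?_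
  exact (injOn_tail x).mono fun ξ hξ => (Finset.mem_filter.mp hξ).2

lemma card_childSet_le (S : Finset (ℕ → A)) (x : A) : (childSet S x).card ≤ S.card := by
  classical
  exact Finset.card_image_le.trans (Finset.card_filter_le _ _)

lemma isTrieNode_nil {S : Finset (ℕ → A)} : IsTrieNode S [] ↔ S.Nonempty := by
  rw [IsTrieNode, ← Finset.card_pos, prefixCount_nil]
  simp only [true_or, and_true]
  omega

lemma isTrieNode_cons {S : Finset (ℕ → A)} (hS : 2 ≤ S.card) (x : A) (β : List A) :
    IsTrieNode S (x :: β) ↔ IsTrieNode (childSet S x) β := by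
  unfold IsTrieNode
  rcases β with _ | ⟨y, β⟩
  · rw [prefixCount_childSet]
    simp [prefixCount_nil, hS]
  · simp [prefixCount_childSet]

lemma not_isTrieNode_cons {S : Finset (ℕ → A)} (hS : S.card ≤ 1) (x : A) (β : List A) :
    ¬ IsTrieNode S (x :: β) := by
  have hcount : ∀ γ, prefixCount S γ ≤ 1 := fun γ =>
    (prefixCount_append_le S [] γ).trans (by rwa [prefixCount_nil])
  rintro (h | ⟨-, h | h⟩)
  · exact absurd (hcount (x :: β)) (by omega)
  · exact List.cons_ne_nil x β h
  · exact absurd (hcount (x :: β).dropLast) (by omega)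

lemma fringe_nil (T : Trie A) : fringe T [] = T := by
  apply Subtype.ext
  ext γ
  simp [fringe]

lemma mem_trieOf [Finite A] {S : Finset (ℕ → A)} {α : List A} :
    α ∈ (trieOf S).1 ↔ IsTrieNode S α := by
  simp [trieOf]

lemma trieOf_of_card_le_one [Finite A] {S : Finset (ℕ → A)} (hS : S.card ≤ 1) :
    (trieOf S).1 = if S.Nonempty then {[]} else ∅ := by
  ext α
  rw [mem_trieOf]
  rcases α with _ | ⟨x, β⟩
  · rw [isTrieNode_nil]
    split_ifs with h <;> simp [h]
  · refine iff_of_false (not_isTrieNode_cons hS x β) ?_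
    split_ifs <;> simp

lemma trieOf_empty [Finite A] : trieOf (∅ : Finset (ℕ → A)) = emptyTrie A :=
  Subtype.ext <| (trieOf_of_card_le_one (by simp)).trans (by simp [emptyTrie])

lemma trieOf_subset_singleton_nil [Finite A] {S : Finset (ℕ → A)} :
    (trieOf S).1 ⊆ {[]} ↔ S.card ≤ 1 := by
  classical
  constructor
  · contrapose!
    intro hS hsub
    obtain ⟨ξ, hξ⟩ := Finset.card_pos.mp (zero_lt_one.trans hS)
    have hmem : [ξ 0] ∈ (trieOf S).1 := by
      rw [mem_trieOf, isTrieNode_cons hS, isTrieNode_nil]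
      exact ⟨_, Finset.mem_image_of_mem _ (Finset.mem_filter.mpr ⟨hξ, rfl⟩)⟩
    simpa using hsub hmem
  · intro hS
    rw [trieOf_of_card_le_one hS]
    split_ifs <;> simp

lemma fringe_trieOf [Finite A] {S : Finset (ℕ → A)} (hS : 2 ≤ S.card) (x : A) (β : List A) :
    fringe (trieOf S) (x :: β) = fringe (trieOf (childSet S x)) β := by
  apply Subtype.ext
  ext γ
  simp only [fringe, Finset.mem_preimage, mem_trieOf, List.cons_append, isTrieNode_cons hS]

lemma sum_trieOf_of_card_le_one [Finite A] {M : Type*} [AddCommMonoid M] {S : Finset (ℕ → A)}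
    (hS : S.card ≤ 1) (g : List A → M) : ∑ v ∈ (trieOf S).1, g v = S.card • g [] := by
  rw [trieOf_of_card_le_one hS]
  split_ifs with h
  · simp [le_antisymm hS h.card_pos]
  · simp [Finset.not_nonempty_iff_eq_empty.mp h]

lemma sum_trieOf [Fintype A] {M : Type*} [AddCommMonoid M] {S : Finset (ℕ → A)}
    (hS : 2 ≤ S.card) (g : List A → M) :
    ∑ v ∈ (trieOf S).1, g v = g [] + ∑ x, ∑ β ∈ (trieOf (childSet S x)).1, g (x :: β) := by
  classical
  have hnodes : (trieOf S).1 = insert []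
      (Finset.univ.biUnion fun x => (trieOf (childSet S x)).1.image (List.cons x)) := by
    ext α
    rcases α with _ | ⟨x, β⟩
    · simp [mem_trieOf, isTrieNode_nil, Finset.card_pos.mp (zero_lt_two.trans_le hS)]
    · simp [mem_trieOf, isTrieNode_cons hS]
  rw [hnodes, Finset.sum_insert (by simp), Finset.sum_biUnion]
  · simp only [Finset.sum_image List.cons_injective.injOn]
  · intro x _ y _ hxy
    rw [Function.onFun, Finset.disjoint_left]
    simp only [Finset.mem_image, not_exists, not_and]
    rintro _ ⟨β, -, rfl⟩ γ _ h
    exact hxy (List.cons.inj h).1.symm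

lemma card_trieOf_childSet_lt [Finite A] {S : Finset (ℕ → A)} (hS : 2 ≤ S.card) (x : A) :
    (trieOf (childSet S x)).1.card < (trieOf S).1.card := by
  have := Fintype.ofFinite A
  rw [Finset.card_eq_sum_ones (trieOf S).1, sum_trieOf hS]
  simp only [← Finset.card_eq_sum_ones]
  have := Finset.single_le_sum (f := fun y => (trieOf (childSet S y)).1.card)
    (fun _ _ => Nat.zero_le _) (Finset.mem_univ x)
  omega

open Classical in
/-- The toll function `φ` with its values on the tries of at most one string (the empty trie and
the single root) replaced by `0`. -/
def innerToll (φ : Trie A → ℝ) (T : Trie A) : ℝ := if T.1 ⊆ {[]} then 0 else φ T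

lemma innerToll_trieOf_of_card_le_one [Finite A] (φ : Trie A → ℝ) {S : Finset (ℕ → A)}
    (hS : S.card ≤ 1) : innerToll φ (trieOf S) = 0 :=
  if_pos (trieOf_subset_singleton_nil.mpr hS)

lemma innerToll_trieOf [Finite A] (φ : Trie A → ℝ) {S : Finset (ℕ → A)} (hS : 2 ≤ S.card) :
    innerToll φ (trieOf S) = φ (trieOf S) :=
  if_neg fun h => absurd (trieOf_subset_singleton_nil.mp h) (by omega)

/-- The value of the toll function `φ` on the trie of a single string. -/
def leafToll [Finite A] [Nonempty A] (φ : Trie A → ℝ) : ℝ :=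
  φ (trieOf {fun _ => Classical.arbitrary A})

lemma apply_trieOf_of_card_eq_one [Finite A] [Nonempty A] (φ : Trie A → ℝ) {S : Finset (ℕ → A)}
    (hS : S.card = 1) : φ (trieOf S) = leafToll φ := by
  refine congrArg φ (Subtype.ext ?_)
  rw [trieOf_of_card_le_one hS.le, trieOf_of_card_le_one (by simp), if_pos, if_pos] <;>
    simp [← Finset.card_pos, hS]

lemma abs_sub_innerToll_trieOf_le [Finite A] [Nonempty A] {φ : Trie A → ℝ}
    (hφ : φ (emptyTrie A) = 0) (S : Finset (ℕ → A)) :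
    |φ (trieOf S) - innerToll φ (trieOf S)| ≤ |leafToll φ| := by
  obtain h | h | h : S.card = 0 ∨ S.card = 1 ∨ 2 ≤ S.card := by omega
  · rw [Finset.card_eq_zero.mp h, innerToll_trieOf_of_card_le_one φ (by simp), trieOf_empty, hφ]
    simp
  · rw [innerToll_trieOf_of_card_le_one φ h.le, sub_zero, apply_trieOf_of_card_eq_one φ h]
  · simp [innerToll_trieOf φ h]

lemma additiveFunctional_trieOf_of_two_le_card [Fintype A] (φ : Trie A → ℝ) {S : Finset (ℕ → A)}
    (hS : 2 ≤ S.card) : additiveFunctional φ (trieOf S) =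
      φ (trieOf S) + ∑ x, additiveFunctional φ (trieOf (childSet S x)) := by
  simp only [additiveFunctional, sum_trieOf hS, fringe_nil, fringe_trieOf hS]

lemma additiveFunctional_eq_card_mul_add [Finite A] [Nonempty A] (φ : Trie A → ℝ)
    (S : Finset (ℕ → A)) : additiveFunctional φ (trieOf S) =
      S.card * leafToll φ + additiveFunctional (innerToll φ) (trieOf S) := by
  have := Fintype.ofFinite A
  induction hn : (trieOf S).1.card using Nat.strong_induction_on generalizing S with
  | _ n ih =>
    rcases Nat.lt_or_ge S.card 2 with hS | hS
    · have hS' := Nat.lt_succ_iff.mp hS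
      simp only [additiveFunctional, sum_trieOf_of_card_le_one hS', fringe_nil,
        innerToll_trieOf_of_card_le_one φ hS', smul_zero, add_zero, nsmul_eq_mul]
      interval_cases hcard : S.card
      · simp
      · rw [apply_trieOf_of_card_eq_one φ hcard]
    · have hchild x := ih _ (hn ▸ card_trieOf_childSet_lt hS x) (childSet S x) rfl
      rw [additiveFunctional_trieOf_of_two_le_card φ hS,
        additiveFunctional_trieOf_of_two_le_card _ hS, Finset.sum_congr rfl fun x _ => hchild x,
        Finset.sum_add_distrib, ← Finset.sum_mul, ← Nat.cast_sum, sum_card_childSet,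
        innerToll_trieOf φ hS]
      ring

lemma additiveFunctional_trieOf [Fintype A] [Nonempty A] (φ : Trie A → ℝ) (S : Finset (ℕ → A)) :
    additiveFunctional φ (trieOf S) =
      innerToll φ (trieOf S) + ∑ x, additiveFunctional φ (trieOf (childSet S x)) := by
  rcases Nat.lt_or_ge S.card 2 with hS | hS
  · have hzero : ∀ S' : Finset (ℕ → A), S'.card ≤ 1 →
        additiveFunctional (innerToll φ) (trieOf S') = 0 := fun S' hS' => by
      simp [additiveFunctional, sum_trieOf_of_card_le_one hS', fringe_nil,
        innerToll_trieOf_of_card_le_one φ hS']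
    have hS' := Nat.lt_succ_iff.mp hS
    simp only [additiveFunctional_eq_card_mul_add φ, hzero _ hS',
      hzero _ ((card_childSet_le S _).trans hS'), innerToll_trieOf_of_card_le_one φ hS',
      add_zero, zero_add, ← Finset.sum_mul, ← Nat.cast_sum, sum_card_childSet]
  · rw [additiveFunctional_trieOf_of_two_le_card φ hS, innerToll_trieOf φ hS]

/-- The additive functional with toll function `ψ`, restricted to the nodes at depth below `m`. -/
def truncatedFunctional (ψ : Trie A → ℝ) (m : ℕ) (T : Trie A) : ℝ :=
  ∑ v ∈ T.1 with v.length < m, ψ (fringe T v)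

lemma truncatedFunctional_zero (ψ : Trie A → ℝ) (T : Trie A) :
    truncatedFunctional ψ 0 T = 0 := by
  simp [truncatedFunctional]

lemma eventually_truncatedFunctional_eq (ψ : Trie A → ℝ) (T : Trie A) :
    ∀ᶠ m in atTop, truncatedFunctional ψ m T = additiveFunctional ψ T := by
  filter_upwards [eventually_gt_atTop (T.1.sup List.length)] with m hm
  rw [truncatedFunctional, Finset.filter_true_of_mem fun v hv => (Finset.le_sup hv).trans_lt hm,
    additiveFunctional]

lemma truncatedFunctional_trieOf_of_card_le_one [Finite A] {ψ : Trie A → ℝ}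
    {S : Finset (ℕ → A)} (hψ : ψ (trieOf S) = 0) (hS : S.card ≤ 1) (m : ℕ) :
    truncatedFunctional ψ m (trieOf S) = 0 := by
  simp [truncatedFunctional, Finset.sum_filter, sum_trieOf_of_card_le_one hS, fringe_nil, hψ]

lemma truncatedFunctional_succ [Fintype A] {ψ : Trie A → ℝ}
    (hψ : ∀ S : Finset (ℕ → A), S.card ≤ 1 → ψ (trieOf S) = 0) (m : ℕ) (S : Finset (ℕ → A)) :
    truncatedFunctional ψ (m + 1) (trieOf S) =
      ψ (trieOf S) + ∑ x, truncatedFunctional ψ m (trieOf (childSet S x)) := by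
  rcases Nat.lt_or_ge S.card 2 with hS | hS
  · have hS' := Nat.lt_succ_iff.mp hS
    have hzero x (k : ℕ) := truncatedFunctional_trieOf_of_card_le_one
      (hψ _ ((card_childSet_le S x).trans hS')) ((card_childSet_le S x).trans hS') k
    simp [truncatedFunctional_trieOf_of_card_le_one (hψ S hS') hS', hψ S hS', hzero]
  · simp [truncatedFunctional, Finset.sum_filter, sum_trieOf hS, fringe_nil, fringe_trieOf hS]

end Root

/-! ### Splitting the Poisson model by the first letter -/

section Measurability

variable {A : Type*}

instance : MeasurableSpace (Trie A) := ⊤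

instance : DiscreteMeasurableSpace (Trie A) := ⟨fun _ => trivial⟩

lemma measurable_trieOf [Finite A] {Ω : Type*} [MeasurableSpace Ω] {S : Ω → Finset (ℕ → A)}
    (hS : ∀ v, Measurable fun ω => prefixCount (S ω) v) : Measurable fun ω => trieOf (S ω) := by
  have hnode v : MeasurableSet {ω | IsTrieNode (S ω) v} :=
    (measurableSet_le measurable_const (hS v)).union
      ((hS v (measurableSet_singleton 1)).inter
        ((MeasurableSet.const _).union (measurableSet_le measurable_const (hS v.dropLast))))
  refine measurable_to_countable' fun T => ?_
  have hpre : (fun ω => trieOf (S ω)) ⁻¹' {T} = ⋂ v, {ω | IsTrieNode (S ω) v ↔ v ∈ T.1} := by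
    ext ω
    simp only [Set.mem_preimage, Set.mem_singleton_iff, Set.mem_iInter, Set.mem_ofPred_eq,
      ← mem_trieOf]
    exact ⟨fun h v => by rw [h], fun h => Subtype.ext (Finset.ext h)⟩
  rw [hpre]
  refine MeasurableSet.iInter fun v => ?_
  by_cases hv : v ∈ T.1
  · simpa [hv] using hnode v
  · simpa [hv, Set.compl_ofPred] using (hnode v).compl

lemma measurableSet_isPrefixOf [MeasurableSpace A] [DiscreteMeasurableSpace A] (v : List A) :
    MeasurableSet {ξ : ℕ → A | IsPrefixOf v ξ} := by
  simp only [IsPrefixOf, Set.ofPred_forall]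
  exact MeasurableSet.iInter fun i =>
    measurable_pi_apply (i : ℕ) (MeasurableSet.of_discrete (s := {x | v.get i = x}))

open Classical in
lemma prefixCount_insert (S : Finset (ℕ → A)) (ξ : ℕ → A) (v : List A) :
    prefixCount (insert ξ S) v =
      prefixCount S v + if ξ ∉ S ∧ IsPrefixOf v ξ then 1 else 0 := by
  rw [prefixCount, prefixCount, Finset.filter_insert]
  by_cases hv : IsPrefixOf v ξ <;> by_cases hξ : ξ ∈ S <;> simp [hv, hξ]

open Classical in
lemma measurable_prefixCount_image [MeasurableSpace A] [DiscreteMeasurableSpace A] [Countable A]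
    (n : ℕ) (v : List A) :
    Measurable fun Ξ : ℕ → ℕ → A => prefixCount ((Finset.range n).image Ξ) v := by
  induction n with
  | zero => simp [prefixCount]
  | succ n ih =>
    have hmem : MeasurableSet {Ξ : ℕ → ℕ → A | Ξ n ∈ (Finset.range n).image Ξ} := by
      simp only [Finset.mem_image, Finset.mem_range, Set.ofPred_exists, Set.ofPred_and]
      refine MeasurableSet.iUnion fun i => MeasurableSet.inter (MeasurableSet.const _) ?_
      exact measurableSet_eq_fun (measurable_pi_apply i) (measurable_pi_apply n)
    have hprefix : MeasurableSet {Ξ : ℕ → ℕ → A | IsPrefixOf v (Ξ n)} :=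
      (measurable_pi_apply (X := fun _ : ℕ => ℕ → A) n) (measurableSet_isPrefixOf v)
    simp_rw [Finset.range_add_one, Finset.image_insert, prefixCount_insert]
    exact ih.add (Measurable.ite (hmem.compl.inter hprefix) measurable_const measurable_const)

open Classical in
/-- The set of strings generating the random trie of the Poisson model. -/
def poissonStrings (ω : ℕ × (ℕ → ℕ → A)) : Finset (ℕ → A) := (Finset.range ω.1).image ω.2

lemma poissonTrie_eq [Finite A] (ω : ℕ × (ℕ → ℕ → A)) :
    poissonTrie ω = trieOf (poissonStrings ω) := rfl

lemma card_poissonStrings_le (ω : ℕ × (ℕ → ℕ → A)) : (poissonStrings ω).card ≤ ω.1 := by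
  classical
  exact Finset.card_image_le.trans (by simp)

/-- The trie generated by the strings of the Poisson model that start with `x`, with that letter
removed. -/
def poissonSubtrie [Finite A] (x : A) (ω : ℕ × (ℕ → ℕ → A)) : Trie A :=
  trieOf (childSet (poissonStrings ω) x)

variable [Finite A] [MeasurableSpace A] [DiscreteMeasurableSpace A]

lemma measurable_prefixCount_poissonStrings (v : List A) :
    Measurable fun ω : ℕ × (ℕ → ℕ → A) => prefixCount (poissonStrings ω) v :=
  measurable_from_prod_countable_right fun n => measurable_prefixCount_image n v

lemma measurable_poissonTrie : Measurable (poissonTrie (A := A)) :=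
  measurable_trieOf measurable_prefixCount_poissonStrings

lemma measurable_apply_poissonTrie {β : Type*} [MeasurableSpace β] (ψ : Trie A → β) :
    Measurable fun ω => ψ (poissonTrie ω) :=
  Measurable.of_discrete.comp measurable_poissonTrie

lemma measurable_poissonSubtrie (x : A) : Measurable (poissonSubtrie x) := by
  refine measurable_trieOf fun v => ?_
  simp_rw [prefixCount_childSet]
  exact measurable_prefixCount_poissonStrings _

end Measurability

section Merge

variable {A : Type*}

/-- The infinite string with first letter `x` followed by `ξ`. -/
def consString (x : A) (ξ : ℕ → A) : ℕ → A
  | 0 => x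
  | i + 1 => ξ i

open Classical in
/-- The number of occurrences of the letter `x` among the first `n` letters of `a`. -/
def letterCount (a : ℕ → A) (n : ℕ) (x : A) : ℕ := Nat.count (fun j => a j = x) n

/-- The sequence of strings whose first letters are given by `a`, and where the strings with first
letter `x` continue, in order, with `X (x, 0), X (x, 1), …`. -/
def mergeStrings (a : ℕ → A) (X : A × ℕ → ℕ → A) (i : ℕ) : ℕ → A :=
  consString (a i) (X (a i, letterCount a i (a i)))

lemma injective_letterCount (a : ℕ → A) :
    Function.Injective fun i => (a i, letterCount a i (a i)) := by
  classical
  intro i j h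
  obtain ⟨hletter, hcount⟩ := Prod.ext_iff.mp h
  simp only at hletter hcount
  rw [← hletter] at hcount
  exact Nat.count_injective (p := fun k => a k = a i) rfl hletter.symm hcount

lemma exists_letterCount_eq {a : ℕ → A} {n k : ℕ} {x : A} (h : k < letterCount a n x) :
    ∃ i < n, a i = x ∧ letterCount a i x = k := by
  classical
  have hcard (hf : (Set.ofPred fun j => a j = x).Finite) : k < hf.toFinset.card :=
    h.trans_le (Nat.count_le_card hf n)
  exact ⟨Nat.nth _ k, Nat.nth_lt_of_lt_count h, Nat.nth_mem k hcard, Nat.count_nth hcard⟩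

lemma letterCount_lt {a : ℕ → A} {i n : ℕ} (h : i < n) :
    letterCount a i (a i) < letterCount a n (a i) := by
  classical
  exact Nat.count_strict_mono (p := fun j => a j = a i) rfl h

lemma childSet_mergeStrings (a : ℕ → A) (X : A × ℕ → ℕ → A) (n : ℕ) (x : A) :
    childSet (poissonStrings (n, mergeStrings a X)) x =
      poissonStrings (letterCount a n x, fun k => X (x, k)) := by
  ext ξ
  simp only [childSet, poissonStrings, Finset.mem_image, Finset.mem_filter, Finset.mem_range]
  constructor
  · rintro ⟨_, ⟨⟨i, hi, rfl⟩, rfl⟩, rfl⟩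
    exact ⟨_, letterCount_lt hi, rfl⟩
  · rintro ⟨k, hk, rfl⟩
    obtain ⟨i, hi, rfl, rfl⟩ := exists_letterCount_eq hk
    exact ⟨_, ⟨⟨i, hi, rfl⟩, rfl⟩, rfl⟩

variable [MeasurableSpace A]

/-- The law of an infinite string with i.i.d. letters. -/
def stringLaw (p : PMF A) : Measure (ℕ → A) := Measure.infinitePi fun _ : ℕ => p.toMeasure

instance (p : PMF A) : IsProbabilityMeasure (stringLaw p) := by
  unfold stringLaw
  infer_instance

lemma measurable_consString : Measurable fun q : A × (ℕ → A) => consString q.1 q.2 := by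
  refine measurable_pi_lambda _ fun i => ?_
  cases i with
  | zero => exact measurable_fst
  | succ i => exact (measurable_pi_apply i).comp measurable_snd

lemma map_consString (p : PMF A) :
    (p.toMeasure.prod (stringLaw p)).map (fun q => consString q.1 q.2) = stringLaw p := by
  classical
  refine Measure.eq_infinitePi _ fun s t ht => ?_
  set t₀ : Set A := if 0 ∈ s then t 0 else Set.univ with ht₀
  set s' := s.preimage Nat.succ Nat.succ_injective.injOn
  have hpre : (fun q : A × (ℕ → A) => consString q.1 q.2) ⁻¹' Set.pi s t =
      t₀ ×ˢ Set.pi s' fun i => t (i + 1) := by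
    ext ⟨x, ξ⟩
    simp only [Set.mem_preimage, Set.mem_pi, Set.mem_prod, Finset.mem_coe, s', ht₀,
      Finset.mem_preimage]
    constructor
    · refine fun h => ⟨?_, fun i hi => h _ hi⟩
      split_ifs with h0
      exacts [h 0 h0, trivial]
    · rintro ⟨hhead, htail⟩ (_ | i) hi
      · rwa [if_pos hi] at hhead
      · exact htail i hi
  have hhead : p.toMeasure t₀ * ∏ i ∈ s.erase 0, p.toMeasure (t i) =
      ∏ i ∈ s, p.toMeasure (t i) := by
    by_cases h0 : 0 ∈ s
    · rw [ht₀, if_pos h0, Finset.mul_prod_erase s (fun i => p.toMeasure (t i)) h0]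
    · rw [ht₀, if_neg h0, measure_univ, one_mul, Finset.erase_eq_of_notMem h0]
  have htail : s.filter (· ∈ Set.range Nat.succ) = s.erase 0 := by
    ext i
    simp [Nat.range_succ, Nat.pos_iff_ne_zero, and_comm]
  rw [Measure.map_apply measurable_consString (.pi s.countable_toSet fun i _ => ht i), hpre,
    Measure.prod_prod, stringLaw, Measure.infinitePi_pi _ fun i _ => ht (i + 1), ← hhead, ← htail,
    ← Finset.prod_preimage' _ _ Nat.succ_injective.injOn fun i => p.toMeasure (t i)]

lemma lintegral_stringLaw_consString_preimage (p : PMF A) {t : Set (ℕ → A)}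
    (ht : MeasurableSet t) :
    ∫⁻ x, stringLaw p (consString x ⁻¹' t) ∂p.toMeasure = stringLaw p t := by
  conv_rhs =>
    rw [← map_consString p, Measure.map_apply measurable_consString ht,
      Measure.prod_apply (measurable_consString ht)]
  rfl

lemma lintegral_prod_infinitePi {ι : Type*} {E : ι → Type*} [∀ i, MeasurableSpace (E i)]
    (P : ∀ i, Measure (E i)) [∀ i, IsProbabilityMeasure (P i)] {g : ∀ i, E i → ℝ≥0∞}
    (hg : ∀ i, Measurable (g i)) (s : Finset ι) :
    ∫⁻ a, ∏ i ∈ s, g i (a i) ∂Measure.infinitePi P = ∏ i ∈ s, ∫⁻ x, g i x ∂P i := by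
  rw [lintegral_prod_eq_prod_lintegral_of_indepFun s _ (iIndepFun_infinitePi hg)
    fun i => (hg i).comp (measurable_pi_apply i)]
  refine Finset.prod_congr rfl fun i _ => ?_
  rw [← lintegral_map (hg i) (measurable_pi_apply i), Measure.infinitePi_map_eval]

lemma infinitePi_mergeStrings_preimage (p : PMF A) (a : ℕ → A) (s : Finset ℕ)
    {t : ℕ → Set (ℕ → A)} (ht : ∀ i, MeasurableSet (t i)) :
    Measure.infinitePi (fun _ : A × ℕ => stringLaw p) (mergeStrings a ⁻¹' Set.pi s t) =
      ∏ i ∈ s, stringLaw p (consString (a i) ⁻¹' t i) := by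
  have hcons i : MeasurableSet (consString (a i) ⁻¹' t i) :=
    (measurable_consString.comp measurable_prodMk_left) (ht i)
  rw [← Measure.infinitePi_pi (fun _ : ℕ => stringLaw p) fun i _ => hcons i,
    ← Measure.map_infinitePi_infinitePi_of_inj (P := fun _ : A × ℕ => stringLaw p)
      (injective_letterCount a),
    Measure.map_apply (by fun_prop) (.pi s.countable_toSet fun i _ => hcons i)]
  rfl

variable [DiscreteMeasurableSpace A]

lemma measurable_letterCount (n : ℕ) (x : A) :
    Measurable fun a : ℕ → A => letterCount a n x := by
  classical
  unfold letterCount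
  induction n with
  | zero => simp
  | succ n ih =>
    simp_rw [Nat.count_succ]
    have hn : MeasurableSet {a : ℕ → A | a n = x} :=
      (measurable_pi_apply (X := fun _ : ℕ => A) n) (MeasurableSet.of_discrete (s := {y | y = x}))
    exact ih.add (Measurable.ite hn measurable_const measurable_const)

lemma measurable_letterCount_prod :
    Measurable fun q : ℕ × (ℕ → A) => letterCount q.2 q.1 :=
  measurable_from_prod_countable_right fun n =>
    measurable_pi_lambda _ fun x => measurable_letterCount n x

lemma measurable_letterCount_curry :
    Measurable fun (q : (ℕ × (ℕ → A)) × (A × ℕ → ℕ → A)) x =>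
      (letterCount q.1.2 q.1.1 x, fun k => q.2 (x, k)) := by
  refine measurable_pi_lambda _ fun x => ?_
  exact ((measurable_pi_apply x).comp (measurable_letterCount_prod.comp measurable_fst)).prodMk
    (by fun_prop)

variable [Countable A]

lemma measurable_mergeStrings :
    Measurable fun q : (ℕ → A) × (A × ℕ → ℕ → A) => mergeStrings q.1 q.2 := by
  refine measurable_pi_lambda _ fun i => ?_
  have heval : Measurable fun q : (A × ℕ) × (A × ℕ → ℕ → A) => q.2 q.1 :=
    measurable_from_prod_countable_right fun j => measurable_pi_apply j
  have hcount' : Measurable fun q : A × (ℕ → A) => letterCount q.2 i q.1 :=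
    measurable_from_prod_countable_right fun x => measurable_letterCount i x
  have hcount : Measurable fun a : ℕ → A => letterCount a i (a i) :=
    hcount'.comp (f := fun a : ℕ → A => (a i, a)) (by fun_prop)
  have hletter : Measurable fun q : (ℕ → A) × (A × ℕ → ℕ → A) => q.1 i :=
    (measurable_pi_apply i).comp measurable_fst
  exact measurable_consString.comp (hletter.prodMk
    (heval.comp ((hletter.prodMk (hcount.comp measurable_fst)).prodMk measurable_snd)))

lemma map_mergeStrings (p : PMF A) :
    ((stringLaw p).prod (Measure.infinitePi fun _ : A × ℕ => stringLaw p)).map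
      (fun q => mergeStrings q.1 q.2) = stringsLaw p := by
  refine Measure.eq_infinitePi _ fun s t ht => ?_
  have hbox : MeasurableSet (Set.pi (s : Set ℕ) t) := .pi s.countable_toSet fun i _ => ht i
  calc ((stringLaw p).prod (Measure.infinitePi fun _ : A × ℕ => stringLaw p)).map
        (fun q => mergeStrings q.1 q.2) (Set.pi s t)
      = ∫⁻ a, ∏ i ∈ s, stringLaw p (consString (a i) ⁻¹' t i) ∂stringLaw p := by
        rw [Measure.map_apply measurable_mergeStrings hbox,
          Measure.prod_apply (measurable_mergeStrings hbox)]
        exact lintegral_congr fun a => infinitePi_mergeStrings_preimage p a s ht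
    _ = ∏ i ∈ s, ∫⁻ x, stringLaw p (consString x ⁻¹' t i) ∂p.toMeasure :=
        lintegral_prod_infinitePi (fun _ => p.toMeasure)
          (g := fun i x => stringLaw p (consString x ⁻¹' t i)) (fun _ => .of_discrete) s
    _ = ∏ i ∈ s, stringLaw p (t i) :=
        Finset.prod_congr rfl fun i _ => lintegral_stringLaw_consString_preimage p (ht i)

lemma poissonModel_eq_map_mergeStrings (p : PMF A) (t : ℝ≥0) :
    poissonModel p t =
      (((poissonMeasure t).prod (stringLaw p)).prod
        (Measure.infinitePi fun _ : A × ℕ => stringLaw p)).map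
          fun q => (q.1.1, mergeStrings q.1.2 q.2) := by
  have hmerge : Measurable (Prod.map (id : ℕ → ℕ)
      fun q : (ℕ → A) × (A × ℕ → ℕ → A) => mergeStrings q.1 q.2) :=
    measurable_id.prodMap measurable_mergeStrings
  rw [poissonModel, ← map_mergeStrings p]
  nth_rw 1 [← Measure.map_id (μ := poissonMeasure t)]
  rw [Measure.map_prod_map _ _ measurable_id measurable_mergeStrings, ← Measure.prodAssoc_prod,
    Measure.map_map hmerge (MeasurableEquiv.measurable _)]
  rfl

end Merge

section PoissonSplitting

variable {A : Type*}

/-- The probability of the letter `x`. -/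
def letterProb (p : PMF A) (x : A) : ℝ≥0 := (p x).toNNReal

lemma coe_letterProb (p : PMF A) (x : A) : (letterProb p x : ℝ≥0∞) = p x :=
  ENNReal.coe_toNNReal (p.apply_ne_top x)

lemma sum_letterProb [Fintype A] (p : PMF A) : ∑ x, letterProb p x = 1 := by
  rw [← ENNReal.coe_inj]
  push_cast
  simp_rw [coe_letterProb]
  rw [← tsum_fintype (L := .unconditional A), p.tsum_coe]

lemma prod_smul_X_eq_monomial {R : Type*} [CommSemiring R] {n : ℕ} (q : A → R) (f : Fin n → A) :
    ∏ i, q (f i) • (MvPolynomial.X (f i) : MvPolynomial A R) =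
      MvPolynomial.monomial (∑ i, Finsupp.single (f i) 1) (∏ i, q (f i)) := by
  rw [MvPolynomial.monomial_sum_prod]
  refine Finset.prod_congr rfl fun i _ => ?_
  rw [MvPolynomial.smul_eq_C_mul, MvPolynomial.C_mul_X_eq_monomial]

/-- Both sides are the coefficient of `∏ x, X x ^ k x` in `(∑ x, q x • X x) ^ n`. -/
lemma sum_prod_of_card_fiber {R : Type*} [Fintype A] [DecidableEq A] [CommSemiring R] {n : ℕ}
    (q : A → R) {k : A → ℕ} (hk : ∑ x, k x = n) :
    ∑ f : Fin n → A with ∀ x, (Finset.univ.filter fun i => f i = x).card = k x, ∏ i, q (f i) =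
      Nat.multinomial Finset.univ k * ∏ x, q x ^ k x := by
  have hcoeff := MvPolynomial.coeff_linearCombination_X_pow_of_fintype q
    (Finsupp.equivFunOnFinite.symm k) n
  rw [if_pos (by rw [Finsupp.sum_fintype _ _ (by simp)]; simpa using hk),
    Finsupp.prod_fintype _ _ (by simp), ← Finsupp.multinomial_of_support_subset
      (Finset.subset_univ _)] at hcoeff
  have hpow : (∑ x, q x • (MvPolynomial.X x : MvPolynomial A R)) ^ n
      = ∑ f : Fin n → A, ∏ i, q (f i) • (MvPolynomial.X (f i) : MvPolynomial A R) := by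
    have := Finset.prod_univ_sum (ι := Fin n) (fun _ => (Finset.univ : Finset A))
      fun _ x => q x • (MvPolynomial.X x : MvPolynomial A R)
    simpa using this
  refine Eq.trans ?_ hcoeff
  rw [hpow, MvPolynomial.coeff_sum, Finset.sum_filter]
  refine Finset.sum_congr rfl fun f _ => ?_
  rw [prod_smul_X_eq_monomial, MvPolynomial.coeff_monomial]
  refine if_congr ?_ rfl rfl
  rw [Finsupp.ext_iff]
  refine forall_congr' fun x => ?_
  rw [Finset.card_filter, Finsupp.finsetSum_apply]
  simp only [Finsupp.single_apply]
  rfl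

lemma poisson_mul_multinomial [Fintype A] {q : A → ℝ} (hq : ∑ x, q x = 1) (t : ℝ) (k : A → ℕ) :
    Real.exp (-t) * t ^ (∑ x, k x) / (∑ x, k x).factorial *
        (Nat.multinomial Finset.univ k * ∏ x, q x ^ k x) =
      ∏ x, Real.exp (-(q x * t)) * (q x * t) ^ k x / (k x).factorial := by
  have hmultinomial : (∏ x, ((k x).factorial : ℝ)) * Nat.multinomial Finset.univ k =
      ((∑ x, k x).factorial : ℝ) := by exact_mod_cast Nat.multinomial_spec Finset.univ k
  have hexp : ∏ x, Real.exp (-(q x * t)) = Real.exp (-t) := by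
    rw [← Real.exp_sum, Finset.sum_neg_distrib, ← Finset.sum_mul, hq, one_mul]
  have hfactorial : (∏ x, ((k x).factorial : ℝ)) ≠ 0 :=
    Finset.prod_ne_zero_iff.mpr fun x _ => by positivity
  have hmultinomial_ne : (Nat.multinomial Finset.univ k : ℝ) ≠ 0 := by
    exact_mod_cast (Nat.multinomial_pos Finset.univ k).ne'
  simp_rw [mul_pow]
  rw [Finset.prod_div_distrib, Finset.prod_mul_distrib, hexp, Finset.prod_mul_distrib,
    Finset.prod_pow_eq_pow_sum, ← hmultinomial]
  field_simp

lemma letterCount_eq_card [DecidableEq A] (a : ℕ → A) (n : ℕ) (x : A) :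
    letterCount a n x = (Finset.univ.filter fun i : Fin n => a i = x).card := by
  rw [letterCount, Nat.count_eq_card_filter_range, Finset.card_filter, Finset.card_filter,
    Finset.sum_range]
  exact Finset.sum_congr rfl fun i _ => by congr

lemma sum_letterCount [Fintype A] (a : ℕ → A) (n : ℕ) : ∑ x, letterCount a n x = n := by
  classical
  simp_rw [letterCount, Nat.count_eq_card_filter_range]
  rw [← Finset.card_eq_sum_card_fiberwise (s := Finset.range n) (f := a) (fun _ _ => by simp),
    Finset.card_range]

lemma letterCount_eq_iff [Fintype A] {n : ℕ} {a : ℕ → A} {k : A → ℕ} :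
    letterCount a n = k ↔ n = ∑ x, k x ∧ letterCount a (∑ x, k x) = k := by
  constructor
  · rintro rfl
    simp [sum_letterCount]
  · rintro ⟨rfl, h⟩
    exact h

variable [Fintype A] [MeasurableSpace A] [DiscreteMeasurableSpace A]

lemma stringLaw_letterCount_eq (p : PMF A) (k : A → ℕ) :
    stringLaw p {a | letterCount a (∑ x, k x) = k} =
      Nat.multinomial Finset.univ k * ∏ x, p x ^ k x := by
  classical
  set n := ∑ x, k x with hn
  have hpre : {a : ℕ → A | letterCount a n = k} =
      (fun (a : ℕ → A) (i : Fin n) => a i) ⁻¹' ((Finset.univ.filter fun f : Fin n → A =>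
        ∀ x, (Finset.univ.filter fun i => f i = x).card = k x : Finset (Fin n → A)) :
          Set (Fin n → A)) := by
    ext a
    simp [funext_iff, letterCount_eq_card]
  rw [← sum_prod_of_card_fiber p hn.symm, hpre, stringLaw,
    ← Measure.map_apply (by fun_prop) MeasurableSet.of_discrete,
    Measure.map_infinitePi_infinitePi_of_inj Fin.val_injective, ← sum_measure_singleton]
  refine Finset.sum_congr rfl fun f _ => ?_
  rw [Measure.infinitePi_singleton_of_fintype]
  exact Finset.prod_congr rfl fun i _ => PMF.toMeasure_apply_singleton _ _ MeasurableSet.of_discrete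

lemma map_letterCount (p : PMF A) (t : ℝ≥0) :
    ((poissonMeasure t).prod (stringLaw p)).map (fun q => letterCount q.2 q.1) =
      Measure.pi fun x => poissonMeasure (letterProb p x * t) := by
  refine Measure.ext_of_singleton fun k => ?_
  have hpre : (fun q : ℕ × (ℕ → A) => letterCount q.2 q.1) ⁻¹' {k} =
      {∑ x, k x} ×ˢ {a | letterCount a (∑ x, k x) = k} := by
    ext ⟨n, a⟩
    exact letterCount_eq_iff
  have hmultinomial : ((Nat.multinomial Finset.univ k : ℕ) : ℝ≥0∞) * ∏ x, p x ^ k x =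
      ENNReal.ofReal (Nat.multinomial Finset.univ k * ∏ x, (letterProb p x : ℝ) ^ k x) := by
    rw [ENNReal.ofReal_mul (by positivity), ENNReal.ofReal_natCast,
      ENNReal.ofReal_prod_of_nonneg fun x _ => by positivity]
    simp [ENNReal.ofReal_pow, coe_letterProb]
  have hsum : ∑ x, (letterProb p x : ℝ) = 1 := by exact_mod_cast sum_letterProb p
  rw [Measure.map_apply measurable_letterCount_prod MeasurableSet.of_discrete, hpre,
    Measure.prod_prod, stringLaw_letterCount_eq, hmultinomial, Measure.pi_singleton]
  simp_rw [poissonMeasure_singleton]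
  rw [← ENNReal.ofReal_mul (by positivity), ← ENNReal.ofReal_prod_of_nonneg
    fun x _ => by positivity, poisson_mul_multinomial hsum]
  simp only [NNReal.coe_mul]

lemma pi_poissonModel_eq_map_letterCount (p : PMF A) (t : ℝ≥0) :
    (Measure.pi fun x => poissonModel p (letterProb p x * t)) =
      (((poissonMeasure t).prod (stringLaw p)).prod
        (Measure.infinitePi fun _ : A × ℕ => stringLaw p)).map
          fun q x => (letterCount q.1.2 q.1.1 x, fun k => q.2 (x, k)) := by
  have hcurry := MeasurableEquiv.measurable (MeasurableEquiv.curry A ℕ (ℕ → A))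
  have hstrings : (Measure.infinitePi fun _ : A × ℕ => stringLaw p).map
      (MeasurableEquiv.curry A ℕ (ℕ → A)) = Measure.pi fun _ : A => stringsLaw p := by
    rw [Measure.infinitePi_map_curry fun _ _ => stringLaw p]
    exact Measure.infinitePi_eq_pi _
  have hpair := (measurePreserving_arrowProdEquivProdArrow ℕ (ℕ → ℕ → A) A
    (fun x => poissonMeasure (letterProb p x * t)) fun _ => stringsLaw p).symm.map_eq
  simp_rw [poissonModel]
  rw [← hpair, ← map_letterCount, ← hstrings,
    Measure.map_prod_map _ _ measurable_letterCount_prod hcurry,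
    Measure.map_map (MeasurableEquiv.measurable _) (measurable_letterCount_prod.prodMap hcurry)]
  rfl

/-- Sorting the strings by their first letter thins the Poisson process. -/
lemma map_poissonSubtrie (p : PMF A) (t : ℝ≥0) :
    (poissonModel p t).map (fun ω x => poissonSubtrie x ω) =
      Measure.pi fun x => (poissonModel p (letterProb p x * t)).map poissonTrie := by
  have htries : Measurable fun (z : A → ℕ × (ℕ → ℕ → A)) x => poissonTrie (z x) :=
    measurable_pi_lambda _ fun x => measurable_poissonTrie.comp (measurable_pi_apply x)
  have hmerge : Measurable fun q : (ℕ × (ℕ → A)) × (A × ℕ → ℕ → A) =>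
      (q.1.1, mergeStrings q.1.2 q.2) :=
    measurable_fst.fst.prodMk (measurable_mergeStrings.comp (measurable_fst.snd.prodMk
      measurable_snd))
  rw [← Measure.pi_map_pi fun x => measurable_poissonTrie.aemeasurable,
    pi_poissonModel_eq_map_letterCount, Measure.map_map htries measurable_letterCount_curry,
    poissonModel_eq_map_mergeStrings, Measure.map_map
      (measurable_pi_lambda _ measurable_poissonSubtrie) hmerge]
  congr 1
  funext q x
  simp only [Function.comp_apply, poissonSubtrie, childSet_mergeStrings, poissonTrie_eq]

end PoissonSplitting

section Finiteness

lemma measure_le_of_forall_singleton_le {α : Type*} [MeasurableSpace α] [Countable α]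
    [MeasurableSingletonClass α] {μ ν : Measure α} (h : ∀ a, μ {a} ≤ ν {a}) : μ ≤ ν := by
  rw [← Measure.sum_smul_dirac μ, ← Measure.sum_smul_dirac ν]
  refine Measure.le_iff.mpr fun s hs => ?_
  simp only [Measure.sum_apply _ hs, Measure.smul_apply, smul_eq_mul]
  exact ENNReal.tsum_le_tsum fun a => mul_le_mul' (h a) le_rfl

lemma poissonMeasure_restrict_Ici_le {s t : ℝ≥0} (hst : s ≤ t) (k : ℕ) :
    (poissonMeasure s).restrict (Set.Ici k) ≤
      (Real.exp t * (s / t) ^ k).toNNReal • poissonMeasure t := by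
  refine measure_le_of_forall_singleton_le fun n => ?_
  rw [Measure.restrict_apply MeasurableSet.of_discrete]
  rcases Nat.lt_or_ge n k with hn | hn
  · simp [Set.singleton_inter_eq_empty.mpr (Set.notMem_Ici.mpr hn)]
  rw [Set.inter_eq_left.mpr (by simpa using hn), Measure.smul_apply, poissonMeasure_singleton,
    poissonMeasure_singleton, ENNReal.smul_def, smul_eq_mul, ← ENNReal.ofReal,
    ← ENNReal.ofReal_mul (by positivity)]
  refine ENNReal.ofReal_le_ofReal ?_
  have hratio : (s / t : ℝ) ≤ 1 := div_le_one_of_le₀ hst t.coe_nonneg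
  have hpow : (s : ℝ) ^ n = (s / t) ^ n * t ^ n := by
    rcases eq_zero_or_pos t with rfl | ht
    · obtain rfl : s = 0 := le_antisymm hst zero_le
      cases n <;> simp
    · rw [← mul_pow, div_mul_cancel₀ _ (by exact_mod_cast ht.ne')]
  calc Real.exp (-s) * s ^ n / n.factorial ≤ 1 * ((s / t) ^ k * t ^ n) / n.factorial := by
        rw [hpow]
        gcongr ?_ * (?_ * _) / _
        · simp
        · exact pow_le_pow_of_le_one (by positivity) hratio hn
    _ = Real.exp t * (s / t) ^ k * (Real.exp (-t) * t ^ n / n.factorial) := by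
        rw [Real.exp_neg]
        field_simp

lemma memLp_natCast_poissonMeasure (t r : ℝ≥0) :
    MemLp (fun n : ℕ => (n : ℝ)) r (poissonMeasure t) := by
  refine memLp_of_mem_interior_integrableExpSet ?_ r
  have huniv : integrableExpSet (fun n : ℕ => (n : ℝ)) (poissonMeasure t) = Set.univ := by
    refine Set.eq_univ_of_forall fun u => ?_
    rw [integrableExpSet, Set.mem_ofPred_eq, integrable_poissonMeasure_iff]
    refine ((Real.summable_pow_div_factorial (Real.exp u * t)).mul_left (Real.exp (-t))).congr
      fun n => ?_
    rw [Real.norm_of_nonneg (Real.exp_pos _).le, mul_pow, ← Real.exp_nat_mul]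
    ring_nf
  simp [huniv]

variable {A : Type*} [MeasurableSpace A] {p : PMF A} {r : ℝ} {s t : ℝ≥0}

lemma poissonModel_restrict_le (p : PMF A) (hst : s ≤ t) (k : ℕ) :
    (poissonModel p s).restrict {ω | k ≤ ω.1} ≤
      (Real.exp t * (s / t) ^ k).toNNReal • poissonModel p t := by
  have hset : {ω : ℕ × (ℕ → ℕ → A) | k ≤ ω.1} = Set.Ici k ×ˢ Set.univ := by
    ext ω
    simp
  rw [poissonModel, poissonModel, hset, ← Measure.restrict_prod_eq_prod_univ,
    ← Measure.prod_smul_left]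
  exact Measure.prod_mono (poissonMeasure_restrict_Ici_le hst k) le_rfl

lemma memLp_and_lpNorm_poissonModel_le (hr : 0 < r) (hst : s ≤ t) {k : ℕ}
    {F : ℕ × (ℕ → ℕ → A) → ℝ} (hF : MemLp F (ENNReal.ofReal r) (poissonModel p t))
    (hFk : ∀ ω, ω.1 < k → F ω = 0) :
    MemLp F (ENNReal.ofReal r) (poissonModel p s) ∧
      lpNorm F (ENNReal.ofReal r) (poissonModel p s) ≤
        (Real.exp t * (s / t) ^ k) ^ r⁻¹ * lpNorm F (ENNReal.ofReal r) (poissonModel p t) := by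
  set c := (Real.exp t * (s / t) ^ k).toNNReal with hc
  have hle := poissonModel_restrict_le p hst k
  have hset : MeasurableSet {ω : ℕ × (ℕ → ℕ → A) | k ≤ ω.1} :=
    measurableSet_le measurable_const measurable_fst
  have hindicator : {ω : ℕ × (ℕ → ℕ → A) | k ≤ ω.1}.indicator F = F :=
    Set.indicator_eq_self.mpr fun ω hω => not_lt.mp fun hk => hω (hFk ω hk)
  have hsmul : MemLp F (ENNReal.ofReal r) (c • poissonModel p t) :=
    hF.smul_measure ENNReal.coe_ne_top
  have hs : MemLp F (ENNReal.ofReal r) (poissonModel p s) := by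
    rw [← hindicator, memLp_indicator_iff_restrict hset]
    exact hsmul.mono_measure hle
  refine ⟨hs, ?_⟩
  calc lpNorm F (ENNReal.ofReal r) (poissonModel p s)
      ≤ lpNorm F (ENNReal.ofReal r) (c • poissonModel p t) := by
        rw [← toReal_eLpNorm hs.1, ← toReal_eLpNorm hsmul.1]
        refine ENNReal.toReal_mono hsmul.eLpNorm_ne_top ?_
        rw [← hindicator, eLpNorm_indicator_eq_eLpNorm_restrict hset, hindicator]
        exact eLpNorm_mono_measure F hle
    _ = _ := by
        rw [lpNorm_smul_measure_of_ne_top ENNReal.ofReal_ne_top, ENNReal.toReal_ofReal hr.le, hc,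
          NNReal.smul_def, NNReal.coe_rpow, Real.coe_toNNReal _ (by positivity), smul_eq_mul]

end Finiteness

section Recursion

variable {A : Type*}

lemma letterProb_pos {p : PMF A} (hp : ∀ x, 0 < p x) (x : A) : 0 < letterProb p x :=
  ENNReal.toNNReal_pos (hp x).ne' (p.apply_ne_top x)

lemma letterProb_le_one (p : PMF A) (x : A) : letterProb p x ≤ 1 :=
  ENNReal.toNNReal_mono ENNReal.one_ne_top (p.coe_le_one x)

lemma letterProb_lt_one [Nontrivial A] {p : PMF A} (hp : ∀ x, 0 < p x) (x : A) :
    letterProb p x < 1 := by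
  obtain ⟨y, hy⟩ := exists_ne x
  refine (letterProb_le_one p x).lt_of_ne fun hx => hy ?_
  have hsupport := p.apply_eq_one_iff x |>.mp (by rw [← coe_letterProb, hx, ENNReal.coe_one])
  exact hsupport.subset ((p.mem_support_iff y).mpr (hp y).ne')

variable [Finite A] [MeasurableSpace A] [DiscreteMeasurableSpace A] {p : PMF A}

lemma map_poissonSubtrie_apply (p : PMF A) (t : ℝ≥0) (x : A) :
    (poissonModel p t).map (poissonSubtrie x) =
      (poissonModel p (letterProb p x * t)).map poissonTrie := by
  have := Fintype.ofFinite A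
  have hprob y : IsProbabilityMeasure ((poissonModel p (letterProb p y * t)).map poissonTrie) :=
    Measure.isProbabilityMeasure_map measurable_poissonTrie.aemeasurable
  have hmarginal := congrArg (Measure.map (Function.eval x)) (map_poissonSubtrie p t)
  rwa [Measure.map_map (measurable_pi_apply x) (measurable_pi_lambda _ measurable_poissonSubtrie),
    (measurePreserving_eval _ x).map_eq] at hmarginal

lemma iIndepFun_poissonSubtrie (p : PMF A) (t : ℝ≥0) :
    iIndepFun (fun x : A => poissonSubtrie x) (poissonModel p t) := by
  have := Fintype.ofFinite A
  rw [iIndepFun_iff_map_fun_eq_pi_map fun x => (measurable_poissonSubtrie x).aemeasurable,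
    map_poissonSubtrie]
  simp_rw [map_poissonSubtrie_apply]

lemma iIndepFun_apply_poissonSubtrie (p : PMF A) (t : ℝ≥0) (ψ : Trie A → ℝ) :
    iIndepFun (fun x ω => ψ (poissonSubtrie x ω)) (poissonModel p t) :=
  (iIndepFun_poissonSubtrie p t).comp (fun _ => ψ) fun _ => Measurable.of_discrete

lemma identDistrib_apply_poissonSubtrie (p : PMF A) (t : ℝ≥0) (x : A) (ψ : Trie A → ℝ) :
    IdentDistrib (fun ω => ψ (poissonSubtrie x ω)) (fun ω => ψ (poissonTrie ω))
      (poissonModel p t) (poissonModel p (letterProb p x * t)) :=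
  IdentDistrib.comp (u := ψ) ⟨(measurable_poissonSubtrie x).aemeasurable,
    measurable_poissonTrie.aemeasurable, map_poissonSubtrie_apply p t x⟩ Measurable.of_discrete

end Recursion

section TruncatedMoments

variable {A : Type*} {ψ : Trie A → ℝ}

lemma truncatedFunctional_poissonTrie_succ [Fintype A]
    (hψ : ∀ S : Finset (ℕ → A), S.card ≤ 1 → ψ (trieOf S) = 0) (m : ℕ) :
    (fun ω => truncatedFunctional ψ (m + 1) (poissonTrie ω)) = fun ω =>
      ψ (poissonTrie ω) + ∑ x, truncatedFunctional ψ m (poissonSubtrie x ω) :=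
  funext fun ω => truncatedFunctional_succ hψ m (poissonStrings ω)

variable [MeasurableSpace A] {p : PMF A} {r : ℝ} {t₀ : ℝ≥0}

/-- A trie generated by at most one string contributes nothing, and two strings are present with
probability `O(t ^ 2)`. -/
lemma exists_memLp_and_lpNorm_poissonTrie_le [Finite A] (hr : 0 < r)
    (hψ : ∀ S : Finset (ℕ → A), S.card ≤ 1 → ψ (trieOf S) = 0)
    (hψL : MemLp (fun ω => ψ (poissonTrie ω)) (ENNReal.ofReal r) (poissonModel p t₀)) :
    ∃ C, 0 ≤ C ∧ ∀ t ≤ t₀, MemLp (fun ω => ψ (poissonTrie ω)) (ENNReal.ofReal r)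
        (poissonModel p t) ∧
      lpNorm (fun ω => ψ (poissonTrie ω)) (ENNReal.ofReal r) (poissonModel p t) ≤
        C * (t : ℝ) ^ (2 / r) := by
  refine ⟨(Real.exp t₀ / t₀ ^ 2) ^ r⁻¹ * lpNorm (fun ω => ψ (poissonTrie ω)) (ENNReal.ofReal r)
    (poissonModel p t₀), mul_nonneg (by positivity) lpNorm_nonneg, fun t ht => ?_⟩
  obtain ⟨hmem, hle⟩ := memLp_and_lpNorm_poissonModel_le hr ht (k := 2) hψL fun ω hω =>
    hψ _ ((card_poissonStrings_le ω).trans (Nat.lt_succ_iff.mp hω))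
  refine ⟨hmem, hle.trans_eq ?_⟩
  have hpow : (t : ℝ) ^ (2 / r) = ((t : ℝ) ^ 2) ^ r⁻¹ := by
    rw [← Real.rpow_natCast, ← Real.rpow_mul t.coe_nonneg, Nat.cast_ofNat, div_eq_mul_inv]
  rw [hpow, mul_right_comm, ← Real.mul_rpow (by positivity) (by positivity), div_pow]
  ring_nf

variable [Finite A] [DiscreteMeasurableSpace A]

lemma memLp_truncatedFunctional
    (hψ : ∀ S : Finset (ℕ → A), S.card ≤ 1 → ψ (trieOf S) = 0) {q : ℝ≥0∞}
    (hψL : ∀ t ≤ t₀, MemLp (fun ω => ψ (poissonTrie ω)) q (poissonModel p t)) (m : ℕ) :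
    ∀ t ≤ t₀, MemLp (fun ω => truncatedFunctional ψ m (poissonTrie ω)) q (poissonModel p t) := by
  have := Fintype.ofFinite A
  induction m with
  | zero => simp [truncatedFunctional_zero]
  | succ m ih =>
    intro t ht
    rw [truncatedFunctional_poissonTrie_succ hψ]
    exact (hψL t ht).add <| memLp_finsetSum _ fun x _ =>
      (identDistrib_apply_poissonSubtrie p t x _).memLp_iff.mpr <|
        ih _ ((mul_le_of_le_one_left' (letterProb_le_one p x)).trans ht)

lemma exists_lpNorm_one_truncatedFunctional_le [Nontrivial A] (hp : ∀ x, 0 < p x)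
    (hψ : ∀ S : Finset (ℕ → A), S.card ≤ 1 → ψ (trieOf S) = 0)
    (hψL : MemLp (fun ω => ψ (poissonTrie ω)) 1 (poissonModel p t₀)) :
    ∃ V, 0 ≤ V ∧ ∀ m, ∀ t ≤ t₀, lpNorm (fun ω => truncatedFunctional ψ m (poissonTrie ω)) 1
      (poissonModel p t) ≤ V * (t : ℝ) ^ 2 := by
  have := Fintype.ofFinite A
  obtain ⟨C, hC, hbound⟩ := exists_memLp_and_lpNorm_poissonTrie_le one_pos hψ (by simpa using hψL)
  simp only [ENNReal.ofReal_one, div_one, Real.rpow_ofNat] at hbound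
  have hρ : ∑ x, (letterProb p x : ℝ) ^ 2 < 1 := by
    simpa using sum_rpow_lt_one_of_sum_eq_one (letterProb_pos hp) (letterProb_lt_one hp)
      (sum_letterProb p) one_lt_two
  set ρ := ∑ x, (letterProb p x : ℝ) ^ 2
  have hρ' : 0 < 1 - ρ := sub_pos.mpr hρ
  refine ⟨C / (1 - ρ), by positivity, fun m => ?_⟩
  induction m with
  | zero =>
    intro t _
    simp only [truncatedFunctional_zero, lpNorm_fun_zero]
    positivity
  | succ m ih =>
    intro t ht
    have hchild x := (mul_le_of_le_one_left' (letterProb_le_one p x)).trans ht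
    have hchildL x := (identDistrib_apply_poissonSubtrie p t x (truncatedFunctional ψ m)).memLp_iff
      |>.mpr (memLp_truncatedFunctional hψ (fun t ht => (hbound t ht).1) m _ (hchild x))
    calc _ ≤ lpNorm (fun ω => ψ (poissonTrie ω)) 1 (poissonModel p t) +
          lpNorm (∑ x, fun ω => truncatedFunctional ψ m (poissonSubtrie x ω)) 1
            (poissonModel p t) := by
          rw [truncatedFunctional_poissonTrie_succ hψ, Finset.sum_fn]
          exact lpNorm_add_le (hbound t ht).1 le_rfl
      _ ≤ C * t ^ 2 + ∑ x, C / (1 - ρ) * (letterProb p x * t : ℝ) ^ 2 := by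
          gcongr ?_ + ?_
          · exact (hbound t ht).2
          refine (lpNorm_sum_le (fun x _ => hchildL x) le_rfl).trans ?_
          gcongr with x
          rw [lpNorm_eq_of_identDistrib (identDistrib_apply_poissonSubtrie p t x _)]
          exact ih _ (hchild x)
      _ = C / (1 - ρ) * t ^ 2 := by
          simp_rw [mul_pow, ← Finset.mul_sum, ← Finset.sum_mul]
          change C * t ^ 2 + C / (1 - ρ) * (ρ * t ^ 2) = _
          field_simp
          ring

lemma sq_le_rpow_mul_rpow {t t₀ : ℝ} (ht : 0 ≤ t) (htt₀ : t ≤ t₀) (hr : 1 ≤ r) :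
    t ^ 2 ≤ t₀ ^ (2 - 2 / r) * t ^ (2 / r) := by
  have hr₂ : 0 ≤ 2 - 2 / r := sub_nonneg.mpr (div_le_self zero_le_two hr)
  calc t ^ 2 = t ^ (2 - 2 / r) * t ^ (2 / r) := by
        rw [← Real.rpow_add_of_nonneg ht hr₂ (by positivity), sub_add_cancel, Real.rpow_ofNat]
    _ ≤ _ := by gcongr

lemma exists_lpNorm_truncatedFunctional_le [Nontrivial A] (hp : ∀ x, 0 < p x) (hr : 1 < r)
    (hψ : ∀ S : Finset (ℕ → A), S.card ≤ 1 → ψ (trieOf S) = 0)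
    (hψL : MemLp (fun ω => ψ (poissonTrie ω)) (ENNReal.ofReal r) (poissonModel p t₀)) :
    ∃ K, ∀ m, ∀ t ≤ t₀, lpNorm (fun ω => truncatedFunctional ψ m (poissonTrie ω))
      (ENNReal.ofReal r) (poissonModel p t) ≤ K * (t : ℝ) ^ (2 / r) := by
  have := Fintype.ofFinite A
  have hr₀ : 0 < r := one_pos.trans hr
  obtain ⟨C, -, hbound⟩ := exists_memLp_and_lpNorm_poissonTrie_le hr₀ hψ hψL
  obtain ⟨V, hV, hmean⟩ := exists_lpNorm_one_truncatedFunctional_le hp hψ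
    (hψL.mono_exponent (ENNReal.one_le_ofReal.mpr hr.le))
  have hρ : ∑ x, (letterProb p x : ℝ) ^ (2 : ℝ) < 1 := sum_rpow_lt_one_of_sum_eq_one
    (letterProb_pos hp) (letterProb_lt_one hp) (sum_letterProb p) one_lt_two
  obtain ⟨K, hclosed, hK⟩ := ((eventually_add_rpow_inv_le hr₀
    (Finset.sum_nonneg fun x _ => by positivity) hρ
    (B := r * (Fintype.card A : ℝ) ^ (r + 1) * (V * (t₀ : ℝ) ^ (2 - 2 / r))) (by positivity)
    C).and (eventually_ge_atTop 0)).exists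
  refine ⟨K, fun m => ?_⟩
  induction m with
  | zero =>
    intro t _
    simp only [truncatedFunctional_zero, lpNorm_fun_zero]
    positivity
  | succ m ih =>
    intro t ht
    have hchild x := (mul_le_of_le_one_left' (letterProb_le_one p x)).trans ht
    have hident x := identDistrib_apply_poissonSubtrie p t x (truncatedFunctional ψ m)
    rw [truncatedFunctional_poissonTrie_succ hψ]
    refine (lpNorm_add_sum_le_of_indep (a := (t : ℝ) ^ (2 / r))
      (w := fun x => (letterProb p x : ℝ) ^ (2 / r)) hr (iIndepFun_apply_poissonSubtrie p t _)
      (fun x => (hident x).memLp_iff.mpr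
        (memLp_truncatedFunctional hψ (fun t ht => (hbound t ht).1) m _ (hchild x)))
      (by positivity) hK (by positivity) (fun x => by positivity)
      (fun x => Real.rpow_le_one (by positivity) (by exact_mod_cast letterProb_le_one p x)
        (by positivity))
      (Finset.sum_le_sum fun x _ => ?_) (hbound t ht).1 (hbound t ht).2 (fun x => ?_)
      fun x => ?_).trans (mul_le_mul_of_nonneg_right hclosed (by positivity))
    · rw [← Real.rpow_mul (by positivity), div_mul_cancel₀ _ hr₀.ne']
    · rw [lpNorm_eq_of_identDistrib (hident x), ← Real.mul_rpow (by positivity) (by positivity)]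
      exact ih _ (hchild x)
    · rw [lpNorm_eq_of_identDistrib (hident x), mul_assoc]
      calc _ ≤ V * (letterProb p x * t : ℝ) ^ 2 := hmean m _ (hchild x)
        _ ≤ V * (t : ℝ) ^ 2 := by
            gcongr
            exact mul_le_of_le_one_left t.coe_nonneg (by exact_mod_cast letterProb_le_one p x)
        _ ≤ V * ((t₀ : ℝ) ^ (2 - 2 / r) * (t : ℝ) ^ (2 / r)) := by
            gcongr
            exact sq_le_rpow_mul_rpow t.coe_nonneg ht hr.le

/-- By Fatou's lemma the bound on the truncated functionals passes to the limit. -/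
lemma memLp_additiveFunctional_of_eq_zero [Nontrivial A] (hp : ∀ x, 0 < p x) (hr : 1 < r)
    (hψ : ∀ S : Finset (ℕ → A), S.card ≤ 1 → ψ (trieOf S) = 0)
    (hψL : MemLp (fun ω => ψ (poissonTrie ω)) (ENNReal.ofReal r) (poissonModel p t₀)) :
    MemLp (fun ω => additiveFunctional ψ (poissonTrie ω)) (ENNReal.ofReal r)
      (poissonModel p t₀) := by
  obtain ⟨C, -, hbound⟩ := exists_memLp_and_lpNorm_poissonTrie_le (one_pos.trans hr) hψ hψL
  obtain ⟨K, hK⟩ := exists_lpNorm_truncatedFunctional_le hp hr hψ hψL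
  have hmem m := memLp_truncatedFunctional hψ (fun t ht => (hbound t ht).1) m t₀ le_rfl
  refine ⟨(measurable_apply_poissonTrie _).aestronglyMeasurable, ?_⟩
  calc _ ≤ liminf (fun m => eLpNorm (fun ω => truncatedFunctional ψ m (poissonTrie ω))
        (ENNReal.ofReal r) (poissonModel p t₀)) atTop :=
        Lp.eLpNorm_lim_le_liminf_eLpNorm (fun m => (hmem m).1) _ <| .of_forall fun ω =>
          tendsto_nhds_of_eventually_eq (eventually_truncatedFunctional_eq ψ _)
    _ ≤ ENNReal.ofReal (K * (t₀ : ℝ) ^ (2 / r)) := by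
        refine (liminf_le_liminf (.of_forall fun m => ?_)).trans_eq (liminf_const _)
        rw [← ENNReal.ofReal_toReal (hmem m).eLpNorm_ne_top, toReal_eLpNorm (hmem m).1]
        exact ENNReal.ofReal_le_ofReal (hK m t₀ le_rfl)
    _ < ⊤ := ENNReal.ofReal_lt_top

end TruncatedMoments

section Perturbation

variable {Ω : Type*} [MeasurableSpace Ω] {μ : Measure Ω} [IsProbabilityMeasure μ] {X Y : Ω → ℝ}
  {r c : ℝ}

lemma memLp_of_abs_sub_le {p : ℝ≥0∞} (hX : MemLp X p μ) (hY : AEStronglyMeasurable Y μ)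
    (hc : ∀ ω, |X ω - Y ω| ≤ c) : MemLp Y p μ := by
  have hdiff : MemLp (X - Y) p μ := by
    refine MemLp.of_bound (hX.1.sub hY) c (ae_of_all μ fun ω => ?_)
    simpa [Real.norm_eq_abs] using hc ω
  simpa using hX.sub hdiff

lemma lpNorm_sub_integral_le_of_abs_sub_le (hr : 1 ≤ r) (hX : MemLp X (ENNReal.ofReal r) μ)
    (hY : AEStronglyMeasurable Y μ) (hc : ∀ ω, |X ω - Y ω| ≤ c) :
    lpNorm (Y · - ∫ ω, Y ω ∂μ) (ENNReal.ofReal r) μ ≤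
      lpNorm (X · - ∫ ω, X ω ∂μ) (ENNReal.ofReal r) μ + 2 * c := by
  have hr' : 1 ≤ ENNReal.ofReal r := ENNReal.one_le_ofReal.mpr hr
  have hYL := memLp_of_abs_sub_le hX hY hc
  have hmean : |∫ ω, X ω ∂μ - ∫ ω, Y ω ∂μ| ≤ c := by
    rw [← integral_sub (hX.integrable hr') (hYL.integrable hr')]
    have hbound : ∀ᵐ ω ∂μ, ‖X ω - Y ω‖ ≤ c := ae_of_all μ hc
    simpa using norm_integral_le_of_norm_le (integrable_const c) hbound
  have hcentre (ω : Ω) : ‖(X ω - ∫ ω, X ω ∂μ) - (Y ω - ∫ ω, Y ω ∂μ)‖ ≤ 2 * c := by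
    rw [sub_sub_sub_comm, Real.norm_eq_abs, two_mul]
    exact (abs_sub _ _).trans (add_le_add (hc ω) hmean)
  have hc0 : 0 ≤ c := (abs_nonneg _).trans hmean
  calc _ ≤ lpNorm (X · - ∫ ω, X ω ∂μ) (ENNReal.ofReal r) μ +
        lpNorm ((X · - ∫ ω, X ω ∂μ) - (Y · - ∫ ω, Y ω ∂μ)) (ENNReal.ofReal r) μ :=
        lpNorm_le_lpNorm_add_lpNorm_sub (hX.sub (memLp_const _)) hr'
    _ ≤ _ := by
        gcongr
        refine (lpNorm_mono_real (memLp_const (2 * c)) hcentre).trans_eq ?_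
        rw [lpNorm_const (by positivity) (IsProbabilityMeasure.ne_zero μ), probReal_univ,
          Real.one_rpow, mul_one, Real.norm_of_nonneg (by positivity)]

lemma variance_le_of_abs_sub_le (hX : MemLp X 2 μ) (hY : AEStronglyMeasurable Y μ)
    (hc : ∀ ω, |X ω - Y ω| ≤ c) : Var[Y; μ] ≤ 2 * Var[X; μ] + 8 * c ^ 2 := by
  have hsd : √Var[Y; μ] ≤ √Var[X; μ] + 2 * c := by
    rw [← lpNorm_two_sub_integral hX, ← lpNorm_two_sub_integral (memLp_of_abs_sub_le hX hY hc)]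
    simpa using lpNorm_sub_integral_le_of_abs_sub_le one_le_two (by simpa using hX) hY hc
  calc Var[Y; μ] = √Var[Y; μ] ^ 2 := (Real.sq_sqrt (variance_nonneg _ _)).symm
    _ ≤ (√Var[X; μ] + 2 * c) ^ 2 := by gcongr
    _ ≤ 2 * (√Var[X; μ] ^ 2 + (2 * c) ^ 2) := add_sq_le
    _ = 2 * Var[X; μ] + 8 * c ^ 2 := by
        rw [Real.sq_sqrt (variance_nonneg _ _)]
        ring

end Perturbation

section PoissonTrie

variable {A : Type*} [Finite A] {φ : Trie A → ℝ}

lemma abs_sub_innerToll_poissonTrie_le [Nonempty A] (hφ : φ (emptyTrie A) = 0)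
    (ω : ℕ × (ℕ → ℕ → A)) :
    |φ (poissonTrie ω) - innerToll φ (poissonTrie ω)| ≤ |leafToll φ| :=
  abs_sub_innerToll_trieOf_le hφ _

variable [MeasurableSpace A] {p : PMF A} {r : ℝ}

lemma exists_lpNorm_poissonTrie_le (hr : 0 < r) {ψ : Trie A → ℝ} {t₀ : ℝ≥0}
    (hψ : MemLp (fun ω => ψ (poissonTrie ω)) (ENNReal.ofReal r) (poissonModel p t₀)) :
    ∃ C, ∀ t ≤ t₀, lpNorm (fun ω => ψ (poissonTrie ω)) (ENNReal.ofReal r) (poissonModel p t) ≤ C :=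
  ⟨_, fun _ ht => by
    simpa using (memLp_and_lpNorm_poissonModel_le hr ht hψ (k := 0) (by simp)).2⟩

variable [DiscreteMeasurableSpace A]

lemma memLp_poissonTrie_of_eventually_integrable (hr : 0 < r) {m : ℝ≥0 → ℝ}
    (h : ∀ᶠ t : ℝ≥0 in atTop,
      Integrable (fun ω => |φ (poissonTrie ω) - m t| ^ r) (poissonModel p t)) (t : ℝ≥0) :
    MemLp (fun ω => φ (poissonTrie ω)) (ENNReal.ofReal r) (poissonModel p t) := by
  obtain ⟨u, hu, htu⟩ := (h.and (eventually_ge_atTop t)).exists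
  have hcentred : MemLp (fun ω => φ (poissonTrie ω) - m u) (ENNReal.ofReal r)
      (poissonModel p u) := by
    rwa [← integrable_norm_rpow_iff
      ((measurable_apply_poissonTrie φ).sub_const _).aestronglyMeasurable (by simpa using hr)
      ENNReal.ofReal_ne_top, ENNReal.toReal_ofReal hr.le]
  have hu' : MemLp (fun ω => φ (poissonTrie ω)) (ENNReal.ofReal r) (poissonModel p u) := by
    simpa [Pi.add_def] using hcentred.add (memLp_const (m u))
  exact (memLp_and_lpNorm_poissonModel_le hr htu hu' (k := 0) (by simp)).1

lemma memLp_card_poissonStrings (p : PMF A) (t q : ℝ≥0) :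
    MemLp (fun ω => ((poissonStrings ω).card : ℝ)) q (poissonModel p t) := by
  have hcount : MemLp (fun ω : ℕ × (ℕ → ℕ → A) => (ω.1 : ℝ)) q (poissonModel p t) :=
    (memLp_natCast_poissonMeasure t q).comp_measurePreserving measurePreserving_fst
  have hmeas : Measurable fun ω : ℕ × (ℕ → ℕ → A) => (poissonStrings ω).card := by
    simp_rw [← prefixCount_nil]
    exact measurable_prefixCount_poissonStrings []
  exact hcount.mono (measurable_from_nat.comp hmeas).aestronglyMeasurable <|
    .of_forall fun ω => by simpa using card_poissonStrings_le ω

lemma memLp_additiveFunctional [Nontrivial A] (hp : ∀ x, 0 < p x) (hφ : φ (emptyTrie A) = 0)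
    (hr : 1 < r) {t : ℝ≥0}
    (hφL : MemLp (fun ω => φ (poissonTrie ω)) (ENNReal.ofReal r) (poissonModel p t)) :
    MemLp (fun ω => additiveFunctional φ (poissonTrie ω)) (ENNReal.ofReal r)
      (poissonModel p t) := by
  have := Fintype.ofFinite A
  have hinner := memLp_additiveFunctional_of_eq_zero hp hr
    (fun S hS => innerToll_trieOf_of_card_le_one φ hS) <| memLp_of_abs_sub_le hφL
      (measurable_apply_poissonTrie (innerToll φ)).aestronglyMeasurable
      (abs_sub_innerToll_poissonTrie_le hφ)
  have hsplit : (fun ω => additiveFunctional φ (poissonTrie ω)) = fun ω =>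
      (poissonStrings ω).card * leafToll φ + additiveFunctional (innerToll φ) (poissonTrie ω) :=
    funext fun ω => additiveFunctional_eq_card_mul_add φ (poissonStrings ω)
  rw [hsplit]
  exact ((memLp_card_poissonStrings p t r.toNNReal).mul_const (leafToll φ)).add hinner

lemma tendsto_variance_innerToll_div [Nonempty A] (hφ : φ (emptyTrie A) = 0)
    (hφL : ∀ t, MemLp (fun ω => φ (poissonTrie ω)) 2 (poissonModel p t))
    (htoll : (fun t : ℝ≥0 => poissonVar p φ t) =o[atTop] fun t : ℝ≥0 => (t : ℝ)) :
    Tendsto (fun t : ℝ≥0 => Var[fun ω => innerToll φ (poissonTrie ω); poissonModel p t] / t)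
      atTop (𝓝 0) := by
  have hconst : Tendsto (fun t : ℝ≥0 => 8 * |leafToll φ| ^ 2 / (t : ℝ)) atTop (𝓝 0) :=
    (NNReal.tendsto_coe_atTop.mpr tendsto_id).const_div_atTop _
  have hbound := (htoll.tendsto_div_nhds_zero.const_mul 2).add hconst
  rw [mul_zero, add_zero] at hbound
  refine squeeze_zero (fun t => div_nonneg (variance_nonneg _ _) t.coe_nonneg) (fun t => ?_) hbound
  rw [← mul_div_assoc, ← add_div]
  gcongr
  exact variance_le_of_abs_sub_le (hφL t) (measurable_apply_poissonTrie _).aestronglyMeasurable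
    (abs_sub_innerToll_poissonTrie_le hφ)

lemma exists_lpNorm_normalized_innerToll_le [Nonempty A] (hφ : φ (emptyTrie A) = 0) (hr : 1 ≤ r)
    (hφL : ∀ t, MemLp (fun ω => φ (poissonTrie ω)) (ENNReal.ofReal r) (poissonModel p t))
    (hmom : (fun t : ℝ≥0 =>
        ∫ ω, |φ (poissonTrie ω) - poissonMean p φ t| ^ r ∂(poissonModel p t))
      =O[atTop] fun t : ℝ≥0 => (t : ℝ) ^ (r / 2)) :
    ∃ C, ∀ᶠ t : ℝ≥0 in atTop,
      lpNorm (normalized (poissonModel p) (fun ω => innerToll φ (poissonTrie ω)) t)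
        (ENNReal.ofReal r) (poissonModel p t) ≤ C := by
  have hr₀ : 0 < r := one_pos.trans_le hr
  obtain ⟨C, hC₀, hC⟩ := hmom.exists_nonneg
  refine ⟨C ^ r⁻¹ + 2 * |leafToll φ|, ?_⟩
  filter_upwards [hC.bound, eventually_ge_atTop 1] with t ht ht₁
  have hsqrt : 1 ≤ √(t : ℝ) := Real.one_le_sqrt.mpr (by exact_mod_cast ht₁)
  have hφt : lpNorm (fun ω => φ (poissonTrie ω) - poissonMean p φ t) (ENNReal.ofReal r)
      (poissonModel p t) ≤ C ^ r⁻¹ * √t := by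
    rw [← Real.rpow_le_rpow_iff lpNorm_nonneg (by positivity) hr₀,
      ← integral_abs_rpow_eq_lpNorm_rpow
        ((measurable_apply_poissonTrie φ).sub_const _).aestronglyMeasurable hr₀,
      Real.mul_rpow (by positivity) (by positivity), Real.rpow_inv_rpow hC₀ hr₀.ne',
      ← Real.rpow_div_two_eq_sqrt r t.coe_nonneg]
    rwa [Real.norm_of_nonneg (integral_nonneg fun ω => by positivity),
      Real.norm_of_nonneg (by positivity)] at ht
  rw [lpNorm_normalized, div_le_iff₀ (one_pos.trans_le hsqrt), add_mul]
  calc _ ≤ lpNorm (fun ω => φ (poissonTrie ω) - poissonMean p φ t) (ENNReal.ofReal r)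
        (poissonModel p t) + 2 * |leafToll φ| :=
        lpNorm_sub_integral_le_of_abs_sub_le hr (hφL t)
          (measurable_apply_poissonTrie _).aestronglyMeasurable
          (abs_sub_innerToll_poissonTrie_le hφ)
    _ ≤ C ^ r⁻¹ * √t + 2 * |leafToll φ| * √t :=
        add_le_add hφt (le_mul_of_one_le_right (by positivity) hsqrt)

lemma eventually_half_mul_le {b v : ℝ≥0 → ℝ} {c : ℝ}
    (hv : Tendsto (fun t : ℝ≥0 => (v t - b t) / t) atTop (𝓝 0)) (hc : 0 < c)
    (hcb : ∀ᶠ t : ℝ≥0 in atTop, c * t ≤ b t) : ∀ᶠ t : ℝ≥0 in atTop, c / 2 * t ≤ v t := by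
  filter_upwards [hcb, hv.eventually_const_le (neg_lt_zero.mpr (half_pos hc)),
    eventually_gt_atTop 0] with t hbt hvt ht
  rw [le_div_iff₀ (by exact_mod_cast ht)] at hvt
  linarith

theorem recursiveFamily_additiveFunctional {A : Type*} [Fintype A] [Nontrivial A]
    [MeasurableSpace A] [DiscreteMeasurableSpace A] {p : PMF A} {φ : Trie A → ℝ}
    (hp : ∀ x, 0 < p x) (hφ : φ (emptyTrie A) = 0) (hr : 2 < r)
    (hvarO : (fun t : ℝ≥0 => poissonVar p (additiveFunctional φ) t) =O[atTop]
      fun t : ℝ≥0 => (t : ℝ))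
    (htoll : (fun t : ℝ≥0 => poissonVar p φ t) =o[atTop] fun t : ℝ≥0 => (t : ℝ))
    (hmomfin : ∀ᶠ t : ℝ≥0 in atTop,
      Integrable (fun ω => |φ (poissonTrie ω) - poissonMean p φ t| ^ r) (poissonModel p t))
    (hmom : (fun t : ℝ≥0 =>
        ∫ ω, |φ (poissonTrie ω) - poissonMean p φ t| ^ r ∂(poissonModel p t))
      =O[atTop] fun t : ℝ≥0 => (t : ℝ) ^ (r / 2)) :
    RecursiveFamily (letterProb p) (poissonModel p)
      (fun ω => additiveFunctional φ (poissonTrie ω)) (fun ω => innerToll φ (poissonTrie ω))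
      (fun x ω => additiveFunctional φ (poissonSubtrie x ω)) r := by
  have hr₀ : 0 < r := two_pos.trans hr
  have hr₁ : 1 < r := one_lt_two.trans hr
  have hφL := memLp_poissonTrie_of_eventually_integrable hr₀ hmomfin
  have hΦL t := memLp_additiveFunctional hp hφ hr₁ (hφL t)
  exact
  { two_lt := hr
    sum_eq_one := sum_letterProb p
    pos := letterProb_pos hp
    lt_one := letterProb_lt_one hp
    isProbabilityMeasure := fun t => inferInstance
    measurable := measurable_apply_poissonTrie _
    measurable_child := fun x =>
      (Measurable.of_discrete (f := additiveFunctional φ)).comp (measurable_poissonSubtrie x)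
    decomp := fun ω => additiveFunctional_trieOf φ (poissonStrings ω)
    indep := fun t => iIndepFun_apply_poissonSubtrie p t _
    identDistrib_child := fun t x => identDistrib_apply_poissonSubtrie p t x _
    memLp := hΦL
    bounded := fun t₀ => exists_lpNorm_poissonTrie_le hr₀ (hΦL t₀)
    variance_le := (div_isBoundedUnder_of_isBigO hvarO).imp fun V hV =>
      (eventually_map.mp hV).mono fun t ht => (le_abs_self _).trans ht
    toll_variance := tendsto_variance_innerToll_div hφ (fun t => (hφL t).mono_exponent <| by
      simpa using ENNReal.ofReal_le_ofReal hr.le) htoll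
    toll_moment := exists_lpNorm_normalized_innerToll_le hφ hr₁.le hφL hmom }

end PoissonTrie

end Tries

end

theorem theoremT1 {A : Type*} [Fintype A] [Nontrivial A] [MeasurableSpace A]
    [DiscreteMeasurableSpace A]
    (p : PMF A) (hp : ∀ x, 0 < p x)
    (φ Φ : Tries.Trie A → ℝ) (hφ : φ (Tries.emptyTrie A) = 0)
    (hΦ : Φ = Tries.additiveFunctional φ)
    (a b : ℝ≥0 → ℝ) (r : ℝ) (hr : 2 < r)
    (hmean : (fun t : ℝ≥0 => Tries.poissonMean p Φ t - a t) =o[atTop] fun t : ℝ≥0 => √(t : ℝ))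
    (hvar : (fun t : ℝ≥0 => Tries.poissonVar p Φ t - b t) =o[atTop] fun t : ℝ≥0 => (t : ℝ))
    (hvarO : (fun t : ℝ≥0 => Tries.poissonVar p Φ t) =O[atTop] fun t : ℝ≥0 => (t : ℝ))
    (htoll : (fun t : ℝ≥0 => Tries.poissonVar p φ t) =o[atTop] fun t : ℝ≥0 => (t : ℝ))
    (hmomfin : ∀ᶠ t : ℝ≥0 in atTop,
      Integrable (fun ω => |φ (Tries.poissonTrie ω) - Tries.poissonMean p φ t| ^ r)
        (Tries.poissonModel p t))
    (hmom : (fun t : ℝ≥0 =>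
        ∫ ω, |φ (Tries.poissonTrie ω) - Tries.poissonMean p φ t| ^ r ∂(Tries.poissonModel p t))
      =O[atTop] fun t : ℝ≥0 => (t : ℝ) ^ (r / 2)) :
    -- part (i), normalized by `a` and `b`
    (Tries.ApproxInDistribution atTop
        (Tries.poissonModel p) (fun t ω => (Φ (Tries.poissonTrie ω) - a t) / √(t : ℝ))
        (fun t => gaussianReal 0 (b t / t).toNNReal) (fun _ y => y) ∧
      Tries.ApproxMomentsBelow atTop
        (Tries.poissonModel p) (fun t ω => (Φ (Tries.poissonTrie ω) - a t) / √(t : ℝ))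
        (fun t => gaussianReal 0 (b t / t).toNNReal) (fun _ y => y) r) ∧
    -- part (i), normalized by the exact mean and variance
    (Tries.ApproxInDistribution atTop
        (Tries.poissonModel p)
        (fun t ω => (Φ (Tries.poissonTrie ω) - Tries.poissonMean p Φ t) / √(t : ℝ))
        (fun t => gaussianReal 0 (Tries.poissonVar p Φ t / t).toNNReal) (fun _ y => y) ∧
      Tries.ApproxMomentsBelow atTop
        (Tries.poissonModel p)
        (fun t ω => (Φ (Tries.poissonTrie ω) - Tries.poissonMean p Φ t) / √(t : ℝ))
        (fun t => gaussianReal 0 (Tries.poissonVar p Φ t / t).toNNReal) (fun _ y => y) r) ∧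
    -- part (ii)
    ((∃ c : ℝ, 0 < c ∧ ∀ᶠ t : ℝ≥0 in atTop, c * t ≤ b t) →
      (TendstoInDistribution (fun t ω => (Φ (Tries.poissonTrie ω) - a t) / √(b t)) atTop
          (fun y : ℝ => y) (fun t => Tries.poissonModel p t) (gaussianReal 0 1) ∧
        Tries.ApproxMomentsBelow atTop
          (Tries.poissonModel p) (fun t ω => (Φ (Tries.poissonTrie ω) - a t) / √(b t))
          (fun _ => gaussianReal 0 1) (fun _ y => y) r) ∧
      (TendstoInDistribution
          (fun t ω => (Φ (Tries.poissonTrie ω) - Tries.poissonMean p Φ t) /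
            √(Tries.poissonVar p Φ t)) atTop
          (fun y : ℝ => y) (fun t => Tries.poissonModel p t) (gaussianReal 0 1) ∧
        Tries.ApproxMomentsBelow atTop
          (Tries.poissonModel p)
          (fun t ω => (Φ (Tries.poissonTrie ω) - Tries.poissonMean p Φ t) /
            √(Tries.poissonVar p Φ t))
          (fun _ => gaussianReal 0 1) (fun _ y => y) r)) := by
  subst hΦ
  have h := Tries.recursiveFamily_additiveFunctional hp hφ hr hvarO htoll hmomfin hmom
  have hmeas := Tries.measurable_apply_poissonTrie (Tries.additiveFunctional φ)
  have ha := hmean.tendsto_div_nhds_zero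
  have hb := hvar.tendsto_div_nhds_zero
  refine ⟨h.approx_div_sqrt ha hb,
    h.approx_div_sqrt (by simp [Tries.poissonMean]) (by simp [Tries.poissonVar]),
    fun ⟨c, hc, hcb⟩ => ?_⟩
  have hvar_ge := Tries.eventually_half_mul_le hb hc hcb
  obtain ⟨hdist, hmoments⟩ := h.approx_div_sqrt_variance ha hb hc hcb
  obtain ⟨hdist', hmoments'⟩ := h.approx_div_sqrt_variance
    (a := Tries.poissonMean p (Tries.additiveFunctional φ))
    (by simp [Tries.poissonMean]) (by simp [Tries.poissonVar]) (half_pos hc) hvar_ge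
  exact ⟨⟨hdist.tendstoInDistribution fun t => (hmeas.sub_const _).div_const _, hmoments⟩,
    ⟨hdist'.tendstoInDistribution fun t => (hmeas.sub_const _).div_const _, hmoments'⟩⟩
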